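/- **Conventions.** Let $H^{10}_{df}$ be the real Hilbert space of divergence-free (in the sense of distributions) vector fields $u:\mathbb R^3\to\mathbb R^3$ of Sobolev regularity $H^{10}$, let $(H^{10}_{df})^*$ be its dual, let $\langle u,v\rangle=\int_{\mathbb R^3}u\cdot v\,dx$, and let $\hat u(\xi)=\int_{\mathbb R^3} u(x)e^{-2\pi i x\cdot\xi}\,dx$. The Euler bilinear operator $B:H^{10}_{df}\times H^{10}_{df}\to (H^{10}_{df})^*$ is defined by $$\langle B(u,v),w\rangle=-\tfrac12\int_{\mathbb R^3}\big((u\cdot\nabla)v\big)\cdot w+\big((v\cdot\nabla)u\big)\cdot w\,dx .$$ For $R\in SO(3)$ and $\lambda>0$ put $\mathrm{Rot}_R u(x)=Ru(R^{-1}x)$ and $\mathrm{Dil}_\lambda u(x)=\lambda^{3/2}u(\lambda x)$. A real Fourier multiplier of order $0$ is an operator $m(D)$, $\widehat{m(D)u}(\xi)=m(\xi)\hat u(\xi)$, where $m$ is complex-valued and smooth on $\mathbb R^3\setminus\{0\}$, $m(-\xi)=\overline{m(\xi)}$, and $\|m\|_k=\sup_{\xi\ne0}|\xi|^k|\nabla^k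 m(\xi)|<\infty$ for all $k\ge 0$; the space $\mathcal M_0$ of these carries the topology of the seminorms $\|\cdot\|_k$ and its Borel $\sigma$-algebra. **Averaged Euler bilinear operators.** A bounded bilinear operator $\tilde B:H^{10}_{df}\times H^{10}_{df}\to(H^{10}_{df})^*$ is an averaged Euler bilinear operator if there are a probability space $(\Omega,\mu)$ and measurable maps $m_i:\Omega\to\mathcal M_0$, $R_i:\Omega\to SO(3)$, $\lambda_i:\Omega\to(0,\infty)$ ($i=1,2,3$) such that $\int_\Omega\|m_{1,\omega}\|_{k_1}\|m_{2,\omega}\|_{k_2}\|m_{3,\omega}\|_{k_3}\,d\mu(\omega)<\infty$ for all $k_1,k_2,k_3\ge 0$, such that $A^{-1}\le\lambda_i(\omega)\le A$ for some finite $A$ and all $i,\omega$, and such that for all $u,v,w\in H^{10}_{df}$ $$\langle\tilde B(u,v),w\rangle=\int_\Omega\Big\langle B\big(m_{1,\omega}(D)\mathrm{Rot}_{R_{1,\omega}}\mathrm{Dil}_{\lambda_{1,\omega}}u,\;m_{2,\omega}(D)\mathrm{Rot}_{R_{2,\omega}}\mathrm{Dil}_{\lambda_{2,\omega}}v\big),\;m_{3,\omega}(D)\mathrm{Rot}_{R_{3,\omega}}\mathrm{Dil}_{\lambda_{3,\omega}}w\Big\rangle\,d\mu(\omega),$$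 where the integral converges absolutely. **Local cascade operators.** Let $\epsilon_0>0$. A basic local cascade operator with dyadic scale parameter $\epsilon_0$ is a bounded bilinear operator $C:H^{10}_{df}\times H^{10}_{df}\to(H^{10}_{df})^*$ given by the absolutely convergent series $$\langle C(u,v),w\rangle=\sum_{n\in\mathbb Z}(1+\epsilon_0)^{5n/2}\langle u,\psi_{1,n}\rangle\langle v,\psi_{2,n}\rangle\langle w,\psi_{3,n}\rangle\qquad(u,v,w\in H^{10}_{df}),$$ where $\psi_{i,n}(x)=(1+\epsilon_0)^{3n/2}\psi_i((1+\epsilon_0)^nx)$ and $\psi_1,\psi_2,\psi_3:\mathbb R^3\to\mathbb R^3$ are Schwartz functions whose Fourier transforms are supported on $\{\xi:1-2\epsilon_0\le|\xi|\le1+2\epsilon_0\}$. A local cascade operator is a finite (real) linear combination of basic ones with the same $\epsilon_0$. **Theorem.** There is an absolute constant $\epsilon>0$ such that for every $0<\epsilon_0<\epsilon$: for all $\psi_1,\psi_2,\psi_3$ as above the series converges absolutely and defines a bounded bilinear operator, and every local cascade operator with dyadic scale parameter $\epsilon_0$ is an averaged Euler bilinear operator. -/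

import Mathlib

open MeasureTheory FourierTransform TemperedDistribution
open scoped SchwartzMap LineDeriv ENNReal

namespace AveragedEuler

noncomputable section

/-! ### Vector fields on `ℝ³` -/

/-- Euclidean space `ℝ³`. -/
abbrev R3 : Type := EuclideanSpace ℝ (Fin 3)

/-- The values of complex vector fields, `ℂ³`. -/
abbrev C3 : Type := EuclideanSpace ℂ (Fin 3)

/-- Square-integrable complex vector fields on `ℝ³`.  A real vector field is a complex vector field
all of whose components have zero imaginary part. -/
abbrev L2Field : Type := Lp C3 2 (volume : Measure R3)

/-- The `i`-th standard basis vector of `ℝ³`. -/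
def stdVec (i : Fin 3) : R3 := EuclideanSpace.single i 1

/-- The `L²` pairing `⟨u, v⟩ = ∫ u · v dx`, which for real fields is a real number.
(The dot product is the bilinear one.) -/
def pairing (u v : R3 → C3) : ℝ := (∫ x, ∑ i, u x i * v x i).re

/-- `u` is divergence free in the sense of distributions: `∑ i, ∂ᵢ uᵢ = 0`, tested against Schwartz
functions. -/
def IsDivFree (u : L2Field) : Prop :=
  ∀ φ : 𝓢(R3, ℂ), ∑ i, (∂_{stdVec i} (u : 𝓢'(R3, C3))) φ i = 0

theorem toTempered_injective {u v : L2Field} (h : (u : 𝓢'(R3, C3)) = v) : u = v := by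
  have hk := Lp.ker_toTemperedDistributionCLM_eq_bot (F := C3) (p := 2)
    (μ := (volume : Measure R3))
  exact LinearMap.ker_eq_bot.1 hk h

theorem toTempered_add (u v : L2Field) :
    ((u + v : L2Field) : 𝓢'(R3, C3)) = (u : 𝓢'(R3, C3)) + v :=
  map_add (Lp.toTemperedDistributionCLM C3 (volume : Measure R3) 2) u v

theorem toTempered_smul (c : ℂ) (u : L2Field) :
    ((c • u : L2Field) : 𝓢'(R3, C3)) = c • (u : 𝓢'(R3, C3)) :=
  map_smul (Lp.toTemperedDistributionCLM C3 (volume : Measure R3) 2) c u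

theorem toTempered_zero : ((0 : L2Field) : 𝓢'(R3, C3)) = 0 :=
  map_zero (Lp.toTemperedDistributionCLM C3 (volume : Measure R3) 2)

/-- The real vector space of real vector fields of regularity `H¹⁰` that are divergence free. -/
def h10dfSubmodule : Submodule ℝ L2Field where
  carrier := {u | (∀ᵐ x, ∀ i, (u x i).im = 0) ∧ MemSobolev 10 2 (u : 𝓢'(R3, C3)) ∧ IsDivFree u}
  zero_mem' := by
    refine ⟨?_, ?_, ?_⟩
    · filter_upwards [Lp.coeFn_zero C3 2 (volume : Measure R3)] with x hx i
      simp
    · rw [toTempered_zero]; exact memSobolev_fun_zero _ _ _ _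
    · intro φ
      simp only [lineDerivOp_apply_apply, toTempered_zero]
      simp
  add_mem' := by
    rintro u v ⟨hu, hu', hu''⟩ ⟨hv, hv', hv''⟩
    refine ⟨?_, ?_, ?_⟩
    · filter_upwards [hu, hv, Lp.coeFn_add u v] with x h1 h2 h3 i
      rw [h3]
      simp [h1 i, h2 i]
    · rw [toTempered_add]; exact hu'.add hv'
    · intro φ
      have h1 := hu'' φ
      have h2 := hv'' φ
      rw [toTempered_add]
      simp only [lineDerivOp_apply_apply] at h1 h2 ⊢
      have h3 : ∀ (a b : 𝓢'(R3, C3)) (f : 𝓢(R3, ℂ)) (i : Fin 3),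
        (a + b) f i = a f i + b f i := fun _ _ _ _ ↦ rfl
      simp only [h3, Finset.sum_add_distrib, h1, h2, add_zero]
  smul_mem' := by
    rintro c u ⟨hu, hu', hu''⟩
    have hc : c • u = (c : ℂ) • u := by
      apply Lp.ext
      filter_upwards [Lp.coeFn_smul c u, Lp.coeFn_smul (c : ℂ) u] with x h1 h2
      rw [h1, h2]
      ext i
      simp
    refine ⟨?_, ?_, ?_⟩
    · filter_upwards [hu, Lp.coeFn_smul c u] with x h1 h2 i
      simp [h2, h1 i]
    · rw [hc, toTempered_smul]; exact hu'.smul _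
    · intro φ
      have h1 := hu'' φ
      rw [hc, toTempered_smul]
      simp only [lineDerivOp_apply_apply] at h1 ⊢
      have h3 : ∀ (a : 𝓢'(R3, C3)) (f : 𝓢(R3, ℂ)) (i : Fin 3),
        ((c : ℂ) • a) f i = (c : ℂ) * a f i := fun _ _ _ ↦ rfl
      simp only [h3, ← Finset.mul_sum, h1, mul_zero]

/-- The space `H¹⁰_df(ℝ³)`, carrying the `H¹⁰` norm (below) rather than the `L²` norm. -/
def H10df : Type := h10dfSubmodule

instance : AddCommGroup H10df := inferInstanceAs (AddCommGroup h10dfSubmodule)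

instance : Module ℝ H10df := inferInstanceAs (Module ℝ h10dfSubmodule)

/-- The underlying square-integrable field of an element of `H¹⁰_df`. -/
def H10df.toL2 (u : H10df) : L2Field := h10dfSubmodule.subtype u

theorem H10df.memSobolev (u : H10df) : MemSobolev 10 2 (u.toL2 : 𝓢'(R3, C3)) := u.2.2.1

/-- The Bessel potential `J u` of order `10` of `u`, that is
`𝓕⁻¹ ((1 + |ξ|²)⁵ û)`, as a square-integrable field. -/
def H10df.bessel (u : H10df) : L2Field := u.memSobolev.choose

theorem H10df.bessel_spec (u : H10df) :
    besselPotential R3 C3 10 (u.toL2 : 𝓢'(R3, C3)) = (u.bessel : 𝓢'(R3, C3)) :=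
  u.memSobolev.choose_spec

/-- The Bessel potential as a linear map. -/
def besselLin : H10df →ₗ[ℝ] L2Field where
  toFun := H10df.bessel
  map_add' u v := by
    apply toTempered_injective
    rw [toTempered_add, ← H10df.bessel_spec, ← H10df.bessel_spec, ← H10df.bessel_spec, ← map_add,
      ← toTempered_add]
    rfl
  map_smul' c u := by
    have hc : ∀ w : L2Field, c • w = (c : ℂ) • w := by
      intro w
      apply Lp.ext
      filter_upwards [Lp.coeFn_smul c w, Lp.coeFn_smul (c : ℂ) w] with x h1 h2
      rw [h1, h2]
      ext i
      simp
    apply toTempered_injective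
    rw [RingHom.id_apply, hc, toTempered_smul, ← H10df.bessel_spec, ← H10df.bessel_spec,
      ← map_smul, ← toTempered_smul, ← hc]
    rfl

theorem besselLin_injective : Function.Injective besselLin := by
  intro u v h
  have h1 : besselPotential R3 C3 10 (u.toL2 : 𝓢'(R3, C3)) =
      besselPotential R3 C3 10 (v.toL2 : 𝓢'(R3, C3)) := by
    rw [H10df.bessel_spec, H10df.bessel_spec]
    exact congrArg _ h
  have h2 := congrArg (besselPotential R3 C3 (-10)) h1
  rw [besselPotential_besselPotential_apply, besselPotential_besselPotential_apply] at h2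
  simp only [add_neg_cancel, besselPotential_zero, ContinuousLinearMap.id_apply] at h2
  exact Subtype.ext (toTempered_injective h2)

/-- The `H¹⁰` norm `‖u‖ = ‖(1 + |ξ|²)⁵ û‖_{L²}`. -/
instance : NormedAddCommGroup H10df :=
  NormedAddCommGroup.induced H10df L2Field besselLin besselLin_injective

instance : NormedSpace ℝ H10df := NormedSpace.induced ℝ H10df L2Field besselLin

/-- Bounded bilinear operators `H¹⁰_df × H¹⁰_df → (H¹⁰_df)*`; `T u v w` is `⟨T(u, v), w⟩`. -/
abbrev BilinOp : Type := H10df →L[ℝ] H10df →L[ℝ] StrongDual ℝ H10df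

/-! ### The Euler bilinear operator -/

open Classical in
/-- The weak partial derivative `∂ⱼ u`: the square-integrable field that represents the
distributional derivative of `u`.  It exists as soon as `u` has regularity `H¹`
(see `weakPartial_spec`), and it is unique by `toTempered_injective`. -/
def weakPartial (j : Fin 3) (u : L2Field) : L2Field :=
  if h : ∃ g : L2Field, ∂_{stdVec j} (u : 𝓢'(R3, C3)) = g then h.choose else 0

theorem weakPartial_spec (j : Fin 3) {u : L2Field} (hu : MemSobolev 1 2 (u : 𝓢'(R3, C3))) :
    ∂_{stdVec j} (u : 𝓢'(R3, C3)) = weakPartial j u := by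
  have h : ∃ g : L2Field, ∂_{stdVec j} (u : 𝓢'(R3, C3)) = g := by
    have h1 := hu.lineDerivOp (m := stdVec j)
    rw [sub_self] at h1
    exact memSobolev_zero_iff.1 h1
  rw [weakPartial, dif_pos h]
  exact h.choose_spec

/-- The convection term `∫ ((u · ∇) v) · w dx`. -/
def convection (u v w : L2Field) : ℝ :=
  (∫ x, ∑ i, (∑ j, u x j * weakPartial j v x i) * w x i).re

/-- The Euler trilinear form
`⟨B(u, v), w⟩ = - ½ ∫ ((u · ∇) v) · w + ((v · ∇) u) · w dx`,
which defines the Euler bilinear operator `B` by duality.  It is written for square-integrable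
fields in order not to carry proofs around, and it is only used for fields of `H¹⁰_df`, where the
weak derivatives exist and the integrals converge. -/
def eulerForm (u v w : L2Field) : ℝ := -(1 / 2) * (convection u v w + convection v u w)

/-! ### Rotations, dilations and Fourier multipliers of order zero -/

/-- The rotation group `SO(3)`. -/
abbrev SO3 : Type := Matrix.specialOrthogonalGroup (Fin 3) ℝ

/-- The action `x ↦ R x` of a rotation on `ℝ³`. -/
def rotSpace (R : SO3) : R3 →L[ℝ] R3 := Matrix.toEuclideanCLM (𝕜 := ℝ) (R : Matrix _ _ ℝ)

/-- The action `X ↦ R X` of a rotation on `ℂ³`. -/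
def rotValue (R : SO3) : C3 →L[ℂ] C3 :=
  Matrix.toEuclideanCLM (𝕜 := ℂ) ((R : Matrix _ _ ℝ).map Complex.ofReal)

theorem rotSpace_measurePreserving (R : SO3) : MeasurePreserving (rotSpace R) := by
  have h : rotSpace R ∈ unitary (R3 →L[ℝ] R3) :=
    Unitary.map_mem (Matrix.toEuclideanCLM (𝕜 := ℝ) (n := Fin 3))
      (Matrix.mem_specialOrthogonalGroup_iff.1 R.2).1
  exact (Unitary.linearIsometryEquiv ⟨rotSpace R, h⟩).measurePreserving

/-- The rotated field `Rot_R u (x) = R u(R⁻¹ x)`. -/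
def rot (R : SO3) (u : L2Field) : L2Field :=
  (rotValue R).compLp (Lp.compMeasurePreserving (rotSpace R⁻¹) (rotSpace_measurePreserving R⁻¹) u)

theorem memLp_dil (c : Set.Ioi (0 : ℝ)) (u : L2Field) :
    MemLp (fun x : R3 ↦ (c : ℝ) ^ (3 / 2 : ℝ) • u ((c : ℝ) • x)) 2 volume := by
  have hc : (c : ℝ) ≠ 0 := ne_of_gt c.2
  have h1 : MemLp u 2 (Measure.map (fun x : R3 ↦ (c : ℝ) • x) volume) := by
    rw [Measure.map_addHaar_smul _ hc]
    exact (Lp.memLp u).smul_measure ENNReal.ofReal_ne_top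
  exact (h1.comp_of_map (by fun_prop)).const_smul ((c : ℝ) ^ (3 / 2 : ℝ))

/-- The dilated field `Dil_c u (x) = c^{3/2} u(c x)`, for `c > 0`. -/
def dil (c : Set.Ioi (0 : ℝ)) (u : L2Field) : L2Field := (memLp_dil c u).toLp _

/-- The seminorm `‖m‖_k = sup_{ξ ≠ 0} |ξ|^k |∇^k m(ξ)|`, with values in `[0, ∞]`. -/
def symbolSeminorm (k : ℕ) (m : R3 → ℂ) : ℝ≥0∞ :=
  ⨆ (ξ : R3) (_ : ξ ≠ 0), ‖ξ‖ₑ ^ k * ‖iteratedFDeriv ℝ k m ξ‖ₑ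

/-- The space of real Fourier multipliers of order `0`, represented by their symbols `m`: smooth
away from the origin, with all seminorms finite, and with `m(-ξ)` the complex conjugate of `m(ξ)`.
The value of `m` at the origin plays no role. -/
structure RealMultiplier where
  /-- the symbol -/
  symbol : R3 → ℂ
  smooth : ContDiffOn ℝ (⊤ : ℕ∞) symbol {0}ᶜ
  bounded : ∀ k, symbolSeminorm k symbol < ∞
  real : ∀ ξ, ξ ≠ 0 → symbol (-ξ) = starRingEnd ℂ (symbol ξ)

/-- The topology on multipliers defined by the seminorms `‖·‖_k`: it is generated by the open
balls of these seminorms. -/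
instance : TopologicalSpace RealMultiplier :=
  TopologicalSpace.generateFrom
    {S | ∃ (k : ℕ) (m₀ : RealMultiplier) (r : ℝ≥0∞),
      S = {m | symbolSeminorm k (m.symbol - m₀.symbol) < r}}

/-- The Borel `σ`-algebra of this topology. -/
instance : MeasurableSpace RealMultiplier := borel RealMultiplier

theorem RealMultiplier.memLp_top (m : RealMultiplier) :
    MemLp m.symbol ∞ (volume : Measure R3) := by
  have hae : ∀ᵐ ξ : R3, ξ ∈ ({0}ᶜ : Set R3) := by
    rw [ae_iff]
    simp
  refine memLp_top_of_bound (C := (symbolSeminorm 0 m.symbol).toReal) ?_ ?_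
  · rw [← Measure.restrict_eq_self_of_ae_mem hae]
    exact m.smooth.continuousOn.aestronglyMeasurable (measurableSet_singleton _).compl
  · filter_upwards [hae] with ξ hξ
    have h1 : ‖m.symbol ξ‖ₑ ≤ symbolSeminorm 0 m.symbol := by
      refine le_trans (le_of_eq ?_) (le_iSup₂ (f := fun (ξ : R3) (_ : ξ ≠ 0) ↦
        ‖ξ‖ₑ ^ 0 * ‖iteratedFDeriv ℝ 0 m.symbol ξ‖ₑ) ξ hξ)
      rw [pow_zero, one_mul, ← ofReal_norm, ← ofReal_norm, norm_iteratedFDeriv_zero]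
    have h2 := ENNReal.toReal_mono (m.bounded 0).ne h1
    simpa using h2

/-- The operator `m(D)`, which multiplies the Fourier transform of a field by `m(ξ)`. -/
def mult (m : RealMultiplier) (u : L2Field) : L2Field :=
  𝓕⁻ ((m.memLp_top.toLp m.symbol • 𝓕 u : L2Field))

/-! ### Averaged Euler bilinear operators -/

/-- `T` is an averaged Euler bilinear operator:
`⟨T(u, v), w⟩ = ∫_Ω ⟨B(m₁(D) Rot_{R₁} Dil_{c₁} u, m₂(D) Rot_{R₂} Dil_{c₂} v),
m₃(D) Rot_{R₃} Dil_{c₃} w⟩ dμ`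
with a probability space `(Ω, μ)` and measurable families of real multipliers `mᵢ` of order `0`,
rotations `Rᵢ` and dilation factors `cᵢ`, such that all moments
`∫_Ω ‖m₁‖_{k₁} ‖m₂‖_{k₂} ‖m₃‖_{k₃} dμ` are finite and the dilation factors are bounded from above
and below.  (The operators `mᵢ(D)`, `Rot` and `Dil` preserve `H¹⁰_df`.)  The integrals that define `T` are required to converge absolutely. -/
def IsAveragedEuler (T : BilinOp) : Prop :=
  ∃ (Ω : Type) (_ : MeasurableSpace Ω) (μ : Measure Ω) (_ : IsProbabilityMeasure μ)
    (m : Fin 3 → Ω → RealMultiplier) (R : Fin 3 → Ω → SO3) (c : Fin 3 → Ω → Set.Ioi (0 : ℝ)),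
    (∀ i, Measurable (m i)) ∧
    (∀ i a b, Measurable fun ω ↦ (R i ω : Matrix (Fin 3) (Fin 3) ℝ) a b) ∧
    (∀ i, Measurable (c i)) ∧
    (∀ k : Fin 3 → ℕ, ∫⁻ ω, ∏ i, symbolSeminorm (k i) (m i ω).symbol ∂μ < ∞) ∧
    (∃ A : ℝ, 0 < A ∧ ∀ i ω, A⁻¹ ≤ (c i ω : ℝ) ∧ (c i ω : ℝ) ≤ A) ∧
    ∀ u v w : H10df,
      let integrand : Ω → ℝ := fun ω ↦ eulerForm
        (mult (m 0 ω) (rot (R 0 ω) (dil (c 0 ω) u.toL2)))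
        (mult (m 1 ω) (rot (R 1 ω) (dil (c 1 ω) v.toL2)))
        (mult (m 2 ω) (rot (R 2 ω) (dil (c 2 ω) w.toL2)))
      Integrable integrand μ ∧ T u v w = ∫ ω, integrand ω ∂μ

/-! ### Local cascade operators -/

/-- `ψ` is a real Schwartz vector field whose Fourier transform is supported on the annulus
`1 - 2ε ≤ |ξ| ≤ 1 + 2ε`. -/
def IsWavelet (ε : ℝ) (ψ : 𝓢(R3, C3)) : Prop :=
  (∀ x i, (ψ x i).im = 0) ∧
    ∀ ξ ∈ Function.support (𝓕 ψ : 𝓢(R3, C3)), 1 - 2 * ε ≤ ‖ξ‖ ∧ ‖ξ‖ ≤ 1 + 2 * ε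

/-- The `L²`-rescaled function `ψ_n (x) = (1 + ε)^{3n/2} ψ((1 + ε)^n x)`. -/
def rescale (ε : ℝ) (ψ : 𝓢(R3, C3)) (n : ℤ) : R3 → C3 :=
  fun x ↦ (1 + ε) ^ (3 * (n : ℝ) / 2) • ψ ((1 + ε) ^ n • x)

/-- The `n`-th term of the series that defines the basic local cascade operator with wavelets
`ψ₁, ψ₂, ψ₃`. -/
def cascadeTerm (ε : ℝ) (ψ : Fin 3 → 𝓢(R3, C3)) (u v w : H10df) (n : ℤ) : ℝ :=
  (1 + ε) ^ (5 * (n : ℝ) / 2) * pairing u.toL2 (rescale ε (ψ 0) n) *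
    pairing v.toL2 (rescale ε (ψ 1) n) * pairing w.toL2 (rescale ε (ψ 2) n)

/-- `C` is the operator given by
`⟨C(u, v), w⟩ = ∑_{n ∈ ℤ} (1 + ε)^{5n/2} ⟨u, ψ_{1,n}⟩ ⟨v, ψ_{2,n}⟩ ⟨w, ψ_{3,n}⟩`,
an absolutely convergent series. -/
def IsCascadeWith (ε : ℝ) (ψ : Fin 3 → 𝓢(R3, C3)) (C : BilinOp) : Prop :=
  ∀ u v w : H10df, HasSum (cascadeTerm ε ψ u v w) (C u v w)

/-- Basic local cascade operators with dyadic scale parameter `ε`. -/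
def IsBasicLocalCascade (ε : ℝ) (C : BilinOp) : Prop :=
  ∃ ψ : Fin 3 → 𝓢(R3, C3), (∀ i, IsWavelet ε (ψ i)) ∧ IsCascadeWith ε ψ C

set_option maxSynthPendingDepth 5 in
/-- Local cascade operators with dyadic scale parameter `ε`: the finite linear combinations of
basic ones. -/
def IsLocalCascade (ε : ℝ) (C : BilinOp) : Prop :=
  C ∈ Submodule.span ℝ {C : BilinOp | IsBasicLocalCascade ε C}

end

end AveragedEuler

open MeasureTheory FourierTransform TemperedDistribution
open scoped SchwartzMap LineDeriv ENNReal

namespace AveragedEuler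

noncomputable section

/-! ### Test functions and the Fourier transform on `L²` -/

/-! On the Fourier side the Euler form is an integral of `triKernel` over triples of frequencies of
sum zero (`convection_eq`). The three arguments are sampled independently, so averaging the form
amounts to averaging each argument (`integral_integral_triKernel`). It therefore suffices to find,
for each argument, a random multiplier, rotation and dilation whose mean effect is `u ↦ ∑ₙ cₙ(u)
Zₙ`, with `cₙ` a wavelet coefficient and `Zₙ` the rescalings of one fixed field.

One argument (`integral_orbit`, `Leg.integral_hat`). Let `R` be Haar distributed and `ζ` uniform in
a shell, and let the multiplier be, up to a power of `|ζ|`, the scalar `g(|ζ| R⁻¹ η) · R⁻¹ Y(η)`.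
For fixed `η` the point `|ζ| R⁻¹ η` sweeps out space with a multiple of Lebesgue measure, so the
mean is an integral over all of `û`. The stabiliser of `η` fixes the direction of the result: adding
the contribution of a quarter turn about `η`, of which `Y(η)` is an eigenvector, projects `û` to
helicity `σ`, and the vectors of helicity `σ` at `η` form a complex line (`smul_dotC_swap`). The
mean is a coefficient of the helicity part of `u` times `Y(η) / |η|³`. Since multipliers of order
zero may be invariant under dilation by `Q`, one periodized symbol serves all scales `Qⁿ`.

Three arguments. The fields `Y` are concentrated near plus and minus three frequencies of sum zero.
For `Q ≥ 100` frequencies of different scales then never sum to zero (`sameScale_bumpField`), so the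
form of the means is diagonal in the scale, and scaling produces `Q^{5n/2}` times a constant
(`hasSum_triForm_mean`). The constant is nonzero for narrow cutoffs, because the symmetrized kernel
is nonzero at the chosen frequencies for every choice of helicities (`exists_triForm_ne`).

The general operator follows from closure of averaged forms under linear combinations: each argument
splits into two helicities, and the exponents `n` split into residue classes modulo `N`, where `Q =
(1 + ε)^N ≥ 100`. -/

theorem locallyIntegrable_coe (f : L2Field) : LocallyIntegrable (f : R3 → C3) :=
  (Lp.memLp f).locallyIntegrable (by norm_num)

theorem ae_eq_of_schwartz {f h : R3 → C3} (hf : LocallyIntegrable f) (hh : LocallyIntegrable h)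
    (H : ∀ φ : 𝓢(R3, ℂ), ∫ x, φ x • f x = ∫ x, φ x • h x) : f =ᵐ[volume] h := by
  refine ae_eq_of_integral_contDiff_smul_eq hf hh fun g hg hc ↦ ?_
  have hg₁ : HasCompactSupport (Complex.ofRealCLM ∘ g) := hc.comp_left rfl
  have hg₂ : ContDiff ℝ (⊤ : ℕ∞) (Complex.ofRealCLM ∘ g) := by fun_prop
  have := H (hg₁.toSchwartzMap hg₂)
  simpa using this

theorem integral_smul_fourier (f : L2Field) (φ : 𝓢(R3, ℂ)) :
    ∫ x, φ x • (𝓕 f : L2Field) x = ∫ x, (𝓕 φ : 𝓢(R3, ℂ)) x • f x := by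
  have h : (f : 𝓢'(R3, C3)) (𝓕 φ) = ((𝓕 f : L2Field) : 𝓢'(R3, C3)) φ :=
    congrArg (fun T : 𝓢'(R3, C3) ↦ T φ) (Lp.fourier_toTemperedDistribution_eq f)
  rw [Lp.toTemperedDistribution_apply, Lp.toTemperedDistribution_apply] at h
  exact h.symm

/-- The transform on `L²` has no pointwise formula. It is identified by moving it onto a Schwartz
test function, where the integral formula applies; the rules below for rotations, dilations and
modulations come from this. -/
theorem fourier_ae_eq {f : L2Field} {h : R3 → C3} (hh : LocallyIntegrable h)
    (H : ∀ φ : 𝓢(R3, ℂ), ∫ x, (𝓕 φ : 𝓢(R3, ℂ)) x • f x = ∫ x, φ x • h x) :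
    (𝓕 f : L2Field) =ᵐ[volume] h :=
  ae_eq_of_schwartz (locallyIntegrable_coe _) hh fun φ ↦ by rw [integral_smul_fourier, H]

theorem fourier_schwartz_apply (φ : 𝓢(R3, ℂ)) (x : R3) :
    (𝓕 φ : 𝓢(R3, ℂ)) x = ∫ y, 𝐞 (-inner ℝ y x) • φ y := by
  rw [SchwartzMap.fourier_coe, Real.fourier_eq]

/-! ### Rotations -/

theorem rotSpace_apply (R : SO3) (x : R3) (i : Fin 3) :
    rotSpace R x i = ∑ j, (R : Matrix (Fin 3) (Fin 3) ℝ) i j * x j := by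
  simp [rotSpace, Matrix.ofLp_toEuclideanCLM, Matrix.mulVec, dotProduct]

theorem rotValue_apply (R : SO3) (x : C3) (i : Fin 3) :
    rotValue R x i = ∑ j, ((R : Matrix (Fin 3) (Fin 3) ℝ) i j : ℂ) * x j := by
  simp [rotValue, Matrix.ofLp_toEuclideanCLM, Matrix.mulVec, dotProduct]

theorem rotSpace_mul (R S : SO3) (x : R3) : rotSpace (R * S) x = rotSpace R (rotSpace S x) := by
  simp [rotSpace]

theorem rotSpace_one (x : R3) : rotSpace 1 x = x := by
  simp [rotSpace]

theorem rotValue_mul (R S : SO3) (x : C3) : rotValue (R * S) x = rotValue R (rotValue S x) := by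
  have h : ((R * S : SO3) : Matrix (Fin 3) (Fin 3) ℝ).map Complex.ofReal =
    (R : Matrix (Fin 3) (Fin 3) ℝ).map Complex.ofReal *
      (S : Matrix (Fin 3) (Fin 3) ℝ).map Complex.ofReal := by
    rw [Submonoid.coe_mul]
    exact Matrix.map_mul (f := Complex.ofRealHom)
  simp only [rotValue, h, map_mul]
  rfl

theorem rotValue_one (x : C3) : rotValue 1 x = x := by
  have h : ((1 : SO3) : Matrix (Fin 3) (Fin 3) ℝ).map Complex.ofReal = 1 := by
    simp
  simp only [rotValue, h, map_one]
  rfl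

theorem rotSpace_inner (R : SO3) (x y : R3) :
    inner ℝ (rotSpace R x) (rotSpace R y) = inner ℝ x y := by
  have h : rotSpace R ∈ unitary (R3 →L[ℝ] R3) :=
    Unitary.map_mem (Matrix.toEuclideanCLM (𝕜 := ℝ) (n := Fin 3))
      (Matrix.mem_specialOrthogonalGroup_iff.1 R.2).1
  exact (Unitary.linearIsometryEquiv ⟨rotSpace R, h⟩).inner_map_map x y

/-- A rotation of `ℝ³` as a linear isometric equivalence. -/
def rotIso (R : SO3) : R3 ≃ₗᵢ[ℝ] R3 where
  toFun := rotSpace R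
  invFun := rotSpace R⁻¹
  map_add' := map_add _
  map_smul' := map_smul _
  left_inv x := by rw [← rotSpace_mul, inv_mul_cancel, rotSpace_one]
  right_inv x := by rw [← rotSpace_mul, mul_inv_cancel, rotSpace_one]
  norm_map' x := by
    have h := rotSpace_inner R x x
    rw [real_inner_self_eq_norm_sq, real_inner_self_eq_norm_sq] at h
    exact (sq_eq_sq₀ (norm_nonneg _) (norm_nonneg _)).1 h

theorem rotIso_apply (R : SO3) (x : R3) : rotIso R x = rotSpace R x := rfl

theorem norm_rotSpace (R : SO3) (x : R3) : ‖rotSpace R x‖ = ‖x‖ := (rotIso R).norm_map x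

theorem norm_rotValue (R : SO3) (x : C3) : ‖rotValue R x‖ = ‖x‖ := by
  have h : rotValue R ∈ unitary (C3 →L[ℂ] C3) := by
    refine Unitary.map_mem (Matrix.toEuclideanCLM (𝕜 := ℂ) (n := Fin 3)) ?_
    have h1 := (Matrix.mem_specialOrthogonalGroup_iff.1 R.2).1
    rw [Matrix.mem_orthogonalGroup_iff] at h1
    rw [← Matrix.unitaryGroup, Matrix.mem_unitaryGroup_iff]
    have h2 := congrArg (fun M : Matrix (Fin 3) (Fin 3) ℝ ↦ M.map Complex.ofRealHom) h1
    simp only [Matrix.map_mul] at h2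
    rw [Matrix.map_one _ (map_zero _) (map_one _)] at h2
    rw [← h2]
    congr 1
    ext i j
    simp
  exact (Unitary.linearIsometryEquiv ⟨rotValue R, h⟩).norm_map x

/-! ### The Fourier transform of rotated, dilated and multiplied fields -/

theorem fourier_mult (m : RealMultiplier) (u : L2Field) :
    (𝓕 (mult m u) : L2Field) =ᵐ[volume] fun ξ ↦ m.symbol ξ • (𝓕 u : L2Field) ξ := by
  have h : (𝓕 (mult m u) : L2Field) = (m.memLp_top.toLp m.symbol • 𝓕 u : L2Field) :=
    fourier_fourierInv_eq _
  rw [h]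
  filter_upwards [Lp.coeFn_lpSMul (r := 2) (m.memLp_top.toLp m.symbol) (𝓕 u : L2Field),
    m.memLp_top.coeFn_toLp] with ξ h1 h2
  rw [h1, Pi.smul_apply', h2]

theorem rot_ae (R : SO3) (u : L2Field) :
    rot R u =ᵐ[volume] fun x ↦ rotValue R (u (rotSpace R⁻¹ x)) := by
  filter_upwards [(rotValue R).coeFn_compLp (Lp.compMeasurePreserving (rotSpace R⁻¹)
    (rotSpace_measurePreserving R⁻¹) u),
    Lp.coeFn_compMeasurePreserving u (rotSpace_measurePreserving R⁻¹)] with x h1 h2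
  rw [rot, h1, h2]
  rfl

theorem locallyIntegrable_of_memLp {f : R3 → C3} (hf : MemLp f 2 volume) : LocallyIntegrable f :=
  hf.locallyIntegrable (by norm_num)

theorem memLp_rot (R : SO3) (u : L2Field) :
    MemLp (fun x ↦ rotValue R (u (rotSpace R⁻¹ x))) 2 volume :=
  (memLp_congr_ae (rot_ae R u)).1 (Lp.memLp _)

theorem fourier_rot (R : SO3) (u : L2Field) :
    (𝓕 (rot R u) : L2Field) =ᵐ[volume]
      fun ξ ↦ rotValue R ((𝓕 u : L2Field) (rotSpace R⁻¹ ξ)) := by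
  refine fourier_ae_eq (locallyIntegrable_of_memLp (memLp_rot R _)) fun φ ↦ ?_
  have h1 : ∫ x, (𝓕 φ : 𝓢(R3, ℂ)) x • rot R u x =
      ∫ x, rotValue R ((𝓕 φ : 𝓢(R3, ℂ)) x • u (rotSpace R⁻¹ x)) := by
    refine integral_congr_ae ?_
    filter_upwards [rot_ae R u] with x hx
    rw [hx, map_smul]
  set e := rotIso R with he
  have hinv : ∀ x, rotSpace R⁻¹ (e x) = x := fun x ↦ by
    rw [he, rotIso_apply, ← rotSpace_mul, inv_mul_cancel, rotSpace_one]
  have hmp : MeasurePreserving e := e.measurePreserving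
  set φ' : 𝓢(R3, ℂ) := SchwartzMap.compCLMOfContinuousLinearEquiv ℂ e.toContinuousLinearEquiv φ
  have hφ' : ∀ x, φ' x = φ (e x) := fun x ↦ rfl
  have h3 : ∀ x, (𝓕 φ' : 𝓢(R3, ℂ)) x = (𝓕 φ : 𝓢(R3, ℂ)) (e x) := fun x ↦ by
    rw [SchwartzMap.fourier_coe, SchwartzMap.fourier_coe]
    exact Real.fourier_comp_linearIsometry e φ x
  rw [h1, ← hmp.integral_comp e.toHomeomorph.measurableEmbedding,
    ← hmp.integral_comp e.toHomeomorph.measurableEmbedding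
      (fun x ↦ φ x • rotValue R ((𝓕 u : L2Field) (rotSpace R⁻¹ x)))]
  simp only [hinv, ← h3, ← hφ']
  -- The rotation is invertible, so it commutes with the integral without any integrability of `f`.
  have hL : ∀ f : R3 → C3, ∫ x, rotValue R (f x) = rotValue R (∫ x, f x) := by
    intro f
    have hinj : Function.Injective (rotValue R) := fun x y hxy ↦ by
      have := congrArg (rotValue R⁻¹) hxy
      rwa [← rotValue_mul, ← rotValue_mul, inv_mul_cancel, rotValue_one, rotValue_one] at this
    have hfd :=
      (LinearEquiv.ofInjectiveEndo (rotValue R : C3 →ₗ[ℂ] C3) hinj).toContinuousLinearEquiv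
    exact ((LinearEquiv.ofInjectiveEndo (rotValue R : C3 →ₗ[ℂ] C3)
      hinj).toContinuousLinearEquiv).integral_comp_comm f
  rw [hL, ← integral_smul_fourier, ← hL]
  simp only [map_smul]

theorem dil_ae (c : Set.Ioi (0 : ℝ)) (u : L2Field) :
    dil c u =ᵐ[volume] fun x ↦ (c : ℝ) ^ (3 / 2 : ℝ) • u ((c : ℝ) • x) :=
  (memLp_dil c u).coeFn_toLp

theorem memLp_comp_smul {c : ℝ} (hc : 0 < c) {u : R3 → C3} (hu : MemLp u 2 volume) :
    MemLp (fun x : R3 ↦ u (c • x)) 2 volume := by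
  have h1 : MemLp u 2 (Measure.map (fun x : R3 ↦ c • x) volume) := by
    rw [Measure.map_addHaar_smul _ hc.ne']
    exact hu.smul_measure ENNReal.ofReal_ne_top
  exact h1.comp_of_map (by fun_prop)

theorem finrank_R3 : Module.finrank ℝ R3 = 3 := by simp

theorem integral_comp_smul_R3 {E : Type*} [NormedAddCommGroup E] [NormedSpace ℝ E] {c : ℝ}
    (hc : 0 < c) (f : R3 → E) : ∫ x, f (c • x) = (c ^ 3)⁻¹ • ∫ x, f x := by
  rw [Measure.integral_comp_smul, finrank_R3, abs_of_pos (by positivity)]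

theorem schwartz_fourier_comp_smul (φ : 𝓢(R3, ℂ)) {c : ℝ} (hc : 0 < c) (x : R3) :
    ∫ y, 𝐞 (-inner ℝ y x) • φ (c • y) = (c ^ 3)⁻¹ • (𝓕 φ : 𝓢(R3, ℂ)) (c⁻¹ • x) := by
  rw [fourier_schwartz_apply, ← integral_comp_smul_R3 hc]
  refine integral_congr_ae (.of_forall fun y ↦ ?_)
  simp only [real_inner_smul_left, real_inner_smul_right]
  rw [inv_mul_cancel_left₀ hc.ne']

theorem fourier_dil (c : Set.Ioi (0 : ℝ)) (u : L2Field) :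
    (𝓕 (dil c u) : L2Field) =ᵐ[volume]
      fun ξ ↦ (c : ℝ) ^ (-(3 / 2) : ℝ) • (𝓕 u : L2Field) ((c : ℝ)⁻¹ • ξ) := by
  have hc : (0 : ℝ) < c := c.2
  refine fourier_ae_eq (locallyIntegrable_of_memLp
    ((memLp_comp_smul (inv_pos.2 hc) (Lp.memLp (𝓕 u : L2Field))).const_smul
      ((c : ℝ) ^ (-(3 / 2) : ℝ)))) fun φ ↦ ?_
  have h1 : ∫ x, (𝓕 φ : 𝓢(R3, ℂ)) x • dil c u x =
      (c : ℝ) ^ (3 / 2 : ℝ) • ∫ x, (𝓕 φ : 𝓢(R3, ℂ)) x • u ((c : ℝ) • x) := by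
    rw [← integral_smul]
    refine integral_congr_ae ?_
    filter_upwards [dil_ae c u] with x hx
    rw [hx, smul_comm]
  set e : R3 ≃L[ℝ] R3 := ContinuousLinearEquiv.smulLeft (Units.mk0 (c : ℝ) hc.ne')
  set φ' : 𝓢(R3, ℂ) := SchwartzMap.compCLMOfContinuousLinearEquiv ℂ e φ
  have hφ' : ∀ x, φ' x = φ ((c : ℝ) • x) := fun x ↦ rfl
  have h3 : ∀ x, (𝓕 φ' : 𝓢(R3, ℂ)) x = ((c : ℝ) ^ 3)⁻¹ • (𝓕 φ : 𝓢(R3, ℂ)) ((c : ℝ)⁻¹ • x) :=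
    fun x ↦ by rw [← schwartz_fourier_comp_smul _ hc, fourier_schwartz_apply]; rfl
  have h4 : ∫ x, (𝓕 φ : 𝓢(R3, ℂ)) x • u ((c : ℝ) • x) =
      ∫ x, (𝓕 φ' : 𝓢(R3, ℂ)) x • u x := by
    have := integral_comp_smul_R3 hc
      (fun x ↦ (𝓕 φ : 𝓢(R3, ℂ)) ((c : ℝ)⁻¹ • x) • u x)
    simp only [inv_smul_smul₀ hc.ne'] at this
    rw [this, ← integral_smul]
    simp only [h3, smul_assoc]
  have h5 : ∫ x, φ' x • (𝓕 u : L2Field) x =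
      ((c : ℝ) ^ 3)⁻¹ • ∫ x, φ x • (𝓕 u : L2Field) ((c : ℝ)⁻¹ • x) := by
    rw [← integral_comp_smul_R3 hc]
    simp only [inv_smul_smul₀ hc.ne', hφ']
  rw [h1, h4, ← integral_smul_fourier, h5, smul_smul]
  simp only [smul_comm (φ _) ((c : ℝ) ^ (-(3 / 2) : ℝ))]
  rw [integral_smul]
  congr 1
  -- The exponent 3/2 of the normalization and -3 of the Jacobian add up to -3/2.
  rw [← Real.rpow_natCast, ← Real.rpow_neg hc.le, ← Real.rpow_add hc]
  norm_num

/-! ### Conjugation -/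

/-- Componentwise complex conjugation on `ℂ³`. -/
def cj : C3 ≃ₗᵢ[ℝ] C3 := LinearIsometryEquiv.piLpCongrRight 2 fun _ ↦ Complex.conjLIE

theorem cj_apply (z : C3) (i : Fin 3) : cj z i = starRingEnd ℂ (z i) := rfl

theorem cj_smul (a : ℂ) (z : C3) : cj (a • z) = starRingEnd ℂ a • cj z := by
  ext i; simp [cj_apply]

theorem cj_cj (z : C3) : cj (cj z) = z := by
  ext i; simp [cj_apply]

theorem fourierChar_conj (t : ℝ) : starRingEnd ℂ (𝐞 t : ℂ) = (𝐞 (-t) : ℂ) := by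
  rw [AddChar.map_neg_eq_inv, Circle.coe_inv_eq_conj]

theorem memLp_modulate (a : R3) (f : L2Field) :
    MemLp (fun x ↦ cj ((𝐞 (inner ℝ a x) : ℂ) • f x)) 2 volume := by
  have h0 : Continuous fun x : R3 ↦ (𝐞 (inner ℝ a x) : ℂ) :=
    continuous_subtype_val.comp (Real.continuous_fourierChar.comp (by fun_prop))
  refine (Lp.memLp f).of_le ?_ (.of_forall fun x ↦ ?_)
  · exact cj.continuous.comp_aestronglyMeasurable
      (h0.aestronglyMeasurable.smul (Lp.memLp f).aestronglyMeasurable)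
  · rw [LinearIsometryEquiv.norm_map, norm_smul, Circle.norm_coe, one_mul]

/-- Conjugation reflects the frequency and modulation translates it; together they give the
involution `ξ ↦ -ξ - a`. With `a = 0` this is the symmetry of the transform of a real field; with
general `a` it turns Plancherel's identity into the convolution formula behind `convection_eq`. -/
theorem fourier_conj_modulate (a : R3) (f g : L2Field)
    (h : g =ᵐ[volume] fun x ↦ cj ((𝐞 (inner ℝ a x) : ℂ) • f x)) :
    (𝓕 g : L2Field) =ᵐ[volume] fun ξ ↦ cj ((𝓕 f : L2Field) (-ξ - a)) := by
  have hmp : MeasurePreserving (fun ξ : R3 ↦ -ξ - a) := by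
    exact (measurePreserving_sub_right (volume : Measure R3) a).comp
      (Measure.measurePreserving_neg volume)
  have hinv : ∀ ξ : R3, -(-ξ - a) - a = ξ := fun ξ ↦ by abel
  have hemb : MeasurableEmbedding (fun ξ : R3 ↦ -ξ - a) :=
    ((Homeomorph.neg R3).trans (Homeomorph.subRight a)).measurableEmbedding
  refine fourier_ae_eq (locallyIntegrable_of_memLp ?_) fun φ ↦ ?_
  · exact cj.toContinuousLinearEquiv.toContinuousLinearMap.comp_memLp'
      ((Lp.memLp (𝓕 f : L2Field)).comp_measurePreserving hmp)
  set φ' : 𝓢(R3, ℂ) := SchwartzMap.postcompCLM (𝕜 := ℝ)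
    (Complex.conjCLE : ℂ →L[ℝ] ℂ)
    (SchwartzMap.compSubConstCLM ℝ (-a) (SchwartzMap.compCLMOfContinuousLinearEquiv ℝ
      (ContinuousLinearEquiv.neg ℝ) φ))
  have hφ' : ∀ x, φ' x = starRingEnd ℂ (φ (-x - a)) := fun x ↦ by
    change starRingEnd ℂ (φ (-(x - -a))) = _
    congr 2; abel
  have hcj : ∀ F : R3 → C3, ∫ x, cj (F x) = cj (∫ x, F x) := fun F ↦
    cj.toContinuousLinearEquiv.integral_comp_comm F
  have h3 : ∀ x, (𝓕 φ' : 𝓢(R3, ℂ)) x =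
      (𝐞 (inner ℝ a x) : ℂ) * starRingEnd ℂ ((𝓕 φ : 𝓢(R3, ℂ)) x) := by
    intro x
    rw [fourier_schwartz_apply, fourier_schwartz_apply, ← integral_conj, ← integral_const_mul,
      ← hmp.integral_comp hemb]
    refine integral_congr_ae (.of_forall fun y ↦ ?_)
    simp only [hφ', Circle.smul_def, smul_eq_mul, map_mul, fourierChar_conj, ← mul_assoc]
    rw [hinv, ← Circle.coe_mul, ← AddChar.map_add_eq_mul]
    congr 4
    simp only [inner_sub_left, inner_neg_left]
    ring
  have h4 : ∫ x, (𝓕 φ : 𝓢(R3, ℂ)) x • g x = cj (∫ x, (𝓕 φ' : 𝓢(R3, ℂ)) x • f x) := by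
    rw [← hcj]
    refine integral_congr_ae ?_
    filter_upwards [h] with x hx
    rw [hx, h3, mul_smul, cj_smul, cj_smul, cj_smul, Complex.conj_conj, smul_comm]
  rw [h4, ← integral_smul_fourier, ← hcj, ← hmp.integral_comp hemb]
  refine integral_congr_ae (.of_forall fun y ↦ ?_)
  simp only [hφ', cj_smul, Complex.conj_conj, hinv]

theorem fourier_neg_of_real (u : L2Field) (hu : ∀ᵐ x, ∀ i, (u x i).im = 0) :
    ∀ᵐ ξ, (𝓕 u : L2Field) (-ξ) = cj ((𝓕 u : L2Field) ξ) := by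
  have h := fourier_conj_modulate 0 u u (by
    filter_upwards [hu] with x hx
    ext i
    simp [cj_apply, Complex.conj_eq_iff_im.2 (hx i)])
  filter_upwards [h] with ξ hξ
  rw [hξ, cj_cj, sub_zero]

/-! ### Derivatives, divergence and regularity on the Fourier side -/

theorem inner_stdVec (x : R3) (j : Fin 3) : inner ℝ x (stdVec j) = x j := by
  simp [stdVec, EuclideanSpace.inner_single_right]

/-- Every Schwartz function is some `𝓕 χ`, so this determines the distributional derivative. The
sign of the integration by parts cancels the sign in the derivative of `𝓕 χ`. -/
theorem partial_fourier_apply (j : Fin 3) (u : L2Field) (χ : 𝓢(R3, ℂ)) :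
    (∂_{stdVec j} (u : 𝓢'(R3, C3))) (𝓕 χ) =
      ∫ x, χ x • (2 * Real.pi * Complex.I * (x j : ℂ)) • (𝓕 u : L2Field) x := by
  have ht : (fun x : R3 ↦ inner ℝ x (stdVec j)).HasTemperateGrowth := by fun_prop
  rw [lineDerivOp_apply_apply, SchwartzMap.lineDerivOp_fourier_eq]
  have h1 : -𝓕 (-(2 * Real.pi * Complex.I) •
      SchwartzMap.smulLeftCLM ℂ (fun x : R3 ↦ inner ℝ x (stdVec j)) χ) =
      (𝓕 ((2 * Real.pi * Complex.I) •
        SchwartzMap.smulLeftCLM ℂ (fun x : R3 ↦ inner ℝ x (stdVec j)) χ) : 𝓢(R3, ℂ)) := by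
    rw [neg_smul, FourierTransform.fourier_neg, neg_neg]
  rw [h1, Lp.toTemperedDistribution_apply, ← integral_smul_fourier]
  refine integral_congr_ae (.of_forall fun x ↦ ?_)
  have h2 := SchwartzMap.smulLeftCLM_apply_apply ht χ x
  rw [inner_stdVec] at h2
  beta_reduce
  rw [smul_apply, h2, smul_smul]
  congr 1
  simp only [smul_eq_mul, Complex.real_smul]
  ring

theorem locallyIntegrable_continuous_smul {g : R3 → ℂ} (hg : Continuous g) (u : L2Field) :
    LocallyIntegrable (fun x ↦ g x • u x) :=
  (locallyIntegrable_coe u).continuous_smul hg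

/-- `weakPartial` is a choice; the injectivity of `L²` into tempered distributions identifies it
with any candidate having the right transform. -/
theorem weakPartial_eq (j : Fin 3) {u g : L2Field}
    (h : (𝓕 g : L2Field) =ᵐ[volume]
      fun ξ ↦ (2 * Real.pi * Complex.I * (ξ j : ℂ)) • (𝓕 u : L2Field) ξ) :
    weakPartial j u = g := by
  have h1 : ∂_{stdVec j} (u : 𝓢'(R3, C3)) = (g : 𝓢'(R3, C3)) := by
    ext φ : 1
    obtain ⟨χ, rfl⟩ : ∃ χ : 𝓢(R3, ℂ), 𝓕 χ = φ := ⟨𝓕⁻ φ, fourier_fourierInv_eq φ⟩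
    rw [partial_fourier_apply, Lp.toTemperedDistribution_apply, ← integral_smul_fourier]
    refine integral_congr_ae ?_
    filter_upwards [h] with x hx
    rw [hx]
  have h2 : ∃ g : L2Field, ∂_{stdVec j} (u : 𝓢'(R3, C3)) = g := ⟨g, h1⟩
  rw [weakPartial, dif_pos h2]
  exact toTempered_injective (h2.choose_spec.symm.trans h1)

theorem fourier_divFree {u : L2Field} (hu : IsDivFree u) :
    ∀ᵐ ξ, ∑ i, (ξ i : ℂ) * (𝓕 u : L2Field) ξ i = 0 := by
  have hloc : ∀ i, LocallyIntegrable
      (fun ξ : R3 ↦ (2 * Real.pi * Complex.I * (ξ i : ℂ)) • (𝓕 u : L2Field) ξ) := fun i ↦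
    locallyIntegrable_continuous_smul (by fun_prop) _
  set F : R3 → ℂ := fun ξ ↦ ∑ i, (2 * Real.pi * Complex.I * (ξ i : ℂ)) * (𝓕 u : L2Field) ξ i
  have hcomp : ∀ i, LocallyIntegrable
      (fun ξ : R3 ↦ (2 * Real.pi * Complex.I * (ξ i : ℂ)) * (𝓕 u : L2Field) ξ i) := fun i x ↦ by
    obtain ⟨s, hs, hs'⟩ := hloc i x
    exact ⟨s, hs, (EuclideanSpace.proj i : C3 →L[ℂ] ℂ).integrable_comp hs'⟩
  have hFloc : LocallyIntegrable F := by
    have := locallyIntegrable_finsetSum (μ := volume) Finset.univ (fun i _ ↦ hcomp i)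
    convert this using 1
  have hF : F =ᵐ[volume] 0 := by
    refine ae_eq_zero_of_integral_contDiff_smul_eq_zero hFloc fun g hg hc ↦ ?_
    have hg₁ : HasCompactSupport (Complex.ofRealCLM ∘ g) := hc.comp_left rfl
    have hg₂ : ContDiff ℝ (⊤ : ℕ∞) (Complex.ofRealCLM ∘ g) := by fun_prop
    set χ : 𝓢(R3, ℂ) := hg₁.toSchwartzMap hg₂
    have hχ : ∀ x, χ x = (g x : ℂ) := fun x ↦ rfl
    -- For a mere `L²` field `ξᵢ û` is only locally integrable; the compact support of `χ` makes
    -- each term integrable, so that the sum may enter the integral.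
    have hint : ∀ i, Integrable fun ξ : R3 ↦
        χ ξ • (2 * Real.pi * Complex.I * (ξ i : ℂ)) • (𝓕 u : L2Field) ξ := fun i ↦ by
      have := (hloc i).integrable_smul_left_of_hasCompactSupport hg.continuous hc
      refine this.congr (.of_forall fun x ↦ ?_)
      simp only [hχ]
      ext k
      simp
    have h := hu (𝓕 χ)
    simp only [partial_fourier_apply] at h
    rw [← h]
    have hp : ∀ i, (∫ x, χ x • (2 * Real.pi * Complex.I * (x i : ℂ)) • (𝓕 u : L2Field) x) i =
        ∫ x, χ x * ((2 * Real.pi * Complex.I * (x i : ℂ)) * (𝓕 u : L2Field) x i) := fun i ↦ by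
      have := (EuclideanSpace.proj i : C3 →L[ℂ] ℂ).integral_comp_comm (hint i)
      simpa using this.symm
    simp only [hp]
    rw [← integral_finsetSum]
    · refine integral_congr_ae (.of_forall fun x ↦ ?_)
      simp only [F, Complex.real_smul, Finset.mul_sum, hχ]
    · intro i _
      exact (EuclideanSpace.proj i : C3 →L[ℂ] ℂ).integrable_comp (hint i)
  filter_upwards [hF] with ξ hξ
  have h2 : (2 * Real.pi * Complex.I : ℂ) * ∑ i, (ξ i : ℂ) * (𝓕 u : L2Field) ξ i = 0 := by
    rw [Finset.mul_sum, ← show F ξ = 0 from hξ]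
    refine Finset.sum_congr rfl fun i _ ↦ by ring
  exact (mul_eq_zero.1 h2).resolve_left Complex.two_pi_I_ne_zero

/-- The Fourier transform of a field of `H¹⁰_df`. -/
def H10df.hat (u : H10df) : R3 → C3 := (𝓕 u.toL2 : L2Field)

theorem H10df.memLp_hat (u : H10df) : MemLp u.hat 2 volume := Lp.memLp _

theorem H10df.measurable_hat (u : H10df) : StronglyMeasurable u.hat := Lp.stronglyMeasurable _

theorem H10df.hat_real (u : H10df) : ∀ᵐ ξ, u.hat (-ξ) = cj (u.hat ξ) :=
  fourier_neg_of_real _ u.2.1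

theorem H10df.hat_divFree (u : H10df) : ∀ᵐ ξ, ∑ i, (ξ i : ℂ) * u.hat ξ i = 0 :=
  fourier_divFree u.2.2.2

theorem H10df.hat_bessel (u : H10df) :
    (𝓕 u.bessel : L2Field) =ᵐ[volume] fun ξ ↦ ((1 + ‖ξ‖ ^ 2) ^ 5 : ℝ) • u.hat ξ := by
  have ht : (fun x : R3 ↦ (((1 + ‖x‖ ^ 2) ^ ((10 : ℝ) / 2) : ℝ) : ℂ)).HasTemperateGrowth := by
    fun_prop
  have hw : ∀ x : R3, (1 + ‖x‖ ^ 2) ^ ((10 : ℝ) / 2) = (1 + ‖x‖ ^ 2) ^ 5 := fun x ↦ by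
    rw [← Real.rpow_natCast]; norm_num
  have h := congrArg 𝓕 u.bessel_spec
  rw [fourier_besselPotential_eq_smulLeftCLM_fourier_apply, Lp.fourier_toTemperedDistribution_eq,
    Lp.fourier_toTemperedDistribution_eq] at h
  refine ae_eq_of_schwartz (locallyIntegrable_coe _) ?_ fun φ ↦ ?_
  · have : Continuous fun ξ : R3 ↦ (((1 + ‖ξ‖ ^ 2) ^ 5 : ℝ) : ℂ) := by fun_prop
    refine (locallyIntegrable_continuous_smul this (𝓕 u.toL2 : L2Field)).congr
      (.of_forall fun ξ ↦ ?_)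
    ext i
    simp [H10df.hat]
  · have h1 := congrArg (fun T : 𝓢'(R3, C3) ↦ T φ) h
    simp only [smulLeftCLM_apply_apply, Lp.toTemperedDistribution_apply] at h1
    rw [← h1]
    refine integral_congr_ae (.of_forall fun ξ ↦ ?_)
    have h2 := SchwartzMap.smulLeftCLM_apply_apply ht φ ξ
    rw [hw] at h2
    beta_reduce
    rw [h2, H10df.hat]
    ext i
    simp
    ring

theorem H10df.norm_def (u : H10df) : ‖u‖ = ‖u.bessel‖ := rfl

theorem H10df.memLp_weight_hat (u : H10df) :
    MemLp (fun ξ ↦ ((1 + ‖ξ‖ ^ 2) ^ 5 : ℝ) • u.hat ξ) 2 volume :=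
  (memLp_congr_ae u.hat_bessel).1 (Lp.memLp _)

theorem H10df.eLpNorm_weight_hat (u : H10df) :
    eLpNorm (fun ξ ↦ ((1 + ‖ξ‖ ^ 2) ^ 5 : ℝ) • u.hat ξ) 2 volume = ENNReal.ofReal ‖u‖ := by
  rw [← eLpNorm_congr_ae u.hat_bessel, u.norm_def, ← Lp.norm_fourier_eq, Lp.norm_def,
    ENNReal.ofReal_toReal (Lp.eLpNorm_ne_top _)]

theorem memLp_inv_weight : MemLp (fun ξ : R3 ↦ ((1 + ‖ξ‖ ^ 2) ^ 5 : ℝ)⁻¹) 2 volume := by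
  have hc : Continuous fun ξ : R3 ↦ ((1 + ‖ξ‖ ^ 2) ^ 5 : ℝ)⁻¹ :=
    Continuous.inv₀ (by fun_prop) fun ξ ↦ by positivity
  rw [memLp_two_iff_integrable_sq hc.aestronglyMeasurable]
  -- The square of the inverse weight is `(1 + |ξ|²)^{-10}`, of decay order 20, which exceeds the
  -- dimension 3.
  have := integrable_rpow_neg_one_add_norm_sq (E := R3) (μ := volume) (r := 20)
    (by rw [finrank_R3]; norm_num)
  refine this.congr (.of_forall fun ξ ↦ ?_)
  simp only
  rw [show (-20 / 2 : ℝ) = -((10 : ℕ) : ℝ) by norm_num, Real.rpow_neg (by positivity),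
    Real.rpow_natCast, inv_pow, ← pow_mul]

/-- Cauchy–Schwarz with the weight `(1 + |ξ|²)⁵` and its inverse, both factors being in `L²`. -/
theorem H10df.integrable_hat (u : H10df) : Integrable u.hat := by
  have h : MemLp ((fun ξ : R3 ↦ ((1 + ‖ξ‖ ^ 2) ^ 5 : ℝ)⁻¹) •
      fun ξ ↦ ((1 + ‖ξ‖ ^ 2) ^ 5 : ℝ) • u.hat ξ) 1 volume :=
    u.memLp_weight_hat.smul memLp_inv_weight
  rw [memLp_one_iff_integrable] at h
  refine h.congr (.of_forall fun ξ ↦ ?_)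
  simp only [Pi.smul_apply']
  rw [inv_smul_smul₀ (by positivity)]

theorem H10df.memLp_norm_hat (u : H10df) : MemLp (fun ξ ↦ ‖ξ‖ • u.hat ξ) 2 volume := by
  refine u.memLp_weight_hat.of_le
    (continuous_norm.aestronglyMeasurable.smul u.memLp_hat.aestronglyMeasurable)
    (.of_forall fun ξ ↦ ?_)
  rw [norm_smul, norm_smul, norm_norm, Real.norm_of_nonneg (by positivity)]
  gcongr
  have h1 : ‖ξ‖ ≤ 1 + ‖ξ‖ ^ 2 := by nlinarith [sq_nonneg (‖ξ‖ - 1), sq_nonneg ‖ξ‖]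
  calc ‖ξ‖ ≤ 1 + ‖ξ‖ ^ 2 := h1
    _ ≤ _ := le_self_pow₀ (by nlinarith [sq_nonneg ‖ξ‖]) (by norm_num)

/-! ### Fourier representation of the pairing and of the convection term -/

/-- The bilinear dot product on `ℂ³`. -/
def dotC : C3 →L[ℂ] C3 →L[ℂ] ℂ :=
  ∑ i, (EuclideanSpace.proj i : C3 →L[ℂ] ℂ).smulRight (EuclideanSpace.proj i : C3 →L[ℂ] ℂ)

theorem dotC_apply (x y : C3) : dotC x y = ∑ i, x i * y i := by
  simp [dotC]

theorem dotC_comm (x y : C3) : dotC x y = dotC y x := by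
  simp only [dotC_apply, mul_comm]

theorem inner_eq_dotC (x y : C3) : inner ℂ x y = dotC (cj x) y := by
  simp [dotC_apply, cj_apply, PiLp.inner_apply, mul_comm]

theorem norm_dotC_le (x y : C3) : ‖dotC x y‖ ≤ ‖x‖ * ‖y‖ := by
  have h := norm_inner_le_norm (𝕜 := ℂ) (cj x) y
  rwa [inner_eq_dotC, cj_cj, LinearIsometryEquiv.norm_map] at h

theorem dotC_cj (x y : C3) : dotC (cj x) (cj y) = starRingEnd ℂ (dotC x y) := by
  simp [dotC_apply, cj_apply]

theorem integral_dotC_fourierInv {f g : R3 → C3} (hf : Integrable f) (hg : Integrable g) :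
    ∫ x, dotC (𝓕⁻ f x) (g x) = ∫ x, dotC (f x) (𝓕⁻ g x) := by
  have h := VectorFourier.integral_bilin_fourierIntegral_eq_flip dotC
    (L := -innerₗ R3) (μ := volume) (ν := volume) Real.continuous_fourierChar
    (by simp only [LinearMap.neg_apply, innerₗ_apply_apply]; fun_prop) hf hg
  have hflip : (-innerₗ R3).flip = -innerₗ R3 := by
    ext x y
    simp [real_inner_comm]
  rw [hflip] at h
  exact h

theorem integral_fourierInv_smul {f : R3 → ℂ} {g : R3 → C3} (hf : Integrable f)
    (hg : Integrable g) : ∫ x, 𝓕⁻ f x • g x = ∫ x, f x • 𝓕⁻ g x := by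
  have h := VectorFourier.integral_fourierIntegral_smul_eq_flip
    (L := -innerₗ R3) (μ := volume) (ν := volume) Real.continuous_fourierChar
    (by simp only [LinearMap.neg_apply, innerₗ_apply_apply]; fun_prop) hf hg
  have hflip : (-innerₗ R3).flip = -innerₗ R3 := by
    ext x y
    simp [real_inner_comm]
  rw [hflip] at h
  exact h

theorem continuous_fourierInv {g : R3 → C3} (hg : Integrable g) : Continuous (𝓕⁻ g) :=
  VectorFourier.fourierIntegral_continuous (L := -innerₗ R3) Real.continuous_fourierChar
    (by simp only [LinearMap.neg_apply, innerₗ_apply_apply]; fun_prop) hg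

/-- Links the abstract transform on `L²` to the classical inversion integral, which is what allows
the first factor of the convection term to be expanded in frequencies. -/
theorem ae_eq_fourierInv {u : L2Field} (hu : Integrable (𝓕 u : L2Field)) :
    u =ᵐ[volume] 𝓕⁻ ((𝓕 u : L2Field) : R3 → C3) := by
  refine ae_eq_of_schwartz (locallyIntegrable_coe _) (continuous_fourierInv hu).locallyIntegrable
    fun φ ↦ ?_
  rw [← integral_fourierInv_smul φ.integrable hu]
  have h := integral_smul_fourier u (𝓕⁻ φ)
  rw [fourier_fourierInv_eq] at h
  rw [← h, SchwartzMap.fourierInv_coe]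

theorem integral_inner_fourier (f g : L2Field) :
    ∫ ξ, dotC (cj ((𝓕 f : L2Field) ξ)) ((𝓕 g : L2Field) ξ) = ∫ x, dotC (cj (f x)) (g x) := by
  have h := Lp.inner_fourier_eq f g
  rw [L2.inner_def, L2.inner_def] at h
  simpa only [inner_eq_dotC] using h

theorem integrable_dotC {f g : R3 → C3} (hf : MemLp f 2 volume) (hg : MemLp g 2 volume) :
    Integrable fun x ↦ dotC (f x) (g x) := by
  have h1 : Integrable fun x ↦ ‖f x‖ * ‖g x‖ := hf.norm.integrable_mul hg.norm
  refine h1.mono (dotC.aestronglyMeasurable_comp₂ hf.1 hg.1) (.of_forall fun x ↦ ?_)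
  rw [norm_mul, norm_norm, norm_norm]
  exact norm_dotC_le _ _

/-- The trilinear symbol of the convection term. -/
def triKernel (F G H : R3 → C3) (p : R3 × R3) : ℂ :=
  (∑ j, F p.1 j * (2 * Real.pi * Complex.I * (p.2 j : ℂ))) * dotC (G p.2) (H (-p.1 - p.2))

theorem measurePreserving_neg_sub (a : R3) : MeasurePreserving (fun η : R3 ↦ -a - η) := by
  have h := (measurePreserving_sub_right (volume : Measure R3) a).comp
    (Measure.measurePreserving_neg volume)
  have h1 : (fun η : R3 ↦ -a - η) = (fun x ↦ x - a) ∘ Neg.neg := by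
    ext1 η
    simp only [Function.comp_apply]
    abel
  rwa [h1]

/-- Writing `u` as an inverse Fourier integral moves the inverse transform onto the products `∂ⱼv ·
w`. At a fixed frequency `ξ` this transform is the pairing of `∂ⱼv` with a modulated `w`, which
Plancherel evaluates. Integrability of `û` justifies the exchange, and the second hypothesis
provides the weak derivatives. -/
theorem convection_eq {u v w : L2Field} (hu : Integrable (𝓕 u : L2Field))
    (hv : MemLp (fun ξ ↦ ‖ξ‖ • (𝓕 v : L2Field) ξ) 2 volume) :
    convection u v w = (∫ ξ, ∫ η, triKernel (𝓕 u : L2Field) (𝓕 v : L2Field) (𝓕 w : L2Field)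
      (ξ, η)).re := by
  have hmem : ∀ j : Fin 3, MemLp
      (fun ξ : R3 ↦ (2 * Real.pi * Complex.I * (ξ j : ℂ)) • (𝓕 v : L2Field) ξ) 2 volume := by
    intro j
    have hc : Continuous fun ξ : R3 ↦ 2 * Real.pi * Complex.I * (ξ j : ℂ) := by fun_prop
    refine (hv.const_smul (2 * Real.pi)).of_le
      (hc.aestronglyMeasurable.smul (Lp.aestronglyMeasurable _)) (.of_forall fun ξ ↦ ?_)
    simp only [Pi.smul_apply, norm_smul, norm_mul, Complex.norm_real, Complex.norm_I, norm_norm,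
      Complex.norm_ofNat, mul_one, Real.norm_ofNat]
    rw [mul_assoc (2 * ‖Real.pi‖)]
    gcongr
    exact PiLp.norm_apply_le ξ j
  set g : Fin 3 → L2Field := fun j ↦ 𝓕⁻ ((hmem j).toLp _) with hg
  have hgF : ∀ j, (𝓕 (g j) : L2Field) =ᵐ[volume]
      fun ξ ↦ (2 * Real.pi * Complex.I * (ξ j : ℂ)) • (𝓕 v : L2Field) ξ := fun j ↦ by
    rw [hg, fourier_fourierInv_eq]
    exact (hmem j).coeFn_toLp
  have hwp : ∀ j, weakPartial j v = g j := fun j ↦ weakPartial_eq j (hgF j)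
  set h : R3 → C3 := fun x ↦ WithLp.toLp 2 fun j ↦ dotC (g j x) (w x) with hh
  have hhj : ∀ j, Integrable fun x ↦ dotC (g j x) (w x) := fun j ↦
    integrable_dotC (Lp.memLp _) (Lp.memLp _)
  have hhint : Integrable h := by
    exact ((PiLp.continuousLinearEquiv 2 ℂ (fun _ : Fin 3 ↦ ℂ)).symm :
      (Fin 3 → ℂ) →L[ℂ] C3).integrable_comp (Integrable.of_eval hhj)
  have h1 : convection u v w =
      (∫ x, dotC (𝓕⁻ ((𝓕 u : L2Field) : R3 → C3) x) (h x)).re := by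
    rw [convection]
    congr 1
    refine integral_congr_ae ?_
    filter_upwards [ae_eq_fourierInv hu] with x hx
    rw [← hx, dotC_apply]
    simp only [hwp, hh, dotC_apply, Finset.sum_mul, Finset.mul_sum]
    rw [Finset.sum_comm]
    refine Finset.sum_congr rfl fun i _ ↦ Finset.sum_congr rfl fun j _ ↦ by ring
  rw [h1, integral_dotC_fourierInv hu hhint]
  congr 1
  refine integral_congr_ae (.of_forall fun ξ ↦ ?_)
  -- Conjugating the modulated `w` in advance makes the sesquilinear Plancherel pairing bilinear.
  set k : L2Field := (memLp_modulate ξ w).toLp _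
  have hk : k =ᵐ[volume] fun x ↦ cj ((𝐞 (inner ℝ ξ x) : ℂ) • w x) :=
    (memLp_modulate ξ w).coeFn_toLp
  have hkF := fourier_conj_modulate ξ w k hk
  have hcomp : ∀ j, 𝓕⁻ h ξ j = ∫ η, dotC ((2 * Real.pi * Complex.I * (η j : ℂ)) •
      (𝓕 v : L2Field) η) ((𝓕 w : L2Field) (-ξ - η)) := by
    intro j
    have hint : Integrable fun x ↦ 𝐞 (inner ℝ x ξ) • h x := by
      have := (VectorFourier.fourierIntegral_convergent_iff (L := -innerₗ R3)
        Real.continuous_fourierChar (by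
          simp only [LinearMap.neg_apply, innerₗ_apply_apply]; fun_prop) (μ := volume)
            (f := h) ξ).2 hhint
      simpa using this
    rw [Real.fourierInv_eq]
    change (EuclideanSpace.proj j : C3 →L[ℂ] ℂ) (∫ x, 𝐞 (inner ℝ x ξ) • h x) = _
    rw [← ContinuousLinearMap.integral_comp_comm _ hint]
    have h2 := integral_inner_fourier k (g j)
    trans ∫ x, dotC (cj (k x)) (g j x)
    · refine integral_congr_ae ?_
      filter_upwards [hk] with x hx
      rw [hx, cj_cj, dotC_comm]
      simp [hh, Circle.smul_def, real_inner_comm]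
    · rw [← h2]
      refine integral_congr_ae ?_
      filter_upwards [hkF, hgF j] with η h3 h4
      rw [h3, h4, cj_cj, dotC_comm, show -ξ - η = -η - ξ by abel]
  have hint2 : ∀ j, Integrable fun η : R3 ↦ dotC ((2 * Real.pi * Complex.I * (η j : ℂ)) •
      (𝓕 v : L2Field) η) ((𝓕 w : L2Field) (-ξ - η)) := fun j ↦
    integrable_dotC (hmem j) ((Lp.memLp (𝓕 w : L2Field)).comp_measurePreserving
      (measurePreserving_neg_sub ξ))
  beta_reduce
  rw [dotC_apply]
  simp only [hcomp]
  simp only [← integral_const_mul]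
  rw [← integral_finsetSum _ fun j _ ↦ (hint2 j).const_mul _]
  refine integral_congr_ae (.of_forall fun η ↦ ?_)
  simp only [triKernel, Finset.sum_mul, map_smul, smul_apply, smul_eq_mul]
  exact Finset.sum_congr rfl fun j _ ↦ by ring

/-! ### Helicity projections -/

/-- The cross product of a real and a complex vector. -/
def crossC (η : R3) (X : C3) : C3 :=
  WithLp.toLp 2 ![(η 1 : ℂ) * X 2 - (η 2 : ℂ) * X 1, (η 2 : ℂ) * X 0 - (η 0 : ℂ) * X 2,
    (η 0 : ℂ) * X 1 - (η 1 : ℂ) * X 0]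

theorem crossC_zero' (η : R3) (X : C3) :
    crossC η X 0 = (η 1 : ℂ) * X 2 - (η 2 : ℂ) * X 1 := rfl

theorem crossC_one' (η : R3) (X : C3) :
    crossC η X 1 = (η 2 : ℂ) * X 0 - (η 0 : ℂ) * X 2 := rfl

theorem crossC_two' (η : R3) (X : C3) :
    crossC η X 2 = (η 0 : ℂ) * X 1 - (η 1 : ℂ) * X 0 := rfl

theorem C3_ext {X Y : C3} (h0 : X 0 = Y 0) (h1 : X 1 = Y 1) (h2 : X 2 = Y 2) : X = Y := by
  ext i
  fin_cases i <;> assumption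

theorem norm_crossC_le (η : R3) (X : C3) : ‖crossC η X‖ ≤ ‖η‖ * ‖X‖ := by
  refine le_of_sq_le_sq ?_ (by positivity)
  rw [mul_pow, EuclideanSpace.norm_sq_eq, EuclideanSpace.norm_sq_eq, EuclideanSpace.norm_sq_eq]
  simp only [Fin.sum_univ_three, crossC_zero', crossC_one', crossC_two', Complex.sq_norm,
    Complex.normSq_apply, Real.norm_eq_abs, sq_abs, Complex.sub_re, Complex.sub_im, Complex.mul_re,
    Complex.mul_im, Complex.ofReal_re, Complex.ofReal_im, zero_mul, sub_zero, add_zero]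
  -- Lagrange's identity for the real and the imaginary part: the defect is the square of the dot
  -- product.
  nlinarith [sq_nonneg (η 0 * (X 0).re + η 1 * (X 1).re + η 2 * (X 2).re),
    sq_nonneg (η 0 * (X 0).im + η 1 * (X 1).im + η 2 * (X 2).im)]

/-- The projection of the Fourier coefficient `X` at the frequency `ξ` to helicity `σ = ±1`. -/
def hel (σ : ℝ) (ξ : R3) (X : C3) : C3 :=
  (1 / 2 : ℂ) • (X + (Complex.I * σ * (‖ξ‖⁻¹ : ℝ)) • crossC ξ X)

theorem norm_hel_le {σ : ℝ} (hσ : σ ^ 2 = 1) (ξ : R3) (X : C3) : ‖hel σ ξ X‖ ≤ ‖X‖ := by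
  have hs : |σ| = 1 := by rw [← sq_eq_sq₀ (abs_nonneg _) zero_le_one, sq_abs, hσ, one_pow]
  have h1 : ‖(Complex.I * σ * (‖ξ‖⁻¹ : ℝ)) • crossC ξ X‖ ≤ ‖X‖ := by
    rw [norm_smul, norm_mul, norm_mul, Complex.norm_I, Complex.norm_real, Complex.norm_real,
      Real.norm_eq_abs, hs, norm_inv, norm_norm, one_mul, one_mul]
    calc ‖ξ‖⁻¹ * ‖crossC ξ X‖ ≤ ‖ξ‖⁻¹ * (‖ξ‖ * ‖X‖) := by gcongr; exact norm_crossC_le _ _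
      _ = (‖ξ‖⁻¹ * ‖ξ‖) * ‖X‖ := by ring
      -- Only an inequality, since at `ξ = 0` the inverse of the norm is zero.
      _ ≤ 1 * ‖X‖ := by gcongr; exact inv_mul_le_one
      _ = ‖X‖ := one_mul _
  rw [hel, norm_smul]
  have h2 := norm_add_le X ((Complex.I * σ * (‖ξ‖⁻¹ : ℝ)) • crossC ξ X)
  have h3 : ‖(1 / 2 : ℂ)‖ = 1 / 2 := by norm_num
  rw [h3]
  linarith

theorem hel_add_hel_neg (σ : ℝ) (ξ : R3) (X : C3) : hel σ ξ X + hel (-σ) ξ X = X := by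
  simp only [hel]
  rw [← smul_add]
  ext i
  simp
  ring

/-- The sign from reversing `ξ` in the cross product cancels the sign from conjugating `I`. Hence
helicity components of real fields are real, and so are their wavelet coefficients. -/
theorem hel_neg_cj (σ : ℝ) (ξ : R3) (X : C3) : hel σ (-ξ) (cj X) = cj (hel σ ξ X) := by
  refine C3_ext ?_ ?_ ?_ <;>
  simp [hel, cj_apply, crossC_zero', crossC_one', crossC_two', map_ofNat] <;> ring

theorem continuous_crossC : Continuous fun p : R3 × C3 ↦ crossC p.1 p.2 := by
  unfold crossC
  fun_prop

theorem stronglyMeasurable_hel (σ : ℝ) {U : R3 → C3} (hU : StronglyMeasurable U) :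
    StronglyMeasurable fun ξ ↦ hel σ ξ (U ξ) := by
  have h1 : StronglyMeasurable fun ξ ↦ crossC ξ (U ξ) :=
    continuous_crossC.comp_stronglyMeasurable (stronglyMeasurable_id.prodMk hU)
  have h2 : Measurable fun ξ : R3 ↦ Complex.I * σ * ((‖ξ‖⁻¹ : ℝ) : ℂ) := by fun_prop
  exact (hU.add (h2.stronglyMeasurable.smul h1)).const_smul (1 / 2 : ℂ)

/-! ### Wavelet coefficients -/

/-- The rescaled profile on the Fourier side. -/
def freqScale (s : ℝ) (g : R3 → C3) (ξ : R3) : C3 := s ^ (-(3 / 2) : ℝ) • g (s⁻¹ • ξ)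

/-- The wavelet coefficient of a field with Fourier transform `U`, for the profile `g` at
scale `s`. -/
def coef (g : R3 → C3) (s : ℝ) (U : R3 → C3) : ℂ := ∫ ξ, dotC (freqScale s g ξ) (U ξ)

theorem eLpNorm_freqScale {s : ℝ} (hs : 0 < s) {g : R3 → C3} (hg : MemLp g 2 volume) :
    eLpNorm (freqScale s g) 2 volume = eLpNorm g 2 volume := by
  have hmap : Measure.map (fun x : R3 ↦ s⁻¹ • x) volume = ENNReal.ofReal (s ^ 3) • volume := by
    rw [Measure.map_addHaar_smul _ (inv_ne_zero hs.ne'), finrank_R3, inv_pow, inv_inv,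
      abs_of_pos (by positivity)]
  have h1 : eLpNorm (fun ξ : R3 ↦ g (s⁻¹ • ξ)) 2 volume =
      ENNReal.ofReal (s ^ (3 / 2 : ℝ)) * eLpNorm g 2 volume := by
    have hg' : AEStronglyMeasurable g (Measure.map (fun x : R3 ↦ s⁻¹ • x) volume) := by
      rw [hmap]; exact hg.1.smul_measure _
    have := eLpNorm_map_measure (p := 2) hg' (by fun_prop)
    rw [Function.comp_def] at this
    rw [← this, hmap, eLpNorm_smul_measure_of_ne_top (by norm_num), smul_eq_mul]
    congr 1
    rw [ENNReal.ofReal_rpow_of_pos (by positivity), ← Real.rpow_natCast, ← Real.rpow_mul hs.le]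
    norm_num
  have h2 : freqScale s g = s ^ (-(3 / 2) : ℝ) • fun ξ ↦ g (s⁻¹ • ξ) := rfl
  rw [h2, eLpNorm_const_smul, h1, ← mul_assoc, Real.enorm_eq_ofReal (by positivity),
    ← ENNReal.ofReal_mul (by positivity), ← Real.rpow_add hs]
  norm_num

theorem aestronglyMeasurable_freqScale {s : ℝ} {g : R3 → C3} (hg : Continuous g) :
    AEStronglyMeasurable (freqScale s g) volume := by
  unfold freqScale
  exact Continuous.aestronglyMeasurable (by fun_prop)

/-- The decay rate of the wavelet coefficients of fields of regularity `H¹⁰`. -/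
def decay (a s : ℝ) : ℝ := ((1 + (a * s) ^ 2) ^ 5)⁻¹

/-- Cauchy–Schwarz with the `H¹⁰` weight on `U` and its inverse on the profile. The rescaled profile
vanishes for `|ξ| < a s`, where the inverse weight could exceed `decay a s`. Requiring only `‖U‖ ≤
‖û‖` covers `û` itself and its helicity components. -/
theorem norm_coef_le {g : R3 → C3} (hc : Continuous g) (hg : MemLp g 2 volume) {a : ℝ}
    (ha : 0 < a) (hga : ∀ ξ, ‖ξ‖ < a → g ξ = 0) {s : ℝ} (hs : 0 < s) (u : H10df) {U : R3 → C3}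
    (hU : StronglyMeasurable U) (hUu : ∀ ξ, ‖U ξ‖ ≤ ‖u.hat ξ‖) :
    Integrable (fun ξ ↦ dotC (freqScale s g ξ) (U ξ)) ∧
    ‖coef g s U‖ ≤ (eLpNorm g 2 volume).toReal * decay a s * ‖u‖ := by
  have hwc : Continuous fun ξ : R3 ↦ ((1 + ‖ξ‖ ^ 2) ^ 5 : ℝ) := by fun_prop
  have hwi : Continuous fun ξ : R3 ↦ ((1 + ‖ξ‖ ^ 2) ^ 5 : ℝ)⁻¹ :=
    hwc.inv₀ fun ξ ↦ by positivity
  set A : R3 → C3 := fun ξ ↦ ((1 + ‖ξ‖ ^ 2) ^ 5 : ℝ)⁻¹ • freqScale s g ξ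
  set B : R3 → C3 := fun ξ ↦ ((1 + ‖ξ‖ ^ 2) ^ 5 : ℝ) • U ξ
  have hAm : AEStronglyMeasurable A volume :=
    hwi.aestronglyMeasurable.smul (aestronglyMeasurable_freqScale hc)
  have hBm : AEStronglyMeasurable B volume := hwc.aestronglyMeasurable.smul hU.aestronglyMeasurable
  have hAB : ∀ ξ, dotC (A ξ) (B ξ) = dotC (freqScale s g ξ) (U ξ) := fun ξ ↦ by
    have : ((1 + ‖ξ‖ ^ 2) ^ 5 : ℝ) ≠ 0 := by positivity
    simp only [A, B, ContinuousLinearMap.map_smul_of_tower, smul_apply]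
    rw [inv_smul_smul₀ this]
  have hBle : eLpNorm B 2 volume ≤ ENNReal.ofReal ‖u‖ := by
    rw [← u.eLpNorm_weight_hat]
    refine eLpNorm_mono fun ξ ↦ ?_
    rw [norm_smul, norm_smul]
    gcongr
    exact hUu ξ
  have hAle : eLpNorm A 2 volume ≤ ENNReal.ofReal (decay a s) * eLpNorm g 2 volume := by
    rw [← eLpNorm_freqScale hs hg]
    refine eLpNorm_le_mul_eLpNorm_of_ae_le_mul (.of_forall fun ξ ↦ ?_) 2
    by_cases hξ : ‖s⁻¹ • ξ‖ < a
    · simp [A, freqScale, hga _ hξ]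
    · rw [norm_smul, norm_inv, decay, Real.norm_of_nonneg (by positivity)]
      rw [norm_smul, norm_inv, Real.norm_of_nonneg hs.le, not_lt, inv_mul_eq_div,
        le_div_iff₀ hs] at hξ
      gcongr
  have h1 : eLpNorm (fun ξ ↦ dotC (A ξ) (B ξ)) 1 volume ≤
      ENNReal.ofReal ((eLpNorm g 2 volume).toReal * decay a s * ‖u‖) := by
    have := eLpNorm_le_eLpNorm_mul_eLpNorm_of_nnnorm (p := 2) (q := 2) (r := 1) hAm hBm
      (fun x y ↦ dotC x y) 1 (.of_forall fun ξ ↦ by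
        rw [one_mul, ← NNReal.coe_le_coe]; push_cast; exact norm_dotC_le _ _)
    refine this.trans ?_
    rw [ENNReal.ofReal_mul (by unfold decay; positivity),
      ENNReal.ofReal_mul (by positivity), ENNReal.ofReal_toReal hg.2.ne]
    simp only [ENNReal.coe_one, one_mul]
    calc _ ≤ (ENNReal.ofReal (decay a s) * eLpNorm g 2 volume) * ENNReal.ofReal ‖u‖ := by gcongr
      _ = _ := by ring
  simp only [hAB] at h1
  have hint : Integrable (fun ξ ↦ dotC (freqScale s g ξ) (U ξ)) := by
    rw [← memLp_one_iff_integrable]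
    exact ⟨dotC.aestronglyMeasurable_comp₂ (aestronglyMeasurable_freqScale hc)
      hU.aestronglyMeasurable, h1.trans_lt ENNReal.ofReal_lt_top⟩
  refine ⟨hint, ?_⟩
  rw [eLpNorm_one_eq_lintegral_enorm] at h1
  have h2 := (enorm_integral_le_lintegral_enorm _).trans h1
  rwa [← ofReal_norm, ENNReal.ofReal_le_ofReal_iff (by unfold decay; positivity)] at h2

/-- Under `ξ ↦ -ξ` the integrand becomes its own conjugate. -/
theorem coef_real {g : R3 → C3} (hg : ∀ ξ, g (-ξ) = cj (g ξ)) (s : ℝ) {U : R3 → C3}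
    (hU : ∀ᵐ ξ, U (-ξ) = cj (U ξ)) : (coef g s U).im = 0 := by
  rw [← Complex.conj_eq_iff_im, coef, ← integral_conj, ← integral_neg_eq_self]
  refine integral_congr_ae ?_
  have hfs : ∀ ξ, freqScale s g (-ξ) = cj (freqScale s g ξ) := fun ξ ↦ by
    rw [freqScale, freqScale, smul_neg, hg, map_smul]
  filter_upwards [hU] with ξ hξ
  rw [hξ, hfs, dotC_cj, Complex.conj_conj]

/-! ### Existence of cascade operators -/

theorem H10df.hat_add (u v : H10df) : (u + v).hat =ᵐ[volume] u.hat + v.hat := by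
  have h : (u + v).toL2 = u.toL2 + v.toL2 := rfl
  rw [H10df.hat, h, FourierTransform.fourier_add]
  exact Lp.coeFn_add _ _

theorem H10df.hat_smul (c : ℝ) (u : H10df) : (c • u).hat =ᵐ[volume] (c : ℂ) • u.hat := by
  have h : (c • u).toL2 = (c : ℂ) • u.toL2 := by
    have h1 : (c • u).toL2 = c • u.toL2 := rfl
    rw [h1]
    apply Lp.ext
    filter_upwards [Lp.coeFn_smul c u.toL2, Lp.coeFn_smul (c : ℂ) u.toL2] with x h1 h2
    rw [h1, h2]
    ext i
    simp
  rw [H10df.hat, h, FourierTransform.fourier_smul]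
  exact Lp.coeFn_smul _ _

theorem exists_coefCLM {g : R3 → C3} (hc : Continuous g) (hg : MemLp g 2 volume) {a : ℝ}
    (ha : 0 < a) (hga : ∀ ξ, ‖ξ‖ < a → g ξ = 0) {s : ℝ} (hs : 0 < s) :
    ∃ ℓ : H10df →L[ℝ] ℝ, (∀ u, ℓ u = (coef g s u.hat).re) ∧
      ‖ℓ‖ ≤ (eLpNorm g 2 volume).toReal * decay a s := by
  have key := fun u : H10df ↦ norm_coef_le hc hg ha hga hs u u.measurable_hat fun _ ↦ le_rfl
  let L : H10df →ₗ[ℝ] ℝ :=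
    { toFun := fun u ↦ (coef g s u.hat).re
      map_add' := fun u v ↦ by
        rw [← Complex.add_re, coef, coef, coef, ← integral_add (key u).1 (key v).1]
        congr 1
        refine integral_congr_ae ?_
        filter_upwards [H10df.hat_add u v] with ξ hξ
        rw [hξ, Pi.add_apply, map_add]
      map_smul' := fun c u ↦ by
        rw [coef, coef, RingHom.id_apply, smul_eq_mul, ← Complex.re_ofReal_mul,
          ← integral_const_mul]
        congr 1
        refine integral_congr_ae ?_
        filter_upwards [H10df.hat_smul c u] with ξ hξ
        rw [hξ, Pi.smul_apply, map_smul, smul_eq_mul] }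
  have hb : ∀ u, ‖L u‖ ≤ (eLpNorm g 2 volume).toReal * decay a s * ‖u‖ := fun u ↦
    (Complex.abs_re_le_norm _).trans (key u).2
  exact ⟨L.mkContinuous _ hb, fun u ↦ rfl,
    L.mkContinuous_norm_le (mul_nonneg ENNReal.toReal_nonneg (by unfold decay; positivity)) _⟩

theorem decay_nonneg (a s : ℝ) : 0 ≤ decay a s := by unfold decay; positivity

theorem decay_le_one (a s : ℝ) : decay a s ≤ 1 :=
  inv_le_one_of_one_le₀ (one_le_pow₀ (by nlinarith [sq_nonneg (a * s)]))

theorem decay_le {a s : ℝ} (ha : 0 < a) (hs : 0 < s) : decay a s ≤ (a ^ 4)⁻¹ * (s ^ 4)⁻¹ := by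
  rw [← mul_inv, ← mul_pow]
  refine inv_anti₀ (by positivity) ?_
  calc (a * s) ^ 4 = ((a * s) ^ 2) ^ 2 := by ring
    _ ≤ (1 + (a * s) ^ 2) ^ 2 := by gcongr; linarith
    _ ≤ _ := pow_le_pow_right₀ (by nlinarith [sq_nonneg (a * s)]) (by norm_num)

/-- For `s ≥ 1` a single factor `decay a s`, of order `s⁻⁴`, already beats `s^{5/2} ≤ s³`; for `s ≤
1` the power itself is small. The bound by `min s s⁻¹` makes the cascade series geometric in both
directions. -/
theorem rpow_mul_decay_le {a s : ℝ} (ha : 0 < a) (hs : 0 < s) :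
    s ^ (5 / 2 : ℝ) * decay a s ^ 3 ≤ (1 + (a ^ 4)⁻¹) * min s s⁻¹ := by
  have h3 : decay a s ^ 3 ≤ decay a s :=
    pow_le_of_le_one (decay_nonneg a s) (decay_le_one a s) (by norm_num)
  rcases le_total 1 s with h | h
  · have h1 : s ^ (5 / 2 : ℝ) ≤ s ^ 3 := by
      rw [← Real.rpow_natCast]
      exact Real.rpow_le_rpow_of_exponent_le h (by norm_num)
    rw [min_eq_right ((inv_le_one_of_one_le₀ h).trans h)]
    calc _ ≤ s ^ 3 * ((a ^ 4)⁻¹ * (s ^ 4)⁻¹) := by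
          gcongr
          · exact pow_nonneg (decay_nonneg _ _) _
          · exact h3.trans (decay_le ha hs)
      _ = (a ^ 4)⁻¹ * s⁻¹ := by field_simp
      _ ≤ _ := by gcongr; linarith
  · have h1 : s ^ (5 / 2 : ℝ) ≤ s := by
      conv_rhs => rw [← Real.rpow_one s]
      exact Real.rpow_le_rpow_of_exponent_ge hs h (by norm_num)
    rw [min_eq_left (h.trans ((one_le_inv₀ hs).2 h))]
    have h4 : 0 < (a ^ 4)⁻¹ := by positivity
    calc _ ≤ s * 1 := by
          gcongr
          · exact pow_nonneg (decay_nonneg _ _) _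
          · exact h3.trans (decay_le_one _ _)
      _ ≤ _ := by rw [mul_comm]; gcongr; linarith

theorem summable_rpow_mul_decay {a q : ℝ} (ha : 0 < a) (hq : 1 < q) :
    Summable fun n : ℤ ↦ (q ^ n) ^ (5 / 2 : ℝ) * decay a (q ^ n) ^ 3 := by
  have hq0 : 0 < q := zero_lt_one.trans hq
  have hgeo : Summable fun n : ℕ ↦ (1 + (a ^ 4)⁻¹) * q⁻¹ ^ n :=
    (summable_geometric_of_lt_one (by positivity) (inv_lt_one_of_one_lt₀ hq)).mul_left _
  refine Summable.of_nat_of_neg ?_ ?_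
  · refine hgeo.of_nonneg_of_le (fun n ↦ mul_nonneg (by positivity)
      (pow_nonneg (decay_nonneg _ _) _)) fun n ↦ ?_
    refine (rpow_mul_decay_le ha (by positivity)).trans ?_
    gcongr
    refine (min_le_right _ _).trans (le_of_eq ?_)
    rw [zpow_natCast, inv_pow]
  · refine hgeo.of_nonneg_of_le (fun n ↦ mul_nonneg (by positivity)
      (pow_nonneg (decay_nonneg _ _) _)) fun n ↦ ?_
    refine (rpow_mul_decay_le ha (by positivity)).trans ?_
    gcongr
    refine (min_le_left _ _).trans (le_of_eq ?_)
    rw [zpow_neg, zpow_natCast, inv_pow]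

/-- The complex conjugate of the Fourier transform of a wavelet. -/
def profile (ψ : 𝓢(R3, C3)) (ξ : R3) : C3 := cj ((𝓕 ψ : 𝓢(R3, C3)) ξ)

theorem contDiff_profile (ψ : 𝓢(R3, C3)) : ContDiff ℝ (⊤ : ℕ∞) (profile ψ) :=
  cj.toContinuousLinearEquiv.contDiff.comp ((𝓕 ψ : 𝓢(R3, C3)).smooth ⊤)

theorem memLp_profile (ψ : 𝓢(R3, C3)) : MemLp (profile ψ) 2 volume :=
  cj.toContinuousLinearEquiv.toContinuousLinearMap.comp_memLp'
    ((𝓕 ψ : 𝓢(R3, C3)).memLp 2 volume)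

theorem fourier_toLp_ae (ψ : 𝓢(R3, C3)) :
    (𝓕 (ψ.toLp 2 volume : L2Field) : L2Field) =ᵐ[volume] (𝓕 ψ : 𝓢(R3, C3)) := by
  rw [SchwartzMap.toLp_fourier_eq]
  exact SchwartzMap.coeFn_toLp _ _ _

theorem profile_neg {ψ : 𝓢(R3, C3)} (h : ∀ x i, (ψ x i).im = 0) (ξ : R3) :
    profile ψ (-ξ) = cj (profile ψ ξ) := by
  have h1 : ∀ᵐ ξ, (𝓕 ψ : 𝓢(R3, C3)) (-ξ) = cj ((𝓕 ψ : 𝓢(R3, C3)) ξ) := by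
    have h2 := fourier_neg_of_real (ψ.toLp 2 volume) (by
      filter_upwards [ψ.coeFn_toLp 2 volume] with x hx i
      rw [hx, h])
    have h3 : ∀ᵐ ξ, (𝓕 (ψ.toLp 2 volume : L2Field) : L2Field) (-ξ) = (𝓕 ψ : 𝓢(R3, C3)) (-ξ) :=
      (Measure.measurePreserving_neg (volume : Measure R3)).quasiMeasurePreserving.ae
        (fourier_toLp_ae ψ)
    filter_upwards [h2, h3, fourier_toLp_ae ψ] with ξ h4 h5 h6
    rw [← h5, h4, h6]
  have hc := (𝓕 ψ : 𝓢(R3, C3)).continuous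
  -- The `L²` theory gives the symmetry almost everywhere; both sides are continuous, so it holds
  -- everywhere.
  have h4 := Continuous.ae_eq_iff_eq volume (f := fun ξ ↦ (𝓕 ψ : 𝓢(R3, C3)) (-ξ))
    (g := fun ξ ↦ cj ((𝓕 ψ : 𝓢(R3, C3)) ξ)) (by fun_prop) (cj.continuous.comp hc)
  rw [profile, profile, congrFun (h4.1 h1) ξ]

/-- Plancherel. The conjugate built into `profile` turns the sesquilinear pairing into the bilinear
one, and on the physical side conjugation does nothing because `ψ` is real. -/
theorem pairing_eq_coef {ψ : 𝓢(R3, C3)} (h : ∀ x i, (ψ x i).im = 0) {s : ℝ} (hs : 0 < s)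
    (u : H10df) :
    pairing u.toL2 (fun x ↦ s ^ (3 / 2 : ℝ) • ψ (s • x)) = (coef (profile ψ) s u.hat).re := by
  set d : L2Field := dil ⟨s, hs⟩ (ψ.toLp 2 volume)
  have hqmp : ∀ c : ℝ, c ≠ 0 → Measure.QuasiMeasurePreserving (fun x : R3 ↦ c • x) := fun c hc ↦ by
    refine ⟨by fun_prop, ?_⟩
    rw [Measure.map_addHaar_smul _ hc]
    exact Measure.smul_absolutelyContinuous
  have hd : d =ᵐ[volume] fun x ↦ s ^ (3 / 2 : ℝ) • ψ (s • x) := by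
    filter_upwards [dil_ae ⟨s, hs⟩ (ψ.toLp 2 volume),
      (hqmp s hs.ne').ae (ψ.coeFn_toLp 2 volume)] with x h1 h2
    rw [h1, h2]
  have hdF : (𝓕 d : L2Field) =ᵐ[volume] fun ξ ↦ cj (freqScale s (profile ψ) ξ) := by
    filter_upwards [fourier_dil ⟨s, hs⟩ (ψ.toLp 2 volume),
      (hqmp s⁻¹ (inv_ne_zero hs.ne')).ae (fourier_toLp_ae ψ)] with x h1 h2
    rw [h1, freqScale, map_smul, profile, cj_cj, h2]
  rw [pairing, coef]
  congr 1
  have h1 := integral_inner_fourier d u.toL2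
  trans ∫ x, dotC (cj (d x)) (u.toL2 x)
  · refine integral_congr_ae ?_
    filter_upwards [hd] with x hx
    have : cj (d x) = s ^ (3 / 2 : ℝ) • ψ (s • x) := by
      rw [hx, map_smul]
      congr 1
      ext i
      rw [cj_apply, Complex.conj_eq_iff_im.2 (h _ i)]
    rw [this, dotC_comm, dotC_apply]
  · rw [← h1]
    refine integral_congr_ae ?_
    filter_upwards [hdF] with x hx
    rw [hx, cj_cj]
    rfl

theorem IsWavelet.profile_eq_zero {ε : ℝ} {ψ : 𝓢(R3, C3)} (h : IsWavelet ε ψ) {ξ : R3}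
    (hξ : ‖ξ‖ < 1 - 2 * ε ∨ 1 + 2 * ε < ‖ξ‖) : profile ψ ξ = 0 := by
  by_contra hne
  have h1 : ξ ∈ Function.support (𝓕 ψ : 𝓢(R3, C3)) := fun h0 ↦ hne (by
    rw [profile, h0, map_zero])
  have h2 := h.2 ξ h1
  rcases hξ with h3 | h3
  · linarith [h2.1]
  · linarith [h2.2]

theorem rescale_eq {ε : ℝ} (hε : 0 < ε) (ψ : 𝓢(R3, C3)) (n : ℤ) :
    rescale ε ψ n = fun x ↦ ((1 + ε) ^ n) ^ (3 / 2 : ℝ) • ψ ((1 + ε) ^ n • x) := by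
  funext x
  rw [rescale, ← Real.rpow_intCast, ← Real.rpow_mul (by positivity)]
  congr 2
  ring

theorem cascadeTerm_eq {ε : ℝ} (hε : 0 < ε) {ψ : Fin 3 → 𝓢(R3, C3)} (hψ : ∀ i, IsWavelet ε (ψ i))
    (u v w : H10df) (n : ℤ) : cascadeTerm ε ψ u v w n = ((1 + ε) ^ n) ^ (5 / 2 : ℝ) *
      (coef (profile (ψ 0)) ((1 + ε) ^ n) u.hat).re *
      (coef (profile (ψ 1)) ((1 + ε) ^ n) v.hat).re *
        (coef (profile (ψ 2)) ((1 + ε) ^ n) w.hat).re := by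
  have hp : 0 < (1 + ε) ^ n := by positivity
  rw [cascadeTerm, rescale_eq hε, rescale_eq hε, rescale_eq hε, pairing_eq_coef (hψ 0).1 hp,
    pairing_eq_coef (hψ 1).1 hp, pairing_eq_coef (hψ 2).1 hp]
  congr 3
  rw [← Real.rpow_intCast, ← Real.rpow_mul (by positivity)]
  congr 1
  ring

-- The series of rank one operators converges in operator norm. The condition `2 * ε < 1` keeps the
-- annulus away from the origin, and this gives the coefficients their decay at high frequencies.
set_option maxSynthPendingDepth 5 in
theorem exists_cascade {ε : ℝ} (hε : 0 < ε) (hε' : 2 * ε < 1) {ψ : Fin 3 → 𝓢(R3, C3)}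
    (hψ : ∀ i, IsWavelet ε (ψ i)) : ∃ C : BilinOp, IsCascadeWith ε ψ C := by
  set a : ℝ := 1 - 2 * ε
  have ha : 0 < a := by simp only [a]; linarith
  have hex : ∀ (i : Fin 3) (n : ℤ), ∃ ℓ : H10df →L[ℝ] ℝ,
      (∀ u, ℓ u = (coef (profile (ψ i)) ((1 + ε) ^ n) u.hat).re) ∧
      ‖ℓ‖ ≤ (eLpNorm (profile (ψ i)) 2 volume).toReal * decay a ((1 + ε) ^ n) := fun i n ↦
    exists_coefCLM (contDiff_profile _).continuous (memLp_profile _) ha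
      (fun ξ hξ ↦ (hψ i).profile_eq_zero (.inl hξ)) (by positivity)
  choose ℓ hℓ hℓn using hex
  set T : ℤ → BilinOp := fun n ↦ ((1 + ε) ^ n) ^ (5 / 2 : ℝ) •
    (ℓ 0 n).smulRight ((ℓ 1 n).smulRight (ℓ 2 n))
  set K : Fin 3 → ℝ := fun i ↦ (eLpNorm (profile (ψ i)) 2 volume).toReal
  have hT : ∀ n, ‖T n‖ ≤ K 0 * K 1 * K 2 *
      (((1 + ε) ^ n) ^ (5 / 2 : ℝ) * decay a ((1 + ε) ^ n) ^ 3) := fun n ↦ by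
    have hp : 0 < ((1 + ε) ^ n) ^ (5 / 2 : ℝ) := by positivity
    simp only [T]
    rw [norm_smul, Real.norm_of_nonneg hp.le, ContinuousLinearMap.norm_smulRight_apply,
      ContinuousLinearMap.norm_smulRight_apply]
    have hd := decay_nonneg a ((1 + ε) ^ n)
    have hK : ∀ i, 0 ≤ K i := fun i ↦ ENNReal.toReal_nonneg
    calc _ ≤ ((1 + ε) ^ n) ^ (5 / 2 : ℝ) * ((K 0 * decay a ((1 + ε) ^ n)) *
          ((K 1 * decay a ((1 + ε) ^ n)) * (K 2 * decay a ((1 + ε) ^ n)))) := by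
          gcongr
          · exact hℓn 0 n
          · exact hℓn 1 n
          · exact hℓn 2 n
      _ = _ := by ring
  have hsum : Summable T :=
    Summable.of_norm_bounded ((summable_rpow_mul_decay ha (by linarith)).mul_left _) hT
  refine ⟨∑' n, T n, fun u v w ↦ ?_⟩
  have h1 := ((hsum.hasSum.mapL (ContinuousLinearMap.apply ℝ _ u)).mapL
    (ContinuousLinearMap.apply ℝ _ v)).mapL (ContinuousLinearMap.apply ℝ _ w)
  refine h1.congr_fun fun n ↦ ?_
  rw [cascadeTerm_eq hε hψ, ← hℓ, ← hℓ, ← hℓ]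
  simp [T]
  ring

/-! ### Multipliers with a discrete scale invariance -/

/-- `f` is a smooth function supported on the annulus `1/2 ≤ |ξ| ≤ 4`. -/
structure IsBand (f : R3 → ℂ) : Prop where
  smooth : ContDiff ℝ (⊤ : ℕ∞) f
  eq_zero : ∀ ξ, (‖ξ‖ < 1 / 2 ∨ 4 < ‖ξ‖) → f ξ = 0

/-- The sum of the dilates of `f` by the powers of `Q`. -/
def periodize (Q : ℝ) (f : R3 → ℂ) (ξ : R3) : ℂ := ∑' n : ℤ, f ((Q ^ n)⁻¹ • ξ)

theorem norm_zpow_inv_smul {Q : ℝ} (hQ : 0 < Q) (n : ℤ) (ξ : R3) :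
    ‖(Q ^ n)⁻¹ • ξ‖ = ‖ξ‖ / Q ^ n := by
  rw [norm_smul, norm_inv, Real.norm_of_nonneg (by positivity), inv_mul_eq_div]

/-- Since `Q` is much larger than the ratio 8 of the radii of the annulus, dilates by different
powers of `Q` are disjoint. The window for `|ξ| / Q ^ n` is open and wider than one period `Q`, so
that the windows cover all `ξ ≠ 0` and the conclusion holds in a neighbourhood. -/
theorem band_ne {E : Type*} [Zero E] {Q : ℝ} (hQ : 100 ≤ Q) {f : R3 → E}
    (hf : ∀ ξ, (‖ξ‖ < 1 / 2 ∨ 4 < ‖ξ‖) → f ξ = 0)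
    {ξ : R3} {n : ℤ} (h1 : 4 / Q < ‖ξ‖ / Q ^ n) (h2 : ‖ξ‖ / Q ^ n < Q / 2) {m : ℤ} (hm : m ≠ n) :
    f ((Q ^ m)⁻¹ • ξ) = 0 := by
  have hQ0 : 0 < Q := by linarith
  have hn : 0 < Q ^ n := by positivity
  refine hf _ ?_
  rw [norm_zpow_inv_smul hQ0]
  rcases lt_or_gt_of_ne hm with h | h
  · right
    have h3 : Q ^ m ≤ Q ^ (n - 1) := zpow_le_zpow_right₀ (by linarith) (by omega)
    have h4 : ‖ξ‖ / Q ^ (n - 1) ≤ ‖ξ‖ / Q ^ m := by gcongr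
    refine lt_of_lt_of_le ?_ h4
    rw [zpow_sub_one₀ hQ0.ne', div_mul_eq_div_div, div_inv_eq_mul]
    rwa [div_lt_iff₀ hQ0] at h1
  · left
    have h3 : Q ^ (n + 1) ≤ Q ^ m := zpow_le_zpow_right₀ (by linarith) (by omega)
    have h4 : ‖ξ‖ / Q ^ m ≤ ‖ξ‖ / Q ^ (n + 1) := by gcongr
    refine lt_of_le_of_lt h4 ?_
    rw [zpow_add_one₀ hQ0.ne', div_mul_eq_div_div, div_lt_iff₀ hQ0]
    linarith

theorem periodize_eq {Q : ℝ} (hQ : 100 ≤ Q) {f : R3 → ℂ} (hf : IsBand f)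
    {ξ : R3} {n : ℤ} (h1 : 4 / Q < ‖ξ‖ / Q ^ n) (h2 : ‖ξ‖ / Q ^ n < Q / 2) :
    periodize Q f ξ = f ((Q ^ n)⁻¹ • ξ) :=
  tsum_eq_single n fun _ hm ↦ band_ne hQ hf.eq_zero h1 h2 hm

theorem exists_scale {Q : ℝ} (hQ : 100 ≤ Q) {ξ : R3} (hξ : ξ ≠ 0) :
    ∃ n : ℤ, 4 / Q < ‖ξ‖ / Q ^ n ∧ ‖ξ‖ / Q ^ n < Q / 2 := by
  have hQ0 : 0 < Q := by linarith
  -- The factor 4 places `|ξ| / Q ^ n` in `[1/4, Q/4)`, which lies inside the open window because `4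
  -- / Q ≤ 1/25`.
  obtain ⟨n, hn1, hn2⟩ := exists_mem_Ico_zpow (x := 4 * ‖ξ‖) (y := Q)
    (by have := norm_pos_iff.2 hξ; positivity) (by linarith)
  have hn : 0 < Q ^ n := by positivity
  refine ⟨n, ?_, ?_⟩
  · rw [div_lt_div_iff₀ hQ0 hn]
    nlinarith
  · rw [div_lt_iff₀ hn]
    rw [zpow_add_one₀ hQ0.ne'] at hn2
    nlinarith [norm_nonneg ξ]

theorem periodize_zero {Q : ℝ} {f : R3 → ℂ} (hf : IsBand f) : periodize Q f 0 = 0 := by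
  simp [periodize, hf.eq_zero 0 (by simp)]

theorem isOpen_scale (Q : ℝ) (n : ℤ) :
    IsOpen {ξ : R3 | 4 / Q < ‖ξ‖ / Q ^ n ∧ ‖ξ‖ / Q ^ n < Q / 2} := by
  have hc : Continuous fun ξ : R3 ↦ ‖ξ‖ / Q ^ n := by fun_prop
  exact (isOpen_lt continuous_const hc).inter (isOpen_lt hc continuous_const)

theorem periodize_eventuallyEq {Q : ℝ} (hQ : 100 ≤ Q) {f : R3 → ℂ} (hf : IsBand f)
    {ξ : R3} {n : ℤ} (h : 4 / Q < ‖ξ‖ / Q ^ n ∧ ‖ξ‖ / Q ^ n < Q / 2) :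
    periodize Q f =ᶠ[nhds ξ] fun x ↦ f ((Q ^ n)⁻¹ • x) := by
  filter_upwards [(isOpen_scale Q n).mem_nhds h] with x hx
  exact periodize_eq hQ hf hx.1 hx.2

theorem contDiffOn_periodize {Q : ℝ} (hQ : 100 ≤ Q) {f : R3 → ℂ} (hf : IsBand f) :
    ContDiffOn ℝ (⊤ : ℕ∞) (periodize Q f) {0}ᶜ := by
  intro ξ hξ
  obtain ⟨n, hn⟩ := exists_scale hQ hξ
  refine ContDiffAt.contDiffWithinAt ?_
  refine ContDiffAt.congr_of_eventuallyEq ?_ (periodize_eventuallyEq hQ hf hn)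
  exact (hf.smooth.comp (contDiff_const_smul _)).contDiffAt

theorem periodize_sub {Q : ℝ} (hQ : 100 ≤ Q) {f g : R3 → ℂ} (hf : IsBand f) (hg : IsBand g) :
    periodize Q f - periodize Q g = periodize Q (f - g) := by
  have hfg : IsBand (f - g) := ⟨hf.smooth.sub hg.smooth, fun ξ hξ ↦ by
    rw [Pi.sub_apply, hf.eq_zero ξ hξ, hg.eq_zero ξ hξ, sub_zero]⟩
  ext ξ
  rw [Pi.sub_apply]
  by_cases hξ : ξ = 0
  · rw [hξ, periodize_zero hf, periodize_zero hg, periodize_zero hfg, sub_zero]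
  · obtain ⟨n, h1, h2⟩ := exists_scale hQ hξ
    rw [periodize_eq hQ hf h1 h2, periodize_eq hQ hg h1 h2, periodize_eq hQ hfg h1 h2,
      Pi.sub_apply]

theorem periodize_neg {Q : ℝ} {f : R3 → ℂ} (hf : ∀ ξ, f (-ξ) = starRingEnd ℂ (f ξ)) (ξ : R3) :
    periodize Q f (-ξ) = starRingEnd ℂ (periodize Q f ξ) := by
  simp only [periodize, smul_neg, hf, Complex.conj_tsum]

/-- The quantity `|ξ|^k |∇^k m|` is invariant under dilations, so each point may be moved to the
basic scale. There `f` is locally zero for `|η| > 4`, whence the factor `4 ^ k`. -/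
theorem symbolSeminorm_periodize_le {Q : ℝ} (hQ : 100 ≤ Q) {f : R3 → ℂ} (hf : IsBand f) {k : ℕ}
    {C : ℝ} (hC : 0 ≤ C) (h : ∀ ξ, ‖ξ‖ ≤ 4 → ‖iteratedFDeriv ℝ k f ξ‖ ≤ C) :
    symbolSeminorm k (periodize Q f) ≤ ENNReal.ofReal (4 ^ k * C) := by
  have hQ0 : 0 < Q := by linarith
  refine iSup₂_le fun ξ hξ ↦ ?_
  obtain ⟨n, hn⟩ := exists_scale hQ hξ
  have hp : 0 < Q ^ n := by positivity
  have h1 := congrFun (iteratedFDeriv_comp_const_smul (𝕜 := ℝ) (i := k) (f := f) (Q ^ n)⁻¹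
    (hf.smooth.of_le (mod_cast le_top))) ξ
  rw [((periodize_eventuallyEq hQ hf hn).iteratedFDeriv ℝ k).eq_of_nhds, h1, ← ofReal_norm,
    ← ofReal_norm, ← ENNReal.ofReal_pow (norm_nonneg _), ← ENNReal.ofReal_mul (by positivity)]
  refine ENNReal.ofReal_le_ofReal ?_
  rw [norm_smul, norm_pow, norm_inv, Real.norm_of_nonneg hp.le, ← mul_assoc, ← mul_pow,
    mul_comm ‖ξ‖,
    inv_mul_eq_div, ← norm_zpow_inv_smul hQ0]
  set η := (Q ^ n)⁻¹ • ξ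
  rcases le_or_gt ‖η‖ 4 with h4 | h4
  · gcongr
    exact h η h4
  · have h5 : f =ᶠ[nhds η] fun _ ↦ 0 := by
      filter_upwards [(isOpen_lt continuous_const continuous_norm).mem_nhds h4] with x hx
      exact hf.eq_zero x (.inr hx)
    rw [(h5.iteratedFDeriv ℝ k).eq_of_nhds]
    have h6 : iteratedFDeriv ℝ k (fun _ : R3 ↦ (0 : ℂ)) η = 0 := by
      simp
    rw [h6, norm_zero, mul_zero]
    positivity

/-- The derivative in the second variable is the full derivative restricted to the directions of the
second factor, and the full derivative is jointly continuous. -/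
theorem continuous_iteratedFDeriv_snd {P : Type*} [NormedAddCommGroup P] [NormedSpace ℝ P]
    {G : P × R3 → ℂ} (hG : ContDiff ℝ (⊤ : ℕ∞) G) (k : ℕ) :
    Continuous fun z : P × R3 ↦ iteratedFDeriv ℝ k (fun ξ ↦ G (z.1, ξ)) z.2 := by
  have h1 : ∀ z : P × R3, iteratedFDeriv ℝ k (fun ξ ↦ G (z.1, ξ)) z.2 =
      (iteratedFDeriv ℝ k G z).compContinuousLinearMap
        fun _ ↦ ContinuousLinearMap.inr ℝ P R3 := by
    intro z
    have h2 : (fun ξ ↦ G (z.1, ξ)) =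
        (fun y ↦ G ((z.1, 0) + y)) ∘ (ContinuousLinearMap.inr ℝ P R3) := by
      ext ξ
      simp
    have h3 : ContDiff ℝ k (fun y ↦ G ((z.1, 0) + y)) :=
      (hG.of_le (mod_cast le_top)).comp (contDiff_const.add contDiff_id)
    rw [h2, ContinuousLinearMap.iteratedFDeriv_comp_right _ h3 _ le_rfl,
      iteratedFDeriv_comp_add_left]
    simp
  simp only [h1]
  exact (ContinuousMultilinearMap.compContinuousLinearMapL (𝕜 := ℝ) (F := ℂ)
    fun _ : Fin k ↦ ContinuousLinearMap.inr ℝ P R3).continuous.comp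
      (hG.continuous_iteratedFDeriv (mod_cast le_top))

/-- The order zero multiplier with symbol `periodize Q f`. -/
def bandMultiplier {Q : ℝ} (hQ : 100 ≤ Q) (f : R3 → ℂ) (hf : IsBand f)
    (hr : ∀ ξ, f (-ξ) = starRingEnd ℂ (f ξ)) : RealMultiplier where
  symbol := periodize Q f
  smooth := contDiffOn_periodize hQ hf
  bounded k := by
    have hc : Continuous (iteratedFDeriv ℝ k f) :=
      hf.smooth.continuous_iteratedFDeriv (mod_cast le_top)
    obtain ⟨C, hC⟩ := (isCompact_closedBall (0 : R3) 4).exists_bound_of_continuousOn hc.continuousOn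
    have hC0 : 0 ≤ C := (norm_nonneg _).trans (hC 0 (by simp))
    exact (symbolSeminorm_periodize_le hQ hf hC0 fun ξ hξ ↦ hC ξ (by simpa using hξ)).trans_lt
      ENNReal.ofReal_lt_top
  real ξ _ := periodize_neg hr ξ

theorem symbolSeminorm_add_le (k : ℕ) {f g : R3 → ℂ} (hf : ContDiffOn ℝ (⊤ : ℕ∞) f {0}ᶜ)
    (hg : ContDiffOn ℝ (⊤ : ℕ∞) g {0}ᶜ) :
    symbolSeminorm k (f + g) ≤ symbolSeminorm k f + symbolSeminorm k g := by
  refine iSup₂_le fun ξ hξ ↦ ?_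
  have ho : {0}ᶜ ∈ nhds ξ := isOpen_compl_singleton.mem_nhds hξ
  have hf' : ContDiffAt ℝ k f ξ := (hf.contDiffAt ho).of_le (mod_cast le_top)
  have hg' : ContDiffAt ℝ k g ξ := (hg.contDiffAt ho).of_le (mod_cast le_top)
  rw [iteratedFDeriv_add_apply hf' hg']
  calc _ ≤ ‖ξ‖ₑ ^ k * (‖iteratedFDeriv ℝ k f ξ‖ₑ + ‖iteratedFDeriv ℝ k g ξ‖ₑ) := by
        gcongr; exact enorm_add_le _ _
    _ = _ := mul_add _ _ _
    _ ≤ _ := by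
      gcongr
      · exact le_iSup₂ (f := fun (ξ : R3) (_ : ξ ≠ 0) ↦ ‖ξ‖ₑ ^ k * ‖iteratedFDeriv ℝ k f ξ‖ₑ) ξ hξ
      · exact le_iSup₂ (f := fun (ξ : R3) (_ : ξ ≠ 0) ↦ ‖ξ‖ₑ ^ k * ‖iteratedFDeriv ℝ k g ξ‖ₑ) ξ hξ

/-! ### Band functions depending smoothly on a parameter -/

section Family

variable {P : Type*} [NormedAddCommGroup P] [NormedSpace ℝ P] {G : P × R3 → ℂ}

theorem isBand_family (hG : ContDiff ℝ (⊤ : ℕ∞) G)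
    (hz : ∀ p ξ, (‖ξ‖ < 1 / 2 ∨ 4 < ‖ξ‖) → G (p, ξ) = 0) (p : P) : IsBand fun ξ ↦ G (p, ξ) :=
  ⟨hG.comp (contDiff_const.prodMk contDiff_id), hz p⟩

theorem exists_symbolSeminorm_le {Q : ℝ} (hQ : 100 ≤ Q) (hG : ContDiff ℝ (⊤ : ℕ∞) G)
    (hz : ∀ p ξ, (‖ξ‖ < 1 / 2 ∨ 4 < ‖ξ‖) → G (p, ξ) = 0) {K : Set P} (hK : IsCompact K) (k : ℕ) :
    ∃ C : ℝ, ∀ p ∈ K, symbolSeminorm k (periodize Q fun ξ ↦ G (p, ξ)) ≤ ENNReal.ofReal C := by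
  obtain ⟨C, hC⟩ := (hK.prod (isCompact_closedBall (0 : R3) 4)).exists_bound_of_continuousOn
    (continuous_iteratedFDeriv_snd hG k).continuousOn
  refine ⟨4 ^ k * max C 0, fun p hp ↦ symbolSeminorm_periodize_le hQ (isBand_family hG hz p)
    (le_max_right _ _) fun ξ hξ ↦ (hC (p, ξ) ⟨hp, by simpa using hξ⟩).trans (le_max_left _ _)⟩

theorem eventually_symbolSeminorm_sub_lt {Q : ℝ} (hQ : 100 ≤ Q) (hG : ContDiff ℝ (⊤ : ℕ∞) G)
    (hz : ∀ p ξ, (‖ξ‖ < 1 / 2 ∨ 4 < ‖ξ‖) → G (p, ξ) = 0) (p₀ : P) (k : ℕ) {r : ℝ≥0∞}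
    (hr : 0 < r) : ∀ᶠ p in nhds p₀, symbolSeminorm k
      ((periodize Q fun ξ ↦ G (p, ξ)) - periodize Q fun ξ ↦ G (p₀, ξ)) < r := by
  obtain ⟨e, he0, her⟩ : ∃ e : ℝ, 0 < e ∧ ENNReal.ofReal (4 ^ k * e) < r := by
    obtain ⟨d, hd0, hd⟩ := ENNReal.lt_iff_exists_real_btwn.1 hr
    refine ⟨d / 4 ^ k, ?_, ?_⟩
    · have := ENNReal.ofReal_pos.1 hd.1
      positivity
    · rw [mul_div_cancel₀ _ (by positivity)]
      exact hd.2
  have hc := continuous_iteratedFDeriv_snd hG k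
  have hc0 : Continuous fun ξ ↦ iteratedFDeriv ℝ k (fun ξ ↦ G (p₀, ξ)) ξ :=
    hc.comp (continuous_const.prodMk continuous_id)
  -- Compactness of the ball makes the joint continuity of the derivatives uniform in `ξ`.
  have hev : ∀ᶠ p in nhds p₀, ∀ ξ ∈ Metric.closedBall (0 : R3) 4,
      ‖iteratedFDeriv ℝ k (fun ξ ↦ G (p, ξ)) ξ - iteratedFDeriv ℝ k (fun ξ ↦ G (p₀, ξ)) ξ‖ < e := by
    refine (isCompact_closedBall (0 : R3) 4).eventually_forall_of_forall_eventually fun ξ _ ↦ ?_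
    have hd : Continuous fun z : P × R3 ↦ ‖iteratedFDeriv ℝ k (fun ξ ↦ G (z.1, ξ)) z.2 -
        iteratedFDeriv ℝ k (fun ξ ↦ G (p₀, ξ)) z.2‖ :=
      (hc.sub (hc0.comp continuous_snd)).norm
    exact hd.continuousAt.eventually_lt continuousAt_const (by simpa using he0)
  filter_upwards [hev] with p hp
  have hb := isBand_family hG hz p
  have hb₀ := isBand_family hG hz p₀
  rw [periodize_sub hQ hb hb₀]
  refine (symbolSeminorm_periodize_le hQ ?_ he0.le fun ξ hξ ↦ ?_).trans_lt her
  · exact ⟨hb.smooth.sub hb₀.smooth, fun ξ hξ ↦ by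
      rw [Pi.sub_apply, hb.eq_zero ξ hξ, hb₀.eq_zero ξ hξ, sub_zero]⟩
  · rw [iteratedFDeriv_sub_apply (hb.smooth.of_le (mod_cast le_top)).contDiffAt
      (hb₀.smooth.of_le (mod_cast le_top)).contDiffAt]
    exact (hp ξ (by simpa using hξ)).le

instance : BorelSpace RealMultiplier := ⟨rfl⟩

/-- Continuity yields Borel measurability of the sampled multipliers. It is tested on the generating
seminorm balls, whose centres `m₀` are arbitrary multipliers. -/
theorem continuous_bandMultiplier {Q : ℝ} (hQ : 100 ≤ Q) (hG : ContDiff ℝ (⊤ : ℕ∞) G)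
    (hz : ∀ p ξ, (‖ξ‖ < 1 / 2 ∨ 4 < ‖ξ‖) → G (p, ξ) = 0) {Ω : Type*} [TopologicalSpace Ω]
    {p : Ω → P} (hp : Continuous p) (hr : ∀ ω ξ, G (p ω, -ξ) = starRingEnd ℂ (G (p ω, ξ))) :
    Continuous fun ω ↦ bandMultiplier hQ (fun ξ ↦ G (p ω, ξ)) (isBand_family hG hz (p ω))
      (hr ω) := by
  refine continuous_generateFrom_iff.2 ?_
  rintro S ⟨k, m₀, r, rfl⟩
  refine isOpen_iff_mem_nhds.2 fun ω₀ hω₀ ↦ ?_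
  rw [Set.mem_preimage, Set.mem_ofPred_eq] at hω₀
  -- The remaining room in the ball; the triangle inequality allows a perturbation of this size.
  have hpos : 0 < r - symbolSeminorm k ((periodize Q fun ξ ↦ G (p ω₀, ξ)) - m₀.symbol) :=
    tsub_pos_iff_lt.2 hω₀
  have hev := hp.continuousAt.eventually
    (eventually_symbolSeminorm_sub_lt hQ hG hz (p ω₀) k hpos)
  filter_upwards [hev] with ω hω
  change symbolSeminorm k ((periodize Q fun ξ ↦ G (p ω, ξ)) - m₀.symbol) < r
  have h1 : (periodize Q fun ξ ↦ G (p ω, ξ)) - m₀.symbol =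
      ((periodize Q fun ξ ↦ G (p ω, ξ)) - periodize Q fun ξ ↦ G (p ω₀, ξ)) +
        ((periodize Q fun ξ ↦ G (p ω₀, ξ)) - m₀.symbol) := by abel
  have hs : ∀ ω, ContDiffOn ℝ (⊤ : ℕ∞) (periodize Q fun ξ ↦ G (p ω, ξ)) {0}ᶜ := fun ω ↦
    contDiffOn_periodize hQ (isBand_family hG hz _)
  rw [h1]
  exact (symbolSeminorm_add_le k ((hs ω).sub (hs ω₀)) ((hs ω₀).sub m₀.smooth)).trans_lt
    (lt_tsub_iff_right.1 hω)

end Family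

/-! ### The rotation group as a compact group -/

instance : MeasurableSpace SO3 := borel SO3

instance : BorelSpace SO3 := ⟨rfl⟩

theorem continuous_SO3_entry (i j : Fin 3) :
    Continuous fun R : SO3 ↦ (R : Matrix (Fin 3) (Fin 3) ℝ) i j :=
  (continuous_apply j).comp ((continuous_apply i).comp continuous_subtype_val)

theorem SO3_inv_apply (R : SO3) (i j : Fin 3) :
    ((R⁻¹ : SO3) : Matrix (Fin 3) (Fin 3) ℝ) i j = (R : Matrix (Fin 3) (Fin 3) ℝ) j i := rfl

instance : ContinuousInv SO3 := ⟨by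
  refine Continuous.subtype_mk (continuous_pi fun i ↦ continuous_pi fun j ↦ ?_) _
  exact continuous_SO3_entry j i⟩

instance : IsTopologicalGroup SO3 where

instance : SecondCountableTopology SO3 :=
  haveI : SecondCountableTopology (Matrix (Fin 3) (Fin 3) ℝ) :=
    inferInstanceAs (SecondCountableTopology (Fin 3 → Fin 3 → ℝ))
  TopologicalSpace.Subtype.secondCountableTopology
    (Matrix.specialOrthogonalGroup (Fin 3) ℝ : Set (Matrix (Fin 3) (Fin 3) ℝ))

instance : CompactSpace SO3 := by
  have hs : ((Matrix.specialOrthogonalGroup (Fin 3) ℝ : Set (Matrix (Fin 3) (Fin 3) ℝ))) =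
      {M | M * M.transpose = 1 ∧ M.det = 1} := by
    ext M
    rw [SetLike.mem_coe, Matrix.mem_specialOrthogonalGroup_iff, Matrix.mem_orthogonalGroup_iff]
    rfl
  have hc : IsClosed
      (Matrix.specialOrthogonalGroup (Fin 3) ℝ : Set (Matrix (Fin 3) (Fin 3) ℝ)) := by
    rw [hs]
    exact (isClosed_eq (by fun_prop) (by fun_prop)).inter (isClosed_eq (by fun_prop) (by fun_prop))
  have hk : IsCompact (Set.pi Set.univ fun _ : Fin 3 ↦ Set.pi Set.univ fun _ : Fin 3 ↦
      Set.Icc (-1 : ℝ) 1) :=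
    isCompact_univ_pi fun _ ↦ isCompact_univ_pi fun _ ↦ isCompact_Icc
  refine isCompact_iff_compactSpace.1 (IsCompact.of_isClosed_subset hk hc fun M hM ↦ ?_)
  refine Set.mem_univ_pi.2 fun i ↦ Set.mem_univ_pi.2 fun j ↦ ?_
  have h1 : M ∈ Matrix.unitaryGroup (Fin 3) ℝ := (Matrix.mem_specialOrthogonalGroup_iff.1 hM).1
  exact abs_le.1 (entry_norm_bound_of_unitary h1 i j)

/-- The Haar probability measure on the rotation group. -/
def haarSO3 : Measure SO3 := Measure.haarMeasure ⊤

instance : haarSO3.IsHaarMeasure := by unfold haarSO3; infer_instance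

instance : IsProbabilityMeasure haarSO3 := ⟨by
  have := Measure.haarMeasure_self (K₀ := (⊤ : TopologicalSpace.PositiveCompacts SO3))
  simpa [haarSO3] using this⟩

theorem continuous_rotSpace : Continuous fun p : SO3 × R3 ↦ rotSpace p.1 p.2 := by
  have h : (fun p : SO3 × R3 ↦ rotSpace p.1 p.2) = fun p ↦ WithLp.toLp 2 fun i ↦
      ∑ j, (p.1 : Matrix (Fin 3) (Fin 3) ℝ) i j * p.2 j := by
    ext p i
    rw [rotSpace_apply]
  rw [h]
  exact (PiLp.continuous_toLp 2 _).comp (continuous_pi fun i ↦ continuous_finsetSum _ fun j _ ↦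
    ((continuous_SO3_entry i j).comp continuous_fst).mul (by fun_prop))

theorem continuous_rotValue : Continuous fun p : SO3 × C3 ↦ rotValue p.1 p.2 := by
  have h : (fun p : SO3 × C3 ↦ rotValue p.1 p.2) = fun p ↦ WithLp.toLp 2 fun i ↦
      ∑ j, ((p.1 : Matrix (Fin 3) (Fin 3) ℝ) i j : ℂ) * p.2 j := by
    ext p i
    rw [rotValue_apply]
  rw [h]
  exact (PiLp.continuous_toLp 2 _).comp (continuous_pi fun i ↦ continuous_finsetSum _ fun j _ ↦
    (Complex.continuous_ofReal.comp ((continuous_SO3_entry i j).comp continuous_fst)).mul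
      (by fun_prop))

/-! ### Explicit rotations and their action on cross and dot products -/

theorem R3_ext {x y : R3} (h0 : x 0 = y 0) (h1 : x 1 = y 1) (h2 : x 2 = y 2) : x = y := by
  ext i; fin_cases i <;> assumption

theorem norm_sq_R3 (x : R3) : ‖x‖ ^ 2 = x 0 ^ 2 + x 1 ^ 2 + x 2 ^ 2 := by
  rw [EuclideanSpace.norm_sq_eq, Fin.sum_univ_three]
  simp

/-- With determinant one the adjugate is the inverse, which is the transpose. These nine identities
express that rotations preserve the cross product. -/
theorem SO3_cofactor (R : SO3) (i j : Fin 3) : (R : Matrix (Fin 3) (Fin 3) ℝ).adjugate i j =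
    (R : Matrix (Fin 3) (Fin 3) ℝ) j i := by
  have h := Matrix.mem_specialOrthogonalGroup_iff.1 R.2
  have h1 : (R : Matrix (Fin 3) (Fin 3) ℝ) * (R : Matrix (Fin 3) (Fin 3) ℝ).adjugate = 1 := by
    rw [Matrix.mul_adjugate, h.2, one_smul]
  have h2 : star (R : Matrix (Fin 3) (Fin 3) ℝ) * R = 1 :=
    (Matrix.mem_orthogonalGroup_iff' _ _).1 h.1
  have h3 : (R : Matrix (Fin 3) (Fin 3) ℝ).adjugate = star (R : Matrix (Fin 3) (Fin 3) ℝ) := by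
    rw [← one_mul (Matrix.adjugate _), ← h2, mul_assoc, h1, mul_one]
  rw [h3]; rfl

theorem rotValue_crossC (R : SO3) (ξ : R3) (X : C3) :
    rotValue R (crossC ξ X) = crossC (rotSpace R ξ) (rotValue R X) := by
  have h : ∀ i j, (((R : Matrix (Fin 3) (Fin 3) ℝ).adjugate i j : ℝ) : ℂ) =
    (((R : Matrix (Fin 3) (Fin 3) ℝ) j i : ℝ) : ℂ) := fun i j ↦ by rw [SO3_cofactor]
  simp only [Matrix.adjugate_fin_three] at h
  have h00 := h 0 0
  have h01 := h 0 1
  have h02 := h 0 2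
  have h10 := h 1 0
  have h11 := h 1 1
  have h12 := h 1 2
  have h20 := h 2 0
  have h21 := h 2 1
  have h22 := h 2 2
  clear h
  simp at h00 h01 h02 h10 h11 h12 h20 h21 h22
  apply C3_ext
  · simp only [rotValue_apply, rotSpace_apply, crossC_zero', crossC_one', crossC_two',
      Fin.sum_univ_three, Complex.ofReal_add, Complex.ofReal_mul]
    rw [← h00, ← h10, ← h20]
    ring
  · simp only [rotValue_apply, rotSpace_apply, crossC_zero', crossC_one', crossC_two',
      Fin.sum_univ_three, Complex.ofReal_add, Complex.ofReal_mul]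
    rw [← h01, ← h11, ← h21]
    ring
  · simp only [rotValue_apply, rotSpace_apply, crossC_zero', crossC_one', crossC_two',
      Fin.sum_univ_three, Complex.ofReal_add, Complex.ofReal_mul]
    rw [← h02, ← h12, ← h22]
    ring

theorem rotValue_dotC (R : SO3) (X Y : C3) : dotC (rotValue R X) (rotValue R Y) = dotC X Y := by
  have h := congrFun₂ ((Matrix.mem_orthogonalGroup_iff' _ _).1
    (Matrix.mem_specialOrthogonalGroup_iff.1 R.2).1)
  have h' : ∀ i j, ((∑ k, (R : Matrix (Fin 3) (Fin 3) ℝ) k i *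
      (R : Matrix (Fin 3) (Fin 3) ℝ) k j : ℝ) : ℂ) =
      if i = j then 1 else 0 := by
    intro i j
    have := h i j
    rw [Matrix.mul_apply] at this
    rw [show (∑ k, (R : Matrix (Fin 3) (Fin 3) ℝ) k i * (R : Matrix (Fin 3) (Fin 3) ℝ) k j)
      = _ from this, Matrix.one_apply]
    split_ifs <;> simp
  have h00 := h' 0 0
  have h01 := h' 0 1
  have h02 := h' 0 2
  have h11 := h' 1 1
  have h12 := h' 1 2
  have h22 := h' 2 2
  simp only [Fin.sum_univ_three, Complex.ofReal_add, Complex.ofReal_mul] at h00 h01 h02 h11 h12 h22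
  simp at h00 h01 h02 h11 h12 h22
  simp only [dotC_apply, rotValue_apply, Fin.sum_univ_three]
  linear_combination X 0 * Y 0 * h00 + (X 0 * Y 1 + X 1 * Y 0) * h01 +
    (X 0 * Y 2 + X 2 * Y 0) * h02 + X 1 * Y 1 * h11 + (X 1 * Y 2 + X 2 * Y 1) * h12 +
    X 2 * Y 2 * h22

/-- The rotation by the matrix `M`. -/
def mkSO3 (M : Matrix (Fin 3) (Fin 3) ℝ) (h : M * M.transpose = 1) (hd : M.det = 1) : SO3 :=
  ⟨M, Matrix.mem_specialOrthogonalGroup_iff.2 ⟨(Matrix.mem_orthogonalGroup_iff _ _).2 h, hd⟩⟩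

theorem mkSO3_apply (M : Matrix (Fin 3) (Fin 3) ℝ) (h : M * M.transpose = 1) (hd : M.det = 1)
    (i j : Fin 3) : (mkSO3 M h hd : Matrix (Fin 3) (Fin 3) ℝ) i j = M i j := rfl

/-- The matrix is `2 n nᵀ - 1`, whose determinant is one in dimension three. -/
theorem exists_halfTurn {n : R3} (hn : ‖n‖ = 1) :
    ∃ S : SO3, ∀ x, rotSpace S x = (2 * inner ℝ n x) • n - x := by
  have h := norm_sq_R3 n
  rw [hn] at h
  refine ⟨mkSO3 !![2 * n 0 * n 0 - 1, 2 * n 0 * n 1, 2 * n 0 * n 2;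
    2 * n 1 * n 0, 2 * n 1 * n 1 - 1, 2 * n 1 * n 2;
    2 * n 2 * n 0, 2 * n 2 * n 1, 2 * n 2 * n 2 - 1] ?_ ?_, fun x ↦ ?_⟩
  · ext i j
    rw [Matrix.mul_apply, Fin.sum_univ_three]
    fin_cases i <;> fin_cases j <;> simp
    · linear_combination -4 * n 0 ^ 2 * h
    · linear_combination -4 * n 0 * n 1 * h
    · linear_combination -4 * n 0 * n 2 * h
    · linear_combination -4 * n 0 * n 1 * h
    · linear_combination -4 * n 1 ^ 2 * h
    · linear_combination -4 * n 1 * n 2 * h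
    · linear_combination -4 * n 0 * n 2 * h
    · linear_combination -4 * n 2 * n 1 * h
    · linear_combination -4 * n 2 ^ 2 * h
  · rw [Matrix.det_fin_three]
    simp
    linear_combination -2 * h
  · have hi : inner ℝ n x = n 0 * x 0 + n 1 * x 1 + n 2 * x 2 := by
      rw [PiLp.inner_apply, Fin.sum_univ_three]; simp; ring
    rw [hi]
    apply R3_ext <;> rw [rotSpace_apply, Fin.sum_univ_three] <;>
      simp only [mkSO3_apply] <;> simp <;> ring

/-- The half turn about the bisector `x + y` exchanges two vectors of equal length. If `y = -x`, a
half turn about any axis orthogonal to `x` does. -/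
theorem exists_rotSpace_eq {x y : R3} (h : ‖x‖ = ‖y‖) : ∃ S : SO3, rotSpace S x = y := by
  by_cases hxy : x + y = 0
  · by_cases hx : x = 0
    · subst hx
      rw [zero_add] at hxy
      exact ⟨1, by rw [hxy, map_zero]⟩
    obtain ⟨v, hv, hv0⟩ : ∃ v : R3, inner ℝ v x = 0 ∧ v ≠ 0 := by
      by_cases h0 : x 0 = 0 ∧ x 1 = 0
      · refine ⟨stdVec 0, ?_, ?_⟩
        · rw [real_inner_comm, inner_stdVec, h0.1]
        · intro h'
          have := congrArg (fun z : R3 ↦ z 0) h'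
          simp [stdVec] at this
      · refine ⟨x 1 • stdVec 0 - x 0 • stdVec 1, ?_, ?_⟩
        · rw [real_inner_comm, inner_sub_right, inner_smul_right, inner_smul_right,
            inner_stdVec, inner_stdVec]
          ring
        · intro h'
          have h1 := congrArg (fun z : R3 ↦ z 0) h'
          have h2 := congrArg (fun z : R3 ↦ z 1) h'
          simp [stdVec] at h1 h2
          exact h0 ⟨h2, h1⟩
    obtain ⟨S, hS⟩ := exists_halfTurn (n := ‖v‖⁻¹ • v)
      (by rw [norm_smul, norm_inv, norm_norm, inv_mul_cancel₀ (norm_ne_zero_iff.2 hv0)])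
    refine ⟨S, ?_⟩
    rw [hS, real_inner_smul_left, hv]
    simp [eq_neg_of_add_eq_zero_right hxy]
  · obtain ⟨S, hS⟩ := exists_halfTurn (n := ‖x + y‖⁻¹ • (x + y))
      (by rw [norm_smul, norm_inv, norm_norm, inv_mul_cancel₀ (norm_ne_zero_iff.2 hxy)])
    refine ⟨S, ?_⟩
    have hne := norm_ne_zero_iff.2 hxy
    have h1 : 2 * inner ℝ (x + y) x = ‖x + y‖ ^ 2 := by
      rw [inner_add_left, norm_add_sq_real, real_inner_self_eq_norm_sq, h, real_inner_comm x y]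
      ring
    rw [hS, real_inner_smul_left, smul_smul, show 2 * (‖x + y‖⁻¹ * inner ℝ (x + y) x) * ‖x + y‖⁻¹
      = 1 by rw [show 2 * (‖x + y‖⁻¹ * inner ℝ (x + y) x) * ‖x + y‖⁻¹ =
        (2 * inner ℝ (x + y) x) * (‖x + y‖⁻¹) ^ 2 by ring, h1, ← mul_pow, mul_inv_cancel₀ hne,
          one_pow]]
    simp

/-- The quarter turn about a unit vector `n`. -/
theorem exists_quarterTurn {n : R3} (hn : ‖n‖ = 1) :
    ∃ S : SO3, rotSpace S n = n ∧ ∀ X : C3, ∑ i, (n i : ℂ) * X i = 0 →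
      rotValue S X = crossC n X ∧ rotValue S⁻¹ X = -crossC n X := by
  have h := norm_sq_R3 n
  rw [hn] at h
  -- Rodrigues' formula at angle π/2: the matrix `n nᵀ` plus the matrix of the cross product with
  -- `n`.
  refine ⟨mkSO3 !![n 0 * n 0, n 0 * n 1 - n 2, n 0 * n 2 + n 1;
    n 1 * n 0 + n 2, n 1 * n 1, n 1 * n 2 - n 0;
    n 2 * n 0 - n 1, n 2 * n 1 + n 0, n 2 * n 2] ?_ ?_, ?_, fun X hX ↦ ⟨?_, ?_⟩⟩
  · ext i j
    rw [Matrix.mul_apply, Fin.sum_univ_three]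
    fin_cases i <;> fin_cases j <;> simp
    · linear_combination -(n 0 ^ 2 + 1) * h
    · linear_combination -(n 0 * n 1) * h
    · linear_combination -(n 0 * n 2) * h
    · linear_combination -(n 0 * n 1) * h
    · linear_combination -(n 1 ^ 2 + 1) * h
    · linear_combination -(n 1 * n 2) * h
    · linear_combination -(n 0 * n 2) * h
    · linear_combination -(n 2 * n 1) * h
    · linear_combination -(n 2 ^ 2 + 1) * h
  · rw [Matrix.det_fin_three]
    simp
    linear_combination -(n 0 ^ 2 + n 1 ^ 2 + n 2 ^ 2 + 1) * h
  · apply R3_ext <;> rw [rotSpace_apply, Fin.sum_univ_three] <;> simp only [mkSO3_apply] <;> simp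
    · linear_combination -n 0 * h
    · linear_combination -n 1 * h
    · linear_combination -n 2 * h
  · rw [Fin.sum_univ_three] at hX
    apply C3_ext <;> rw [rotValue_apply, Fin.sum_univ_three] <;> simp only [mkSO3_apply] <;>
      simp [crossC_zero', crossC_one', crossC_two']
    · linear_combination (n 0 : ℂ) * hX
    · linear_combination (n 1 : ℂ) * hX
    · linear_combination (n 2 : ℂ) * hX
  · rw [Fin.sum_univ_three] at hX
    apply C3_ext <;> rw [rotValue_apply, Fin.sum_univ_three] <;>
      simp only [SO3_inv_apply, mkSO3_apply] <;>
      simp [crossC_zero', crossC_one', crossC_two']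
    · linear_combination (n 0 : ℂ) * hX
    · linear_combination (n 1 : ℂ) * hX
    · linear_combination (n 2 : ℂ) * hX

/-! ### Averaging over rotations and dilations -/

/-- The point `|ζ| R⁻¹ η`. -/
def orbit (η : R3) (p : SO3 × R3) : R3 := ‖p.2‖ • rotSpace p.1⁻¹ η

theorem continuous_rotSpace_inv {T : Type*} [TopologicalSpace T] {f : T → SO3} {g : T → R3}
    (hf : Continuous f) (hg : Continuous g) : Continuous fun t ↦ rotSpace (f t)⁻¹ (g t) := by
  have h := continuous_rotSpace.comp (hf.inv.prodMk hg)
  exact h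

theorem continuous_orbit (η : R3) : Continuous (orbit η) := by
  have h : Continuous fun p : SO3 × R3 ↦ rotSpace p.1⁻¹ η :=
    continuous_rotSpace_inv continuous_fst continuous_const
  exact continuous_snd.norm.smul h

theorem norm_orbit (η : R3) (p : SO3 × R3) : ‖orbit η p‖ = ‖p.2‖ * ‖η‖ := by
  rw [orbit, norm_smul, norm_norm, norm_rotSpace]

/-- For fixed `ζ`, transitivity on spheres and invariance of Haar measure show that `|ζ| R⁻¹ η` and
`|η| R⁻¹ ζ` have the same law in `R`. For fixed `R` the latter is a rotation followed by a dilation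
in `ζ`, with Jacobian factor `|η|⁻³`. -/
theorem map_orbit {η : R3} (hη : η ≠ 0) : (haarSO3.prod volume).map (orbit η) =
    ENNReal.ofReal (‖η‖ ^ 3)⁻¹ • (volume : Measure R3) := by
  have hη' := norm_ne_zero_iff.2 hη
  have hc : Continuous fun p : SO3 × R3 ↦ ‖η‖ • rotSpace p.1⁻¹ p.2 := by
    have h := continuous_rotSpace_inv (continuous_fst (X := SO3) (Y := R3)) continuous_snd
    exact h.const_smul ‖η‖
  refine Measure.ext fun A hA ↦ ?_
  rw [Measure.map_apply (continuous_orbit η).measurable hA,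
    Measure.prod_apply_symm ((continuous_orbit η).measurable hA)]
  have h1 : ∀ ζ : R3, haarSO3 ((fun R ↦ (R, ζ)) ⁻¹' (orbit η ⁻¹' A)) =
      haarSO3 ((fun R ↦ (R, ζ)) ⁻¹' ((fun p : SO3 × R3 ↦ ‖η‖ • rotSpace p.1⁻¹ p.2) ⁻¹' A)) := by
    intro ζ
    obtain ⟨S, hS⟩ := exists_rotSpace_eq (x := ‖η‖ • ζ) (y := ‖ζ‖ • η)
      (by rw [norm_smul, norm_smul, norm_norm, norm_norm, mul_comm])
    -- Replacing `R` by `S R` turns `R⁻¹(|ζ| η)` into `R⁻¹(|η| ζ)`.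
    rw [← measure_preimage_mul haarSO3 S]
    congr 1
    ext R
    simp only [Set.mem_preimage, orbit]
    rw [mul_inv_rev, rotSpace_mul, ← map_smul, ← map_smul, ← hS, ← rotSpace_mul S⁻¹,
      inv_mul_cancel, rotSpace_one, map_smul]
  simp_rw [h1]
  rw [← Measure.prod_apply_symm (hc.measurable hA), Measure.prod_apply (hc.measurable hA)]
  have h2 : ∀ R : SO3, volume (Prod.mk R ⁻¹' ((fun p : SO3 × R3 ↦ ‖η‖ • rotSpace p.1⁻¹ p.2) ⁻¹' A))
      = ENNReal.ofReal (‖η‖ ^ 3)⁻¹ * volume A := by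
    intro R
    have h3 : Prod.mk R ⁻¹' ((fun p : SO3 × R3 ↦ ‖η‖ • rotSpace p.1⁻¹ p.2) ⁻¹' A) =
      rotSpace R⁻¹ ⁻¹' ((fun x ↦ ‖η‖ • x) ⁻¹' A) := rfl
    rw [h3, (rotSpace_measurePreserving R⁻¹).measure_preimage
      ((measurable_const_smul ‖η‖) hA).nullMeasurableSet, Measure.addHaar_preimage_smul _ hη',
      finrank_R3, abs_of_nonneg (by positivity)]
  simp_rw [h2]
  rw [lintegral_const, measure_univ, mul_one]
  rfl

theorem quasi_orbit {η : R3} (hη : η ≠ 0) :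
    Measure.QuasiMeasurePreserving (orbit η) (haarSO3.prod volume) volume :=
  ⟨(continuous_orbit η).measurable, by
    rw [map_orbit hη]; exact Measure.smul_absolutelyContinuous⟩

theorem integrable_comp_orbit {E : Type*} [NormedAddCommGroup E] {η : R3} (hη : η ≠ 0) {f : R3 → E}
    (hf : Integrable f) : Integrable (fun p ↦ f (orbit η p)) (haarSO3.prod volume) := by
  have h : Integrable f ((haarSO3.prod volume).map (orbit η)) := by
    rw [map_orbit hη]; exact hf.smul_measure ENNReal.ofReal_ne_top
  exact h.comp_measurable (continuous_orbit η).measurable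

theorem integral_comp_orbit {E : Type*} [NormedAddCommGroup E] [NormedSpace ℝ E] {η : R3}
    (hη : η ≠ 0) {f : R3 → E} (hf : AEStronglyMeasurable f volume) :
    ∫ p, f (orbit η p) ∂(haarSO3.prod volume) = (‖η‖ ^ 3)⁻¹ • ∫ ξ, f ξ := by
  have h : AEStronglyMeasurable f ((haarSO3.prod volume).map (orbit η)) := by
    rw [map_orbit hη]; exact hf.smul_measure _
  rw [← integral_map (continuous_orbit η).measurable.aemeasurable h, map_orbit hη,
    integral_smul_measure, ENNReal.toReal_ofReal (by positivity)]

/-- `y` is a vector of helicity `σ` at the frequency `η`. -/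
def IsHel (σ : ℝ) (η : R3) (y : C3) : Prop :=
  Complex.I • crossC η y = ((σ * ‖η‖ : ℝ) : ℂ) • y

theorem crossC_smul_left (t : ℝ) (η : R3) (X : C3) : crossC (t • η) X = (t : ℂ) • crossC η X := by
  apply C3_ext <;> simp [crossC_zero', crossC_one', crossC_two'] <;> ring

theorem hel_smul (σ : ℝ) {t : ℝ} (ht : 0 < t) (ξ : R3) (X : C3) :
    hel σ (t • ξ) X = hel σ ξ X := by
  have h : (t : ℂ) ≠ 0 := by exact_mod_cast ht.ne'
  rw [hel, hel, crossC_smul_left, smul_smul, norm_smul, Real.norm_of_nonneg ht.le]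
  congr 3
  push_cast
  field_simp

theorem hel_rotValue (σ : ℝ) (R : SO3) (ξ : R3) (X : C3) :
    hel σ (rotSpace R ξ) (rotValue R X) = rotValue R (hel σ ξ X) := by
  rw [hel, hel, ← rotValue_crossC, norm_rotSpace, map_smul, map_add, map_smul]

theorem crossC_add_right (η : R3) (X Y : C3) : crossC η (X + Y) = crossC η X + crossC η Y := by
  apply C3_ext <;> simp [crossC_zero', crossC_one', crossC_two'] <;> ring

theorem crossC_smul_right (η : R3) (c : ℂ) (X : C3) : crossC η (c • X) = c • crossC η X := by
  apply C3_ext <;> simp [crossC_zero', crossC_one', crossC_two'] <;> ring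

theorem crossC_crossC {η : R3} {X : C3} (hX : ∑ i, (η i : ℂ) * X i = 0) :
    crossC η (crossC η X) = (-(‖η‖ : ℂ) ^ 2) • X := by
  have hrn : (‖η‖ : ℂ) ^ 2 = (η 0 : ℂ) ^ 2 + (η 1 : ℂ) ^ 2 + (η 2 : ℂ) ^ 2 := by
    exact_mod_cast norm_sq_R3 η
  rw [Fin.sum_univ_three] at hX
  rw [hrn]
  apply C3_ext <;> simp [crossC_zero', crossC_one', crossC_two']
  · linear_combination (η 0 : ℂ) * hX
  · linear_combination (η 1 : ℂ) * hX
  · linear_combination (η 2 : ℂ) * hX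

/-- On the orthogonal complement of `η` the operator `X ↦ i η × X / |η|` is an involution by
`crossC_crossC`, and `hel σ` is its spectral projection. -/
theorem isHel_hel {σ : ℝ} (hσ : σ ^ 2 = 1) {η : R3} (hη : η ≠ 0) {X : C3}
    (hX : ∑ i, (η i : ℂ) * X i = 0) : IsHel σ η (hel σ η X) := by
  have hr : (‖η‖ : ℂ) ≠ 0 := by exact_mod_cast norm_ne_zero_iff.2 hη
  have hσC : (σ : ℂ) ^ 2 = 1 := by exact_mod_cast hσ
  rw [IsHel, hel, crossC_smul_right, crossC_add_right, crossC_smul_right, crossC_crossC hX]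
  ext i
  simp
  field_simp
  linear_combination (-(σ : ℂ) * ‖η‖ * X i) * Complex.I_sq - (Complex.I * crossC η X i) * hσC

theorem IsHel.orthogonal {σ : ℝ} (hσ : σ ^ 2 = 1) {η : R3} (hη : η ≠ 0) {y : C3}
    (hy : IsHel σ η y) : ∑ i, (η i : ℂ) * y i = 0 := by
  have hσ0 : σ ≠ 0 := by rintro rfl; norm_num at hσ
  have hr : ((σ * ‖η‖ : ℝ) : ℂ) ≠ 0 := by
    exact_mod_cast mul_ne_zero hσ0 (norm_ne_zero_iff.2 hη)
  have h0 := congrArg (fun z : C3 ↦ z 0) hy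
  have h1 := congrArg (fun z : C3 ↦ z 1) hy
  have h2 := congrArg (fun z : C3 ↦ z 2) hy
  simp only [PiLp.smul_apply, crossC_zero', crossC_one', crossC_two', smul_eq_mul] at h0 h1 h2
  refine (mul_eq_zero.1 ?_).resolve_left hr
  rw [Fin.sum_univ_three]
  linear_combination -(η 0 : ℂ) * h0 - (η 1 : ℂ) * h1 - (η 2 : ℂ) * h2

/-- The vectors of helicity `σ` at `η` form a complex line, so `y` and `W` are proportional. This is
what collapses the vector-valued average to a multiple of the prescribed `y`. -/
theorem smul_dotC_swap {σ : ℝ} (hσ : σ ^ 2 = 1) {η : R3} (hη : η ≠ 0) {y W : C3}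
    (hy : IsHel σ η y) (hW : IsHel σ η W) (a : C3) :
    dotC a y • W = dotC a W • y := by
  have hσ0 : σ ≠ 0 := by rintro rfl; norm_num at hσ
  have hr : ((σ * ‖η‖ : ℝ) : ℂ) ≠ 0 := by
    exact_mod_cast mul_ne_zero hσ0 (norm_ne_zero_iff.2 hη)
  have hyo := hy.orthogonal hσ hη
  have hWo := hW.orthogonal hσ hη
  rw [Fin.sum_univ_three] at hyo hWo
  have h0 := congrArg (fun z : C3 ↦ z 0) hy
  have h1 := congrArg (fun z : C3 ↦ z 1) hy
  have h2 := congrArg (fun z : C3 ↦ z 2) hy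
  have k0 := congrArg (fun z : C3 ↦ z 0) hW
  have k1 := congrArg (fun z : C3 ↦ z 1) hW
  have k2 := congrArg (fun z : C3 ↦ z 2) hW
  simp only [PiLp.smul_apply, crossC_zero', crossC_one', crossC_two', smul_eq_mul]
    at h0 h1 h2 k0 k1 k2
  -- The three coordinates of `y × W = 0`, from the eigenvector equations and orthogonality to `η`.
  have e0 : y 1 * W 2 - y 2 * W 1 = 0 := by
    refine (mul_eq_zero.1 ?_).resolve_left hr
    linear_combination (1 / 2 : ℂ) * (-W 2 * h1 + W 1 * h2 - y 1 * k2 + y 2 * k1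
      + Complex.I * y 0 * hWo - Complex.I * W 0 * hyo)
  have e1 : y 2 * W 0 - y 0 * W 2 = 0 := by
    refine (mul_eq_zero.1 ?_).resolve_left hr
    linear_combination (1 / 2 : ℂ) * (-W 0 * h2 + W 2 * h0 - y 2 * k0 + y 0 * k2
      + Complex.I * y 1 * hWo - Complex.I * W 1 * hyo)
  have e2 : y 0 * W 1 - y 1 * W 0 = 0 := by
    refine (mul_eq_zero.1 ?_).resolve_left hr
    linear_combination (1 / 2 : ℂ) * (-W 1 * h0 + W 0 * h1 - y 0 * k1 + y 1 * k0
      + Complex.I * y 2 * hWo - Complex.I * W 2 * hyo)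
  rw [dotC_apply, dotC_apply, Fin.sum_univ_three, Fin.sum_univ_three]
  apply C3_ext <;> simp only [PiLp.smul_apply, smul_eq_mul]
  · linear_combination a 2 * e1 - a 1 * e2
  · linear_combination a 0 * e2 - a 2 * e0
  · linear_combination a 1 * e0 - a 0 * e1

/-- The average over all rotations and dilations of a rank one operator projects onto a fixed
vector of given helicity. -/
theorem integral_orbit {σ : ℝ} (hσ : σ ^ 2 = 1) {g U : R3 → C3} (hg : Continuous g)
    (hU : StronglyMeasurable U) (hgU : Integrable fun ξ ↦ ‖g ξ‖ * ‖U ξ‖)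
    (hdiv : ∀ᵐ ξ, ∑ i, (ξ i : ℂ) * U ξ i = 0) {η : R3} (hη : η ≠ 0) {y : C3} (hy : IsHel σ η y) :
    Integrable (fun p : SO3 × R3 ↦
      dotC (rotValue p.1 (g (orbit η p))) y • rotValue p.1 (U (orbit η p)))
      (haarSO3.prod volume) ∧
    ∫ p : SO3 × R3, dotC (rotValue p.1 (g (orbit η p))) y • rotValue p.1 (U (orbit η p))
      ∂(haarSO3.prod volume) =
      ((‖η‖ ^ 3)⁻¹ • ∫ ξ, dotC (g ξ) (hel σ ξ (U ξ))) • y := by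
  set ν := haarSO3.prod (volume : Measure R3)
  set H : SO3 × R3 → C3 := fun p ↦
    dotC (rotValue p.1 (g (orbit η p))) y • rotValue p.1 (U (orbit η p)) with hH
  have hUo : StronglyMeasurable fun p ↦ U (orbit η p) :=
    hU.comp_measurable (continuous_orbit η).measurable
  have hRU : StronglyMeasurable fun p : SO3 × R3 ↦ rotValue p.1 (U (orbit η p)) := by
    have h := continuous_rotValue.comp_stronglyMeasurable
      ((measurable_fst (α := SO3) (β := R3)).stronglyMeasurable.prodMk hUo)
    exact h
  have hRg : StronglyMeasurable fun p : SO3 × R3 ↦ rotValue p.1 (g (orbit η p)) := by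
    have h := continuous_rotValue.comp_stronglyMeasurable
      ((measurable_fst (α := SO3) (β := R3)).stronglyMeasurable.prodMk
        (hg.comp (continuous_orbit η)).stronglyMeasurable)
    exact h
  have hHm : StronglyMeasurable H :=
    ((dotC.flip y).continuous.comp_stronglyMeasurable hRg).smul hRU
  have hHi : Integrable H ν := by
    refine Integrable.mono' ((integrable_comp_orbit hη hgU).const_mul ‖y‖)
      hHm.aestronglyMeasurable (.of_forall fun p ↦ ?_)
    rw [hH, norm_smul, norm_rotValue]
    calc _ ≤ (‖rotValue p.1 (g (orbit η p))‖ * ‖y‖) * ‖U (orbit η p)‖ := by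
          gcongr; exact norm_dotC_le _ _
      _ = _ := by rw [norm_rotValue]; ring
  refine ⟨hHi, ?_⟩
  have hr : 0 < ‖η‖ := norm_pos_iff.2 hη
  set n : R3 := ‖η‖⁻¹ • η
  -- Averaging over `R` and `S R`, with `S` a quarter turn fixing `η`, is enough to produce the
  -- helicity projection.
  obtain ⟨S, hSn, hS⟩ := exists_quarterTurn (n := n)
    (by rw [norm_smul, norm_inv, norm_norm, inv_mul_cancel₀ hr.ne'])
  have hηn : η = ‖η‖ • n := by rw [smul_smul, mul_inv_cancel₀ hr.ne', one_smul]
  have hSη : rotSpace S⁻¹ η = η := by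
    rw [hηn, map_smul]
    congr 1
    nth_rw 1 [← hSn]
    rw [← rotSpace_mul, inv_mul_cancel, rotSpace_one]
  have hn_orth : ∀ X : C3, ∑ i, (η i : ℂ) * X i = 0 → ∑ i, (n i : ℂ) * X i = 0 := by
    intro X hX
    have : ∀ i, (n i : ℂ) * X i = (‖η‖⁻¹ : ℝ) * ((η i : ℂ) * X i) := by
      intro i; simp [n]; ring
    simp_rw [this, ← Finset.mul_sum, hX, mul_zero]
  have hyo := hy.orthogonal hσ hη
  have hcn : ∀ X, crossC n X = ((‖η‖⁻¹ : ℝ) : ℂ) • crossC η X := fun X ↦ crossC_smul_left _ _ _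
  have hrC : (‖η‖ : ℂ) ≠ 0 := by exact_mod_cast hr.ne'
  -- On vectors orthogonal to `η` the inverse turn is minus the cross product with `n`, so helicity
  -- vectors are its eigenvectors.
  have hSy : rotValue S⁻¹ y = (Complex.I * σ) • y := by
    rw [(hS y (hn_orth y hyo)).2, hcn]
    have h1 : crossC η y = -(Complex.I * (σ * ‖η‖ : ℝ)) • y := by
      have h2 := congrArg (fun z ↦ -Complex.I • z) hy
      simp only [smul_smul] at h2
      rw [neg_mul, Complex.I_mul_I, neg_neg, one_smul] at h2
      rw [h2, neg_mul]
    rw [h1, smul_smul, ← neg_smul]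
    congr 1
    push_cast
    field_simp
  have hmp : MeasurePreserving (fun p : SO3 × R3 ↦ (S * p.1, p.2)) ν ν :=
    (measurePreserving_mul_left haarSO3 S).prod (MeasurePreserving.id _)
  have hshift : ∫ p, H (S * p.1, p.2) ∂ν = ∫ p, H p ∂ν := by
    conv_rhs => rw [← hmp.map_eq]
    rw [integral_map hmp.measurable.aemeasurable]
    rw [hmp.map_eq]
    exact hHi.1
  have horb : ∀ p : SO3 × R3, orbit η (S * p.1, p.2) = orbit η p := by
    intro p
    simp only [orbit]
    rw [mul_inv_rev, rotSpace_mul, hSη]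
  have hne : ∀ᵐ p ∂ν, orbit η p ≠ 0 := by
    refine (quasi_orbit hη).ae (p := fun ξ : R3 ↦ ξ ≠ 0) ?_
    rw [ae_iff]; simp
  -- The turned term contributes `iσ n × RU`, so the sum contains `RU + iσ n × RU`, twice the
  -- helicity projection of `RU`.
  have hsum : ∀ᵐ p ∂ν, H p + H (S * p.1, p.2) =
      ((2 : ℂ) * dotC (g (orbit η p)) (hel σ (orbit η p) (U (orbit η p)))) • y := by
    filter_upwards [hne, (quasi_orbit hη).ae hdiv] with p h0 hp
    set x := orbit η p with hx
    set R := p.1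
    have hζ : 0 < ‖p.2‖ := by
      refine (norm_nonneg _).lt_of_ne' fun h ↦ h0 ?_
      rw [hx, orbit, h, zero_smul]
    have hRx : rotSpace R x = ‖p.2‖ • η := by
      rw [hx, orbit, map_smul, ← rotSpace_mul, mul_inv_cancel, rotSpace_one]
    have hRU0 : ∑ i, (η i : ℂ) * rotValue R (U x) i = 0 := by
      have h1 : dotC (WithLp.toLp 2 fun i ↦ (rotSpace R x i : ℂ)) (rotValue R (U x)) = 0 := by
        have h2 : (WithLp.toLp 2 fun i ↦ (rotSpace R x i : ℂ) : C3) =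
            rotValue R (WithLp.toLp 2 fun i ↦ (x i : ℂ)) := by
          ext i
          rw [rotValue_apply]
          simp [rotSpace_apply]
        rw [h2, rotValue_dotC, dotC_apply]
        exact hp
      rw [dotC_apply, hRx] at h1
      have h3 : (‖p.2‖ : ℂ) ≠ 0 := by exact_mod_cast hζ.ne'
      refine (mul_eq_zero.1 ?_).resolve_left h3
      rw [← h1, Finset.mul_sum]
      refine Finset.sum_congr rfl fun i _ ↦ ?_
      simp; ring
    have hdot : dotC (rotValue (S * R) (g x)) y = (Complex.I * σ) * dotC (rotValue R (g x)) y := by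
      rw [← rotValue_dotC S⁻¹, ← rotValue_mul, inv_mul_cancel_left, hSy, map_smul, smul_eq_mul]
    have hHS : H (S * p.1, p.2) = ((Complex.I * σ) * dotC (rotValue R (g x)) y) •
        crossC n (rotValue R (U x)) := by
      simp only [hH]
      rw [horb, hdot, rotValue_mul, (hS _ (hn_orth _ hRU0)).1]
    have hHp : H p = dotC (rotValue R (g x)) y • rotValue R (U x) := rfl
    have hadd : H p + H (S * p.1, p.2) =
        (2 : ℂ) • dotC (rotValue R (g x)) y • hel σ η (rotValue R (U x)) := by
      rw [hHp, hHS, hel, hcn]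
      ext i
      simp
      ring
    -- Both `y` and the projected vector lie on the same line, so they can trade places; then
    -- rotation invariance removes `R`.
    rw [hadd, smul_dotC_swap hσ hη hy (isHel_hel hσ hη hRU0), smul_smul]
    congr 2
    rw [show hel σ η (rotValue R (U x)) = hel σ (rotSpace R x) (rotValue R (U x)) by
      rw [hRx, hel_smul σ hζ], hel_rotValue, rotValue_dotC]
  have hfm : AEStronglyMeasurable (fun ξ ↦ dotC (g ξ) (hel σ ξ (U ξ))) volume := by
    have h1 := stronglyMeasurable_hel σ hU
    exact (isBoundedBilinearMap_apply.continuous.comp_stronglyMeasurable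
      ((dotC.continuous.comp hg).stronglyMeasurable.prodMk h1)).aestronglyMeasurable
  have h2 : (2 : ℂ) • ∫ p, H p ∂ν =
      (2 : ℂ) • ((‖η‖ ^ 3)⁻¹ • ∫ ξ, dotC (g ξ) (hel σ ξ (U ξ))) • y := by
    rw [two_smul]
    nth_rw 2 [← hshift]
    have hHi' : Integrable (fun p ↦ H (S * p.1, p.2)) ν := hmp.integrable_comp_of_integrable hHi
    rw [← integral_add hHi hHi', integral_congr_ae hsum,
      integral_smul_const, integral_const_mul, integral_comp_orbit hη hfm, smul_smul]
  exact smul_right_injective _ (two_ne_zero (α := ℂ)) h2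

/-! ### Families of multipliers, rotations and dilations -/

theorem rotValue_cj (R : SO3) (X : C3) : rotValue R (cj X) = cj (rotValue R X) := by
  ext i
  simp only [rotValue_apply, cj_apply, map_sum, map_mul, Complex.conj_ofReal]

theorem continuous_rotSpaceCLM : Continuous rotSpace := by
  have h : Continuous fun M : Matrix (Fin 3) (Fin 3) ℝ ↦
      (Matrix.toEuclideanCLM (𝕜 := ℝ) M : R3 →L[ℝ] R3) :=
    LinearMap.continuous_of_finiteDimensional
      (IsLinearMap.mk' (fun M ↦ Matrix.toEuclideanCLM (𝕜 := ℝ) (n := Fin 3) M)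
        ⟨map_add _, map_smul _⟩)
  exact h.comp continuous_subtype_val

theorem continuous_rotValueCLM : Continuous rotValue := by
  have h : Continuous fun M : Matrix (Fin 3) (Fin 3) ℂ ↦
      (Matrix.toEuclideanCLM (𝕜 := ℂ) M : C3 →L[ℂ] C3) :=
    LinearMap.continuous_of_finiteDimensional
      (IsLinearMap.mk' (fun M ↦ Matrix.toEuclideanCLM (𝕜 := ℂ) (n := Fin 3) M)
        ⟨map_add _, map_smul _⟩)
  exact h.comp (continuous_subtype_val.matrix_map Complex.continuous_ofReal)

/-- The norm of `ζ`, truncated to the interval `[a / 4, 2 b]`. -/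
def clampNorm (a b : ℝ) (ζ : R3) : ℝ := max (a / 4) (min ‖ζ‖ (2 * b))

theorem continuous_clampNorm (a b : ℝ) : Continuous (clampNorm a b) := by
  unfold clampNorm; fun_prop

theorem le_clampNorm (a b : ℝ) (ζ : R3) : a / 4 ≤ clampNorm a b ζ := le_max_left _ _

theorem clampNorm_le {a b : ℝ} (h : a / 4 ≤ 2 * b) (ζ : R3) : clampNorm a b ζ ≤ 2 * b :=
  max_le h (min_le_right _ _)

/-- The truncation is inactive on the shell, which carries the sampling measure. Off the shell it
keeps the dilation factors bounded for every sample point, and the parameters in a compact set. -/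
theorem clampNorm_eq {a b : ℝ} {ζ : R3} (h1 : a / 4 ≤ ‖ζ‖) (h2 : ‖ζ‖ ≤ 2 * b) :
    clampNorm a b ζ = ‖ζ‖ := by
  rw [clampNorm, min_eq_left h2, max_eq_right h1]

/-- The spherical shell of the vectors whose norm lies in `[a / 4, 2 b]`. -/
def shell (a b : ℝ) : Set R3 := {ζ | a / 4 ≤ ‖ζ‖ ∧ ‖ζ‖ ≤ 2 * b}

theorem isClosed_shell (a b : ℝ) : IsClosed (shell a b) :=
  (isClosed_le continuous_const continuous_norm).inter
    (isClosed_le continuous_norm continuous_const)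

theorem volume_shell_ne_top (a b : ℝ) : volume (shell a b) ≠ ∞ := by
  have h : shell a b ⊆ Metric.closedBall 0 (2 * b) := fun ζ hζ ↦ by
    rw [mem_closedBall_zero_iff]; exact hζ.2
  exact ((measure_mono h).trans_lt measure_closedBall_lt_top).ne

theorem volume_shell_ne_zero {a b : ℝ} (ha : 0 < a) (hab : a ≤ b) : volume (shell a b) ≠ 0 := by
  have ho : IsOpen {ζ : R3 | a / 4 < ‖ζ‖ ∧ ‖ζ‖ < 2 * b} :=
    (isOpen_lt continuous_const continuous_norm).inter (isOpen_lt continuous_norm continuous_const)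
  have hne : {ζ : R3 | a / 4 < ‖ζ‖ ∧ ‖ζ‖ < 2 * b}.Nonempty := by
    refine ⟨a • stdVec 0, ?_⟩
    have : ‖a • stdVec 0‖ = a := by
      rw [norm_smul, Real.norm_of_nonneg ha.le, stdVec, PiLp.norm_single, norm_one,
        mul_one]
    rw [Set.mem_ofPred_eq, this]
    constructor <;> linarith
  have hsub : {ζ : R3 | a / 4 < ‖ζ‖ ∧ ‖ζ‖ < 2 * b} ⊆ shell a b :=
    fun ζ hζ ↦ ⟨hζ.1.le, hζ.2.le⟩
  exact fun h ↦ (ho.measure_pos volume hne).ne' (measure_mono_null hsub h)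

/-- The product of the Haar measure of the rotation group and the uniform distribution on a
shell. -/
def legMeasure (a b : ℝ) : Measure (SO3 × R3) :=
  haarSO3.prod (ProbabilityTheory.cond volume (shell a b))

theorem isProbabilityMeasure_legMeasure {a b : ℝ} (ha : 0 < a) (hab : a ≤ b) :
    IsProbabilityMeasure (legMeasure a b) := by
  have := ProbabilityTheory.cond_isProbabilityMeasure_of_finite (volume_shell_ne_zero ha hab)
    (volume_shell_ne_top a b)
  unfold legMeasure; infer_instance

theorem legMeasure_eq (a b : ℝ) : legMeasure a b = (volume (shell a b))⁻¹ •
    (haarSO3.prod volume).restrict (Set.univ ×ˢ shell a b) := by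
  rw [legMeasure, ProbabilityTheory.cond, Measure.prod_smul_right, ← Measure.prod_restrict,
    Measure.restrict_univ]

/-- The data from which the families of multipliers are built: a profile `g` supported on an
annulus,
and a field `Y` of vectors of helicity `σ`, supported in a fixed annulus. -/
structure Leg (a b σ : ℝ) where
  g : R3 → C3
  Y : R3 → C3
  g_smooth : ContDiff ℝ (⊤ : ℕ∞) g
  g_zero : ∀ ξ, (‖ξ‖ < a ∨ b < ‖ξ‖) → g ξ = 0
  g_neg : ∀ ξ, g (-ξ) = cj (g ξ)
  Y_smooth : ContDiff ℝ (⊤ : ℕ∞) Y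
  Y_zero : ∀ ξ, (‖ξ‖ < 1 / 2 ∨ 4 < ‖ξ‖) → Y ξ = 0
  Y_neg : ∀ ξ, Y (-ξ) = cj (Y ξ)
  Y_hel : ∀ ξ, IsHel σ ξ (Y ξ)

namespace Leg

variable {a b σ : ℝ} (ℓ : Leg a b σ)

/-- The dilation and rotation that act on the profile and on the field `Y`. -/
def paramOf (p : SO3 × ℝ) : (R3 →L[ℝ] R3) × (C3 →L[ℝ] C3) :=
  (p.2 • rotSpace p.1⁻¹, (p.2 ^ (-(3 / 2) : ℝ)) • (rotValue p.1⁻¹).restrictScalars ℝ)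

/-- The parameters live in a normed space of operators, where joint smoothness of the band function
with `ξ` makes sense; the rotation group enters only through this continuous map. -/
theorem continuousOn_paramOf : ContinuousOn paramOf (Set.univ ×ˢ Set.Ioi 0) := by
  have hi : Continuous fun p : SO3 × ℝ ↦ p.1⁻¹ := continuous_inv.comp continuous_fst
  have h1 := continuous_rotSpaceCLM.comp hi
  have h2 := (ContinuousLinearMap.continuous_restrictScalars
    (𝕜 := ℂ) (E := C3) (F := C3) (𝕜' := ℝ)).comp
    (continuous_rotValueCLM.comp hi)
  have h3 : ContinuousOn (fun p : SO3 × ℝ ↦ p.2 ^ (-(3 / 2) : ℝ)) (Set.univ ×ˢ Set.Ioi 0) :=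
    continuousOn_snd.rpow_const fun p hp ↦ Or.inl (ne_of_gt hp.2)
  exact (continuousOn_snd.smul h1.continuousOn).prodMk (h3.smul h2.continuousOn)

/-- The parameters of the multiplier at the sample point `ω`. -/
def param (a b : ℝ) (ω : SO3 × R3) : (R3 →L[ℝ] R3) × (C3 →L[ℝ] C3) :=
  paramOf (ω.1, clampNorm a b ω.2)

theorem continuous_param (ha : 0 < a) : Continuous (param a b) := by
  have h : Continuous fun ω : SO3 × R3 ↦ (ω.1, clampNorm a b ω.2) :=
    continuous_fst.prodMk ((continuous_clampNorm a b).comp continuous_snd)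
  refine continuousOn_paramOf.comp_continuous h fun ω ↦ ⟨trivial, ?_⟩
  exact (by positivity : 0 < a / 4).trans_le (le_clampNorm a b ω.2)

/-- Compactness gives seminorm bounds uniform in the sample point, hence finite moments of all
orders. -/
theorem exists_compact_param (ha : 0 < a) (hab : a ≤ b) :
    ∃ K, IsCompact K ∧ ∀ ω, param a b ω ∈ K := by
  refine ⟨paramOf '' (Set.univ ×ˢ Set.Icc (a / 4) (2 * b)),
    (isCompact_univ.prod isCompact_Icc).image_of_continuousOn
      (continuousOn_paramOf.mono (Set.prod_mono subset_rfl fun t ht ↦ ?_)), fun ω ↦ ?_⟩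
  · exact (by positivity : 0 < a / 4).trans_le ht.1
  · exact ⟨_, ⟨trivial, le_clampNorm a b ω.2, clampNorm_le (by linarith) _⟩, rfl⟩

/-- The band function, as a function of the parameters. -/
def band (z : ((R3 →L[ℝ] R3) × (C3 →L[ℝ] C3)) × R3) : ℂ :=
  dotC (ℓ.g (z.1.1 z.2)) (z.1.2 (ℓ.Y z.2))

theorem contDiff_band : ContDiff ℝ (⊤ : ℕ∞) ℓ.band := by
  have h1 : ContDiff ℝ (⊤ : ℕ∞) fun z : ((R3 →L[ℝ] R3) × (C3 →L[ℝ] C3)) × R3 ↦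
      ℓ.g (z.1.1 z.2) := ℓ.g_smooth.comp (contDiff_fst.fst.clm_apply contDiff_snd)
  have h2 : ContDiff ℝ (⊤ : ℕ∞) fun z : ((R3 →L[ℝ] R3) × (C3 →L[ℝ] C3)) × R3 ↦
      z.1.2 (ℓ.Y z.2) := contDiff_fst.snd.clm_apply (ℓ.Y_smooth.comp contDiff_snd)
  have hb : ∀ X Y : C3, dotC X Y = X 0 * Y 0 + X 1 * Y 1 + X 2 * Y 2 := fun X Y ↦ by
    rw [dotC_apply, Fin.sum_univ_three]
  unfold band
  simp_rw [hb]
  have hp : ∀ i, ContDiff ℝ (⊤ : ℕ∞) fun X : C3 ↦ X i := fun i ↦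
    ((EuclideanSpace.proj i : C3 →L[ℂ] ℂ).restrictScalars ℝ).contDiff
  have hm : ∀ i, ContDiff ℝ (⊤ : ℕ∞) fun z : ((R3 →L[ℝ] R3) × (C3 →L[ℝ] C3)) × R3 ↦
      ℓ.g (z.1.1 z.2) i * z.1.2 (ℓ.Y z.2) i := fun i ↦ ((hp i).comp h1).mul ((hp i).comp h2)
  exact ((hm 0).add (hm 1)).add (hm 2)

theorem band_zero (p : (R3 →L[ℝ] R3) × (C3 →L[ℝ] C3)) (ξ : R3)
    (hξ : ‖ξ‖ < 1 / 2 ∨ 4 < ‖ξ‖) : ℓ.band (p, ξ) = 0 := by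
  rw [band, ℓ.Y_zero ξ hξ, map_zero, map_zero]

theorem band_neg (ω : SO3 × R3) (ξ : R3) :
    ℓ.band (param a b ω, -ξ) = starRingEnd ℂ (ℓ.band (param a b ω, ξ)) := by
  simp only [band, param, paramOf, smul_apply,
    ContinuousLinearMap.coe_restrictScalars']
  rw [map_neg, smul_neg, ℓ.g_neg, ℓ.Y_neg, rotValue_cj, ← cj.map_smul, dotC_cj]

/-- The multiplier at the sample point `ω`. -/
def multiplier {Q : ℝ} (hQ : 100 ≤ Q) (ω : SO3 × R3) : RealMultiplier :=
  bandMultiplier hQ (fun ξ ↦ ℓ.band (param a b ω, ξ))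
    (isBand_family ℓ.contDiff_band ℓ.band_zero (param a b ω)) (ℓ.band_neg ω)

theorem measurable_multiplier {Q : ℝ} (hQ : 100 ≤ Q) (ha : 0 < a) :
    Measurable (ℓ.multiplier hQ) :=
  (continuous_bandMultiplier hQ ℓ.contDiff_band ℓ.band_zero (continuous_param ha)
    ℓ.band_neg).measurable

theorem exists_symbolSeminorm_multiplier_le {Q : ℝ} (hQ : 100 ≤ Q) (ha : 0 < a) (hab : a ≤ b)
    (k : ℕ) : ∃ C : ℝ, ∀ ω, symbolSeminorm k (ℓ.multiplier hQ ω).symbol ≤ ENNReal.ofReal C := by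
  obtain ⟨K, hK, hp⟩ := exists_compact_param ha hab
  obtain ⟨C, hC⟩ := exists_symbolSeminorm_le hQ ℓ.contDiff_band ℓ.band_zero hK k
  exact ⟨C, fun ω ↦ hC _ (hp ω)⟩

/-- The dilation factor at the sample point `ω`. -/
def dilation (ha : 0 < a) (b : ℝ) (ω : SO3 × R3) : Set.Ioi (0 : ℝ) :=
  ⟨(clampNorm a b ω.2)⁻¹, inv_pos.2 ((by positivity : 0 < a / 4).trans_le (le_clampNorm a b ω.2))⟩

theorem measurable_dilation (ha : 0 < a) (b : ℝ) : Measurable (dilation ha b) :=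
  Measurable.subtype_mk ((continuous_clampNorm a b).measurable.comp measurable_snd).inv

end Leg

/-! ### Transformed fields and their means -/

theorem hasSum_band {E : Type*} [AddCommMonoid E] [TopologicalSpace E] {Q : ℝ} (hQ : 100 ≤ Q)
    {f : R3 → E} (hf : ∀ ξ, (‖ξ‖ < 1 / 2 ∨ 4 < ‖ξ‖) → f ξ = 0) {ξ : R3} {n : ℤ}
    (h1 : 4 / Q < ‖ξ‖ / Q ^ n) (h2 : ‖ξ‖ / Q ^ n < Q / 2) :
    HasSum (fun m : ℤ ↦ f ((Q ^ m)⁻¹ • ξ)) (f ((Q ^ n)⁻¹ • ξ)) :=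
  hasSum_single n fun _ hm ↦ band_ne hQ hf h1 h2 hm

theorem norm_periodize_le {Q : ℝ} (hQ : 100 ≤ Q) {f : R3 → ℂ} (hf : IsBand f) {M : ℝ}
    (hM : 0 ≤ M) (h : ∀ ξ, ‖f ξ‖ ≤ M) (ξ : R3) : ‖periodize Q f ξ‖ ≤ M := by
  by_cases hξ : ξ = 0
  · rw [hξ, periodize_zero hf, norm_zero]; exact hM
  · obtain ⟨n, h1, h2⟩ := exists_scale hQ hξ
    rw [periodize_eq hQ hf h1 h2]; exact h _

/-- At each point at most one term is nonzero, so the finite partial sums converge pointwise and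
measurability passes to the limit. -/
theorem measurable_periodize_family {Ω : Type*} [MeasurableSpace Ω] {Q : ℝ} (hQ : 100 ≤ Q)
    {f : Ω → R3 → ℂ} (hf : ∀ ω, IsBand (f ω)) (hm : Measurable fun p : Ω × R3 ↦ f p.1 p.2) :
    Measurable fun p : Ω × R3 ↦ periodize Q (f p.1) p.2 := by
  refine measurable_of_tendsto_metrizable' (u := Filter.atTop)
    (f := fun (s : Finset ℤ) (p : Ω × R3) ↦ ∑ n ∈ s, f p.1 ((Q ^ n)⁻¹ • p.2)) (fun s ↦ ?_) ?_
  · refine Finset.measurable_fun_sum _ fun n _ ↦ ?_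
    exact hm.comp (measurable_fst.prodMk (measurable_snd.const_smul (Q ^ n)⁻¹))
  · rw [tendsto_pi_nhds]
    rintro ⟨ω, ξ⟩
    suffices h : Summable fun n : ℤ ↦ f ω ((Q ^ n)⁻¹ • ξ) from h.hasSum
    by_cases hξ : ξ = 0
    · have h0 : (fun n : ℤ ↦ f ω ((Q ^ n)⁻¹ • ξ)) = fun _ ↦ 0 := by
        ext n
        rw [hξ, smul_zero, (hf ω).eq_zero 0 (Or.inl (by simp))]
      rw [h0]; exact summable_zero
    · obtain ⟨n, h1, h2⟩ := exists_scale hQ hξ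
      exact (hasSum_band hQ (hf ω).eq_zero h1 h2).summable

theorem lintegral_comp_smul_rot {r : ℝ} (hr : 0 < r) (R : SO3) {f : R3 → ℝ≥0∞}
    (hf : Measurable f) :
    ∫⁻ ξ, f (r • rotSpace R ξ) = ENNReal.ofReal (r ^ 3)⁻¹ * ∫⁻ ξ, f ξ := by
  rw [(rotSpace_measurePreserving R).lintegral_comp (f := fun ξ ↦ f (r • ξ)) (by fun_prop),
    ← lintegral_map hf (by fun_prop), Measure.map_addHaar_smul _ hr.ne', lintegral_smul_measure,
    finrank_R3, abs_of_pos (by positivity), smul_eq_mul]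

theorem ae_comp_smul_rot {r : ℝ} (hr : 0 < r) (R : SO3) {p : R3 → Prop} (h : ∀ᵐ ξ, p ξ) :
    ∀ᵐ ξ, p (r • rotSpace R ξ) := by
  have h1 : Measure.QuasiMeasurePreserving (fun ξ : R3 ↦ r • ξ) volume volume := by
    refine ⟨by fun_prop, ?_⟩
    rw [Measure.map_addHaar_smul _ hr.ne']
    exact Measure.smul_absolutelyContinuous
  exact (h1.comp (rotSpace_measurePreserving R).quasiMeasurePreserving).ae h

namespace Leg

variable {a b σ : ℝ} (ℓ : Leg a b σ)

theorem clampNorm_pos (ha : 0 < a) (b : ℝ) (ζ : R3) : 0 < clampNorm a b ζ :=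
  (by positivity : 0 < a / 4).trans_le (le_clampNorm a b ζ)

/-- The Fourier transform of the transformed field at the sample point `ω`. -/
def hat (Q : ℝ) (u : H10df) (ω : SO3 × R3) (ξ : R3) : C3 :=
  periodize Q (fun η ↦ ℓ.band (param a b ω, η)) ξ • (clampNorm a b ω.2 ^ (3 / 2 : ℝ)) •
    rotValue ω.1 (u.hat (clampNorm a b ω.2 • rotSpace ω.1⁻¹ ξ))

/-- The dilation factor is the inverse of the truncated norm, so that on the Fourier side `û` is
evaluated at `|ζ| R⁻¹ ξ`, in accordance with `orbit`. -/
theorem fourier_leg {Q : ℝ} (hQ : 100 ≤ Q) (ha : 0 < a) (u : H10df) (ω : SO3 × R3) :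
    (𝓕 (mult (ℓ.multiplier hQ ω) (rot ω.1 (dil (dilation ha b ω) u.toL2))) : L2Field)
      =ᵐ[volume] ℓ.hat Q u ω := by
  have h1 := fourier_dil (dilation ha b ω) u.toL2
  have h2 : ∀ᵐ ξ, _ := (rotSpace_measurePreserving ω.1⁻¹).quasiMeasurePreserving.ae h1
  filter_upwards [fourier_mult (ℓ.multiplier hQ ω) (rot ω.1 (dil (dilation ha b ω) u.toL2)),
    fourier_rot ω.1 (dil (dilation ha b ω) u.toL2), h2] with ξ e1 e2 e3
  rw [e1, e2, e3]
  have hp := clampNorm_pos ha b ω.2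
  simp only [dilation, inv_inv]
  rw [Real.inv_rpow hp.le, Real.rpow_neg hp.le, inv_inv]
  rw [hat]
  congr 1
  exact (rotValue ω.1).map_smul_of_tower _ _

theorem exists_norm_hat_le {Q : ℝ} (hQ : 100 ≤ Q) (ha : 0 < a) (hab : a ≤ b) :
    ∃ M : ℝ, 0 ≤ M ∧ ∀ (u : H10df) (ω : SO3 × R3) (ξ : R3), ‖ℓ.hat Q u ω ξ‖ ≤
      M * ‖u.hat (clampNorm a b ω.2 • rotSpace ω.1⁻¹ ξ)‖ := by
  obtain ⟨K, hK, hp⟩ := exists_compact_param ha hab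
  obtain ⟨C, hC⟩ := (hK.prod (isCompact_closedBall (0 : R3) 4)).exists_bound_of_continuousOn
    ℓ.contDiff_band.continuous.continuousOn
  have hb : ∀ ω ξ, ‖ℓ.band (param a b ω, ξ)‖ ≤ max C 0 := by
    intro ω ξ
    by_cases hξ : ‖ξ‖ ≤ 4
    · exact (hC _ ⟨hp ω, by simpa using hξ⟩).trans (le_max_left _ _)
    · rw [ℓ.band_zero _ _ (Or.inr (not_le.1 hξ)), norm_zero]; exact le_max_right _ _
  have hbb : 0 ≤ 2 * b := by linarith
  refine ⟨max C 0 * (2 * b) ^ (3 / 2 : ℝ), by positivity, fun u ω ξ ↦ ?_⟩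
  have hpos := clampNorm_pos ha b ω.2
  rw [hat, norm_smul, norm_smul, norm_rotValue, mul_assoc, Real.norm_of_nonneg (by positivity)]
  have h1 := norm_periodize_le hQ (isBand_family ℓ.contDiff_band ℓ.band_zero (param a b ω))
    (le_max_right C 0) (hb ω) ξ
  have h2 : clampNorm a b ω.2 ^ (3 / 2 : ℝ) ≤ (2 * b) ^ (3 / 2 : ℝ) :=
    Real.rpow_le_rpow hpos.le (clampNorm_le (by linarith) _) (by norm_num)
  gcongr

theorem measurable_hat {Q : ℝ} (hQ : 100 ≤ Q) (ha : 0 < a) (u : H10df) :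
    StronglyMeasurable fun p : (SO3 × R3) × R3 ↦ ℓ.hat Q u p.1 p.2 := by
  have h1 : Measurable fun p : (SO3 × R3) × R3 ↦
      periodize Q (fun η ↦ ℓ.band (param a b p.1, η)) p.2 := by
    refine measurable_periodize_family hQ (fun ω ↦ isBand_family ℓ.contDiff_band ℓ.band_zero _) ?_
    have hc : Continuous fun p : (SO3 × R3) × R3 ↦ (param a b p.1, p.2) :=
      ((continuous_param ha).comp continuous_fst).prodMk continuous_snd
    exact (ℓ.contDiff_band.continuous.comp hc).measurable
  have hcl : Continuous fun p : (SO3 × R3) × R3 ↦ clampNorm a b p.1.2 :=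
    (continuous_clampNorm a b).comp continuous_fst.snd
  have h2 : Measurable fun p : (SO3 × R3) × R3 ↦ clampNorm a b p.1.2 ^ (3 / 2 : ℝ) :=
    hcl.measurable.pow_const _
  have hR := continuous_rotSpace_inv
    (continuous_fst.comp (continuous_fst (X := SO3 × R3) (Y := R3)))
    continuous_snd
  have hx : Continuous fun p : (SO3 × R3) × R3 ↦ clampNorm a b p.1.2 • rotSpace p.1.1⁻¹ p.2 :=
    hcl.smul hR
  have h3 := continuous_rotValue.comp_stronglyMeasurable
    (((measurable_fst (α := SO3) (β := R3)).comp
      (measurable_fst (α := SO3 × R3) (β := R3))).stronglyMeasurable.prodMk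
      (u.measurable_hat.comp_measurable hx.measurable))
  exact h1.stronglyMeasurable.smul (h2.stronglyMeasurable.smul h3)

/-- A change of variables, with bounds uniform in `ω` because the dilation is at least `a / 4`. The
cases `(j, k) = (0, 1), (2, 2), (0, 2)` are those needed for the three slots of `triKernel`. -/
theorem exists_lintegral_hat_le {Q : ℝ} (hQ : 100 ≤ Q) (ha : 0 < a) (hab : a ≤ b) (u : H10df)
    (j k : ℕ) (h : ∫⁻ ξ, ‖ξ‖ₑ ^ j * ‖u.hat ξ‖ₑ ^ k < ∞) :
    ∃ C : ℝ≥0∞, C < ∞ ∧ ∀ ω, ∫⁻ ξ, ‖ξ‖ₑ ^ j * ‖ℓ.hat Q u ω ξ‖ₑ ^ k ≤ C := by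
  obtain ⟨M, hM, hb⟩ := ℓ.exists_norm_hat_le hQ ha hab
  have hm : Measurable fun ξ : R3 ↦ ‖ξ‖ₑ ^ j * ‖u.hat ξ‖ₑ ^ k :=
    (measurable_enorm.pow_const _).mul (u.measurable_hat.measurable.enorm.pow_const _)
  refine ⟨ENNReal.ofReal (4 / a) ^ j * ENNReal.ofReal M ^ k * (ENNReal.ofReal ((a / 4) ^ 3)⁻¹ *
    ∫⁻ ξ, ‖ξ‖ₑ ^ j * ‖u.hat ξ‖ₑ ^ k), ?_, fun ω ↦ ?_⟩
  · exact ENNReal.mul_lt_top (ENNReal.mul_lt_top (ENNReal.pow_lt_top ENNReal.ofReal_lt_top)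
      (ENNReal.pow_lt_top ENNReal.ofReal_lt_top)) (ENNReal.mul_lt_top ENNReal.ofReal_lt_top h)
  have hpos := clampNorm_pos ha b ω.2
  have hle := le_clampNorm a b ω.2
  set r := clampNorm a b ω.2 with hr
  calc ∫⁻ ξ, ‖ξ‖ₑ ^ j * ‖ℓ.hat Q u ω ξ‖ₑ ^ k
      ≤ ∫⁻ ξ, ENNReal.ofReal (4 / a) ^ j * ENNReal.ofReal M ^ k *
        (‖r • rotSpace ω.1⁻¹ ξ‖ₑ ^ j * ‖u.hat (r • rotSpace ω.1⁻¹ ξ)‖ₑ ^ k) := by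
        refine lintegral_mono fun ξ ↦ ?_
        have h1 : ‖ξ‖ₑ ≤ ENNReal.ofReal (4 / a) * ‖r • rotSpace ω.1⁻¹ ξ‖ₑ := by
          rw [← ofReal_norm, ← ofReal_norm, ← ENNReal.ofReal_mul (by positivity), norm_smul,
            norm_rotSpace, Real.norm_of_nonneg hpos.le]
          refine ENNReal.ofReal_le_ofReal ?_
          have : 1 ≤ 4 / a * r := by
            rw [div_mul_eq_mul_div, le_div_iff₀ ha]; linarith
          nlinarith [norm_nonneg ξ]
        have h2 : ‖ℓ.hat Q u ω ξ‖ₑ ≤ ENNReal.ofReal M * ‖u.hat (r • rotSpace ω.1⁻¹ ξ)‖ₑ := by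
          rw [← ofReal_norm, ← ofReal_norm, ← ENNReal.ofReal_mul hM]
          exact ENNReal.ofReal_le_ofReal (hb u ω ξ)
        calc _ ≤ (ENNReal.ofReal (4 / a) * ‖r • rotSpace ω.1⁻¹ ξ‖ₑ) ^ j *
            (ENNReal.ofReal M * ‖u.hat (r • rotSpace ω.1⁻¹ ξ)‖ₑ) ^ k := by gcongr
          _ = _ := by rw [mul_pow, mul_pow]; ring
    _ = ENNReal.ofReal (4 / a) ^ j * ENNReal.ofReal M ^ k * (ENNReal.ofReal (r ^ 3)⁻¹ *
        ∫⁻ ξ, ‖ξ‖ₑ ^ j * ‖u.hat ξ‖ₑ ^ k) := by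
        rw [lintegral_const_mul', lintegral_comp_smul_rot hpos _ hm]
        exact ENNReal.mul_ne_top (ENNReal.pow_ne_top ENNReal.ofReal_ne_top)
          (ENNReal.pow_ne_top ENNReal.ofReal_ne_top)
    _ ≤ _ := by gcongr

/-- The field `Y(η) / |η|³`. -/
def Z (η : R3) : C3 := (‖η‖ ^ 3)⁻¹ • ℓ.Y η

theorem Z_zero (ξ : R3) (hξ : ‖ξ‖ < 1 / 2 ∨ 4 < ‖ξ‖) : ℓ.Z ξ = 0 := by
  rw [Z, ℓ.Y_zero ξ hξ, smul_zero]

/-- The average of the transformed fields, up to a constant. -/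
def mean (Q : ℝ) (u : H10df) (ξ : R3) : C3 :=
  ∑' n : ℤ, coef ℓ.g (Q ^ n) (fun ξ ↦ hel σ ξ (u.hat ξ)) • freqScale (Q ^ n) ℓ.Z ξ

theorem freqScale_Z_ne {Q : ℝ} (hQ : 100 ≤ Q) {ξ : R3} {n : ℤ}
    (h1 : 4 / Q < ‖ξ‖ / Q ^ n) (h2 : ‖ξ‖ / Q ^ n < Q / 2) {m : ℤ} (hm : m ≠ n) :
    freqScale (Q ^ m) ℓ.Z ξ = 0 := by
  rw [freqScale, band_ne hQ ℓ.Z_zero h1 h2 hm, smul_zero]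

theorem mean_eq {Q : ℝ} (hQ : 100 ≤ Q) (u : H10df) {ξ : R3} {n : ℤ}
    (h1 : 4 / Q < ‖ξ‖ / Q ^ n) (h2 : ‖ξ‖ / Q ^ n < Q / 2) :
    ℓ.mean Q u ξ = coef ℓ.g (Q ^ n) (fun ξ ↦ hel σ ξ (u.hat ξ)) • freqScale (Q ^ n) ℓ.Z ξ :=
  tsum_eq_single n fun m hm ↦ by rw [ℓ.freqScale_Z_ne hQ h1 h2 hm, smul_zero]

theorem mean_zero (Q : ℝ) (u : H10df) : ℓ.mean Q u 0 = 0 := by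
  simp [mean, freqScale, ℓ.Z_zero 0 (Or.inl (by simp))]

theorem memLp_g : MemLp ℓ.g 2 volume := by
  refine ℓ.g_smooth.continuous.memLp_of_hasCompactSupport
    (HasCompactSupport.of_support_subset_isCompact (isCompact_closedBall (0 : R3) b) fun ξ hξ ↦ ?_)
  rw [mem_closedBall_zero_iff]
  by_contra h
  exact hξ (ℓ.g_zero ξ (Or.inr (not_le.1 h)))

/-- Near `ξ = Qⁿ η` only the `n`-th term of the periodized symbol is present, and the normalizing
powers of `|ζ|` cancel. What remains is the integrand of `integral_orbit` for the rescaled field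
`û(Qⁿ ·)`, restricted to the shell. -/
theorem integral_hat {Q : ℝ} (hQ : 100 ≤ Q) (ha : 0 < a) (hab : a ≤ b) (hσ : σ ^ 2 = 1)
    (u : H10df) (ξ : R3) :
    Integrable (fun ω ↦ ℓ.hat Q u ω ξ) (legMeasure a b) ∧
    ∫ ω, ℓ.hat Q u ω ξ ∂(legMeasure a b) =
      ((volume (shell a b)).toReal)⁻¹ • ℓ.mean Q u ξ := by
  have hV : (volume (shell a b))⁻¹ ≠ ∞ := ENNReal.inv_ne_top.2 (volume_shell_ne_zero ha hab)
  by_cases hξ : ξ = 0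
  · have h0 : ∀ ω, ℓ.hat Q u ω ξ = 0 := fun ω ↦ by
      rw [hat, hξ, periodize_zero (isBand_family ℓ.contDiff_band ℓ.band_zero _), zero_smul]
    simp_rw [h0]
    rw [hξ, mean_zero]
    simp
  obtain ⟨n, h1, h2⟩ := exists_scale hQ hξ
  have hs : 0 < Q ^ n := by positivity
  set s := Q ^ n with hs_def
  set η := s⁻¹ • ξ with hη
  have hη0 : η ≠ 0 := smul_ne_zero (inv_ne_zero hs.ne') hξ
  have hξη : ξ = s • η := by rw [hη, smul_smul, mul_inv_cancel₀ hs.ne', one_smul]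
  set U : R3 → C3 := fun x ↦ u.hat (s • x) with hUdef
  have hUm : StronglyMeasurable U := u.measurable_hat.comp_measurable (by fun_prop)
  have hUL : MemLp U 2 volume := memLp_comp_smul hs u.memLp_hat
  have hgU : Integrable fun x ↦ ‖ℓ.g x‖ * ‖U x‖ := ℓ.memLp_g.norm.integrable_mul hUL.norm
  have hdiv : ∀ᵐ x, ∑ i, (x i : ℂ) * U x i = 0 := by
    have h3 := ae_comp_smul_rot hs 1 u.hat_divFree
    filter_upwards [h3] with x hx
    rw [rotSpace_one] at hx
    have hsC : (s : ℂ) ≠ 0 := by exact_mod_cast hs.ne'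
    refine (mul_eq_zero.1 ?_).resolve_left hsC
    rw [← hx, Finset.mul_sum]
    refine Finset.sum_congr rfl fun i _ ↦ ?_
    simp [hUdef]
    ring
  obtain ⟨k1, k2⟩ := integral_orbit hσ ℓ.g_smooth.continuous hUm hgU hdiv hη0 (ℓ.Y_hel η)
  set H : SO3 × R3 → C3 := fun p ↦
    dotC (rotValue p.1 (ℓ.g (orbit η p))) (ℓ.Y η) • rotValue p.1 (U (orbit η p)) with hH
  -- If `Y η ≠ 0` then `1/2 ≤ |η| ≤ 4`, and a nonzero profile needs `a ≤ |ζ| |η| ≤ b`; hence `a/4 ≤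
  -- |ζ| ≤ 2b`. This is the origin of the bounds of the shell, and it extends the integral to all of
  -- space.
  have hsupp : ∀ p ∉ (Set.univ : Set SO3) ×ˢ shell a b, H p = 0 := by
    intro p hp
    by_cases hηb : ‖η‖ < 1 / 2 ∨ 4 < ‖η‖
    · simp only [hH]
      rw [ℓ.Y_zero η hηb, map_zero, zero_smul]
    · push Not at hηb
      have hg0 : ℓ.g (orbit η p) = 0 := by
        apply ℓ.g_zero
        rw [norm_orbit]
        by_contra hcon
        push Not at hcon
        refine hp ⟨trivial, ?_, ?_⟩
        · nlinarith [norm_nonneg p.2]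
        · nlinarith [norm_nonneg p.2]
      simp only [hH]
      rw [hg0, map_zero, map_zero, zero_apply, zero_smul]
  have heq : ∀ p ∈ (Set.univ : Set SO3) ×ˢ shell a b, ℓ.hat Q u p ξ = H p := by
    rintro p ⟨-, hp1, hp2⟩
    have hpos := clampNorm_pos ha b p.2
    have hc := clampNorm_eq hp1 hp2
    rw [hat, periodize_eq hQ (isBand_family ℓ.contDiff_band ℓ.band_zero _) h1 h2]
    simp only [band, param, paramOf, smul_apply,
      ContinuousLinearMap.coe_restrictScalars', hH]
    rw [← hs_def, ← hη]
    rw [hc] at hpos ⊢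
    have e1 : ‖p.2‖ • rotSpace p.1⁻¹ η = orbit η p := rfl
    have e2 : ‖p.2‖ • rotSpace p.1⁻¹ ξ = s • orbit η p := by
      rw [hξη, map_smul, smul_comm]; rfl
    have e3 : ‖p.2‖ ^ (-(3 / 2) : ℝ) * ‖p.2‖ ^ (3 / 2 : ℝ) = 1 := by
      rw [← Real.rpow_add hpos]; norm_num
    rw [e1, e2, ContinuousLinearMap.map_smul_of_tower, ← rotValue_dotC p.1 (ℓ.g (orbit η p)),
      ← rotValue_mul, mul_inv_cancel, rotValue_one, smul_assoc, smul_comm _ (‖p.2‖ ^ (3 / 2 : ℝ)),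
      smul_smul, e3, one_smul]
  have hms : MeasurableSet ((Set.univ : Set SO3) ×ˢ shell a b) :=
    MeasurableSet.univ.prod (isClosed_shell a b).measurableSet
  have hcoef : ∫ x, dotC (ℓ.g x) (hel σ x (U x)) =
      (s ^ (-(3 / 2) : ℝ)) • coef ℓ.g s (fun ξ ↦ hel σ ξ (u.hat ξ)) := by
    have h3 : ∀ x, dotC (ℓ.g x) (hel σ x (U x)) = s ^ (3 / 2 : ℝ) •
        dotC (freqScale s ℓ.g (s • x)) (hel σ (s • x) (u.hat (s • x))) := by
      intro x
      rw [hel_smul σ hs, freqScale, smul_smul, inv_mul_cancel₀ hs.ne', one_smul,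
        ContinuousLinearMap.map_smul_of_tower, smul_apply, smul_smul, ← Real.rpow_add hs]
      norm_num [hUdef]
    simp_rw [h3]
    rw [integral_smul, integral_comp_smul_R3 hs
      (fun ξ ↦ dotC (freqScale s ℓ.g ξ) (hel σ ξ (u.hat ξ))), smul_smul, coef]
    congr 1
    -- The exponent 3/2 from `freqScale` and -3 from the Jacobian give -3/2, the normalization of
    -- `freqScale` for `Z`.
    rw [← Real.rpow_natCast, ← Real.rpow_neg hs.le, ← Real.rpow_add hs]
    norm_num
  rw [legMeasure_eq]
  refine ⟨?_, ?_⟩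
  · refine Integrable.smul_measure ?_ hV
    exact (integrableOn_congr_fun heq hms).2 k1.integrableOn
  · rw [integral_smul_measure, setIntegral_congr_fun hms heq,
      setIntegral_eq_integral_of_forall_compl_eq_zero hsupp, k2, ENNReal.toReal_inv,
      ℓ.mean_eq hQ u h1 h2, hcoef, ← hs_def]
    congr 1
    rw [freqScale, ← hη, Z]
    ext i
    simp
    ring

end Leg

/-! ### Averages of the trilinear form -/

theorem norm_sum_mul_le (X : C3) (η : R3) :
    ‖∑ j, X j * (2 * Real.pi * Complex.I * (η j : ℂ))‖ ≤ 2 * Real.pi * (‖X‖ * ‖η‖) := by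
  have h1 : ∑ j, X j * (2 * Real.pi * Complex.I * (η j : ℂ)) =
      (2 * Real.pi * Complex.I) * dotC X (WithLp.toLp 2 fun i ↦ (η i : ℂ)) := by
    rw [dotC_apply, Finset.mul_sum]
    exact Finset.sum_congr rfl fun j _ ↦ by simp; ring
  have h2 : ‖(WithLp.toLp 2 fun i ↦ (η i : ℂ) : C3)‖ = ‖η‖ := by
    rw [EuclideanSpace.norm_eq, EuclideanSpace.norm_eq]
    simp
  rw [h1, norm_mul]
  have h3 := norm_dotC_le X (WithLp.toLp 2 fun i ↦ (η i : ℂ))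
  rw [h2] at h3
  have h4 : ‖(2 * Real.pi * Complex.I : ℂ)‖ = 2 * Real.pi := by
    simp [abs_of_pos Real.pi_pos]
  rw [h4]
  gcongr

/-- The crude inequality `x y ≤ x² + y²` separates the second and third fields, so that Tonelli's
theorem reduces everything to single integrals. Only finiteness matters, not the constant. -/
theorem enorm_triKernel_le (F G H : R3 → C3) (p : R3 × R3) :
    ‖triKernel F G H p‖ₑ ≤ ENNReal.ofReal (2 * Real.pi) *
      (‖F p.1‖ₑ * (‖p.2‖ₑ ^ 2 * ‖G p.2‖ₑ ^ 2 + ‖H (-p.1 - p.2)‖ₑ ^ 2)) := by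
  have h1 : ∀ x y : ℝ≥0∞, x * y ≤ x ^ 2 + y ^ 2 := by
    intro x y
    rcases le_total x y with h | h
    · calc x * y ≤ y * y := by gcongr
        _ = y ^ 2 := (sq y).symm
        _ ≤ _ := le_add_self
    · calc x * y ≤ x * x := by gcongr
        _ = x ^ 2 := (sq x).symm
        _ ≤ _ := le_self_add
  have h2 : ‖triKernel F G H p‖ ≤ (2 * Real.pi) * (‖F p.1‖ *
      ((‖p.2‖ * ‖G p.2‖) * ‖H (-p.1 - p.2)‖)) := by
    rw [triKernel, norm_mul]
    calc _ ≤ (2 * Real.pi * (‖F p.1‖ * ‖p.2‖)) * (‖G p.2‖ * ‖H (-p.1 - p.2)‖) := by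
          gcongr
          · exact norm_sum_mul_le _ _
          · exact norm_dotC_le _ _
      _ = _ := by ring
  calc ‖triKernel F G H p‖ₑ ≤ ENNReal.ofReal ((2 * Real.pi) * (‖F p.1‖ *
      ((‖p.2‖ * ‖G p.2‖) * ‖H (-p.1 - p.2)‖))) := by
        rw [← ofReal_norm]; exact ENNReal.ofReal_le_ofReal h2
    _ = ENNReal.ofReal (2 * Real.pi) * (‖F p.1‖ₑ * ((‖p.2‖ₑ * ‖G p.2‖ₑ) * ‖H (-p.1 - p.2)‖ₑ)) := by
        rw [ENNReal.ofReal_mul (p := 2 * Real.pi) (by positivity),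
          ENNReal.ofReal_mul (p := ‖F p.1‖) (norm_nonneg _),
          ENNReal.ofReal_mul (p := ‖p.2‖ * ‖G p.2‖) (by positivity),
          ENNReal.ofReal_mul (p := ‖p.2‖) (norm_nonneg _)]
        simp only [ofReal_norm]
    _ ≤ _ := by
        rw [← mul_pow]
        gcongr
        exact h1 _ _

theorem lintegral_triKernel_le {F G H : R3 → C3} (hF : StronglyMeasurable F)
    (hG : StronglyMeasurable G) (hH : StronglyMeasurable H) :
    ∫⁻ p, ‖triKernel F G H p‖ₑ ∂(volume.prod volume) ≤ ENNReal.ofReal (2 * Real.pi) *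
      ((∫⁻ ξ, ‖F ξ‖ₑ) * ((∫⁻ ξ, ‖ξ‖ₑ ^ 2 * ‖G ξ‖ₑ ^ 2) + ∫⁻ ξ, ‖H ξ‖ₑ ^ 2)) := by
  have hFm := hF.measurable.enorm
  have hGm : Measurable fun ξ : R3 ↦ ‖ξ‖ₑ ^ 2 * ‖G ξ‖ₑ ^ 2 :=
    (measurable_enorm.pow_const 2).mul (hG.measurable.enorm.pow_const 2)
  have hHm : Measurable fun ξ : R3 ↦ ‖H ξ‖ₑ ^ 2 := hH.measurable.enorm.pow_const 2
  have hsub : Measurable fun p : R3 × R3 ↦ -p.1 - p.2 := by fun_prop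
  have hm : Measurable fun p : R3 × R3 ↦
      ‖F p.1‖ₑ * (‖p.2‖ₑ ^ 2 * ‖G p.2‖ₑ ^ 2 + ‖H (-p.1 - p.2)‖ₑ ^ 2) :=
    (hFm.comp measurable_fst).mul ((hGm.comp measurable_snd).add (hHm.comp hsub))
  calc _ ≤ ∫⁻ p, ENNReal.ofReal (2 * Real.pi) *
      (‖F p.1‖ₑ * (‖p.2‖ₑ ^ 2 * ‖G p.2‖ₑ ^ 2 + ‖H (-p.1 - p.2)‖ₑ ^ 2))
        ∂(volume.prod volume) := lintegral_mono fun p ↦ enorm_triKernel_le F G H p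
    _ = _ := by
        rw [lintegral_const_mul _ hm, lintegral_prod _ hm.aemeasurable]
        congr 1
        rw [← lintegral_mul_const _ hFm]
        refine lintegral_congr fun ξ ↦ ?_
        have h1 : Measurable fun η : R3 ↦ ‖H (-ξ - η)‖ₑ ^ 2 :=
          hHm.comp (measurable_const.sub measurable_id)
        have h2 : Measurable fun η : R3 ↦ ‖η‖ₑ ^ 2 * ‖G η‖ₑ ^ 2 + ‖H (-ξ - η)‖ₑ ^ 2 := hGm.add h1
        dsimp only
        rw [lintegral_const_mul _ h2, lintegral_add_left hGm,
          (measurePreserving_neg_sub ξ).lintegral_comp (f := fun η ↦ ‖H η‖ₑ ^ 2) hHm]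

theorem triKernel_congr_ae {F F' G G' H H' : R3 → C3} (hF : F =ᵐ[volume] F')
    (hG : G =ᵐ[volume] G') (hH : H =ᵐ[volume] H') :
    ∫ ξ, ∫ η, triKernel F G H (ξ, η) = ∫ ξ, ∫ η, triKernel F' G' H' (ξ, η) := by
  refine integral_congr_ae ?_
  filter_upwards [hF] with ξ h1
  refine integral_congr_ae ?_
  filter_upwards [hG, (measurePreserving_neg_sub ξ).quasiMeasurePreserving.ae hH] with η h2 h3
  simp only [triKernel]
  rw [h1, h2, h3]

theorem stronglyMeasurable_triKernel {T : Type*} [MeasurableSpace T] {F G H : T → R3 → C3}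
    (hF : StronglyMeasurable fun p : T × R3 ↦ F p.1 p.2)
    (hG : StronglyMeasurable fun p : T × R3 ↦ G p.1 p.2)
    (hH : StronglyMeasurable fun p : T × R3 ↦ H p.1 p.2) :
    StronglyMeasurable fun p : T × (R3 × R3) ↦ triKernel (F p.1) (G p.1) (H p.1) p.2 := by
  have h1 : Measurable fun p : T × (R3 × R3) ↦ (p.1, p.2.1) := by fun_prop
  have h2 : Measurable fun p : T × (R3 × R3) ↦ (p.1, p.2.2) := by fun_prop
  have h3 : Measurable fun p : T × (R3 × R3) ↦ (p.1, -p.2.1 - p.2.2) := by fun_prop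
  have hF' := hF.comp_measurable h1
  have hG' := hG.comp_measurable h2
  have hH' := hH.comp_measurable h3
  have hc : ∀ j : Fin 3, Continuous fun X : C3 ↦ X j := fun j ↦ by fun_prop
  have hp : ∀ j : Fin 3, StronglyMeasurable fun p : T × (R3 × R3) ↦
      2 * Real.pi * Complex.I * (p.2.2 j : ℂ) := fun j ↦ by
    have : Continuous fun ξ : R3 ↦ 2 * Real.pi * Complex.I * (ξ j : ℂ) := by fun_prop
    exact this.comp_stronglyMeasurable (f := fun p : T × (R3 × R3) ↦ p.2.2)
      (measurable_snd.comp measurable_snd).stronglyMeasurable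
  have hs : StronglyMeasurable fun p : T × (R3 × R3) ↦
      ∑ j, F p.1 p.2.1 j * (2 * Real.pi * Complex.I * (p.2.2 j : ℂ)) :=
    Finset.stronglyMeasurable_fun_sum _ fun j _ ↦ ((hc j).comp_stronglyMeasurable hF').mul (hp j)
  have hd := isBoundedBilinearMap_apply.continuous.comp_stronglyMeasurable
    ((dotC.continuous.comp_stronglyMeasurable hG').prodMk hH')
  exact hs.mul hd

section Average

variable {T : Type*} [MeasurableSpace T] {μ : Measure T} [IsProbabilityMeasure μ]

/-- Independence of the coordinates. The permutation records which sample point feeds which slot, so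
that both orders of the symmetrized Euler form are covered. -/
theorem integral_pi_mul_mul (e : Equiv.Perm (Fin 3)) {A : Fin 3 → T → ℂ}
    (hA : ∀ i, Integrable (A i) μ) :
    Integrable (fun ω : Fin 3 → T ↦ A 0 (ω (e 0)) * A 1 (ω (e 1)) * A 2 (ω (e 2)))
      (Measure.pi fun _ ↦ μ) ∧
    ∫ ω : Fin 3 → T, A 0 (ω (e 0)) * A 1 (ω (e 1)) * A 2 (ω (e 2)) ∂(Measure.pi fun _ ↦ μ) =
      (∫ t, A 0 t ∂μ) * (∫ t, A 1 t ∂μ) * ∫ t, A 2 t ∂μ := by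
  have h : ∀ ω : Fin 3 → T, A 0 (ω (e 0)) * A 1 (ω (e 1)) * A 2 (ω (e 2)) =
      ∏ i, A (e.symm i) (ω i) := by
    intro ω
    rw [← Equiv.prod_comp e, Fin.prod_univ_three]
    simp
  simp_rw [h]
  refine ⟨Integrable.fintype_prod_dep fun i ↦ hA _, ?_⟩
  rw [integral_fintype_prod_eq_prod, ← Equiv.prod_comp e, Fin.prod_univ_three]
  simp

/-- At a fixed pair of frequencies the kernel is a finite sum of products of one coordinate of each
field. -/
theorem integral_triKernel_family (e : Equiv.Perm (Fin 3)) {F : Fin 3 → T → R3 → C3}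
    {M : Fin 3 → R3 → C3} (hF : ∀ i ξ, Integrable (fun t ↦ F i t ξ) μ)
    (hM : ∀ i ξ, ∫ t, F i t ξ ∂μ = M i ξ) (p : R3 × R3) :
    ∫ ω : Fin 3 → T, triKernel (F 0 (ω (e 0))) (F 1 (ω (e 1))) (F 2 (ω (e 2))) p
      ∂(Measure.pi fun _ ↦ μ) = triKernel (M 0) (M 1) (M 2) p := by
  have hproj : ∀ i ξ (j : Fin 3), Integrable (fun t ↦ F i t ξ j) μ := fun i ξ j ↦
    (EuclideanSpace.proj j : C3 →L[ℂ] ℂ).integrable_comp (hF i ξ)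
  have hMj : ∀ i ξ (j : Fin 3), ∫ t, F i t ξ j ∂μ = M i ξ j := fun i ξ j ↦ by
    rw [← hM]
    exact (EuclideanSpace.proj j : C3 →L[ℂ] ℂ).integral_comp_comm (hF i ξ)
  have hexp : ∀ A B C : R3 → C3, triKernel A B C p = ∑ j, ∑ i,
      (2 * Real.pi * Complex.I * (p.2 j : ℂ)) * (A p.1 j * B p.2 i * C (-p.1 - p.2) i) := by
    intro A B C
    rw [triKernel, dotC_apply, Finset.sum_mul_sum]
    exact Finset.sum_congr rfl fun j _ ↦ Finset.sum_congr rfl fun i _ ↦ by ring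
  simp_rw [hexp]
  have hkey : ∀ j i : Fin 3, Integrable (fun ω : Fin 3 → T ↦
      F 0 (ω (e 0)) p.1 j * F 1 (ω (e 1)) p.2 i * F 2 (ω (e 2)) (-p.1 - p.2) i)
        (Measure.pi fun _ ↦ μ) ∧ ∫ ω : Fin 3 → T,
      F 0 (ω (e 0)) p.1 j * F 1 (ω (e 1)) p.2 i * F 2 (ω (e 2)) (-p.1 - p.2) i
        ∂(Measure.pi fun _ ↦ μ) = M 0 p.1 j * M 1 p.2 i * M 2 (-p.1 - p.2) i := by
    intro j i
    have := integral_pi_mul_mul (μ := μ) e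
      (A := ![fun t ↦ F 0 t p.1 j, fun t ↦ F 1 t p.2 i, fun t ↦ F 2 t (-p.1 - p.2) i])
      (fun k ↦ by fin_cases k; exacts [hproj _ _ _, hproj _ _ _, hproj _ _ _])
    simpa [hMj] using this
  rw [integral_finsetSum _ fun j _ ↦ integrable_finsetSum _ fun i _ ↦ (hkey j i).1.const_mul _]
  refine Finset.sum_congr rfl fun j _ ↦ ?_
  rw [integral_finsetSum _ fun i _ ↦ (hkey j i).1.const_mul _]
  refine Finset.sum_congr rfl fun i _ ↦ ?_
  rw [integral_const_mul, (hkey j i).2]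

/-- Averaging the trilinear form over independent families amounts to averaging its arguments. -/
theorem integral_integral_triKernel (e : Equiv.Perm (Fin 3)) {F : Fin 3 → T → R3 → C3}
    {M : Fin 3 → R3 → C3} (hm : ∀ i, StronglyMeasurable fun p : T × R3 ↦ F i p.1 p.2)
    (hF : ∀ i ξ, Integrable (fun t ↦ F i t ξ) μ) (hM : ∀ i ξ, ∫ t, F i t ξ ∂μ = M i ξ)
    {C₀ C₁ C₂ : ℝ≥0∞} (hC₀ : C₀ < ∞) (hC₁ : C₁ < ∞) (hC₂ : C₂ < ∞)
    (h₀ : ∀ t, ∫⁻ ξ, ‖F 0 t ξ‖ₑ ≤ C₀) (h₁ : ∀ t, ∫⁻ ξ, ‖ξ‖ₑ ^ 2 * ‖F 1 t ξ‖ₑ ^ 2 ≤ C₁)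
    (h₂ : ∀ t, ∫⁻ ξ, ‖F 2 t ξ‖ₑ ^ 2 ≤ C₂) :
    Integrable (fun ω : Fin 3 → T ↦ ∫ ξ, ∫ η,
      triKernel (F 0 (ω (e 0))) (F 1 (ω (e 1))) (F 2 (ω (e 2))) (ξ, η))
        (Measure.pi fun _ ↦ μ) ∧
    ∫ ω : Fin 3 → T, (∫ ξ, ∫ η,
      triKernel (F 0 (ω (e 0))) (F 1 (ω (e 1))) (F 2 (ω (e 2))) (ξ, η))
        ∂(Measure.pi fun _ ↦ μ) =
      ∫ p, triKernel (M 0) (M 1) (M 2) p ∂(volume.prod volume) := by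
  set ν : Measure (Fin 3 → T) := Measure.pi fun _ ↦ μ
  have hev : ∀ i, StronglyMeasurable fun p : (Fin 3 → T) × R3 ↦ F i (p.1 (e i)) p.2 := fun i ↦ by
    have h : Measurable fun p : (Fin 3 → T) × R3 ↦ (p.1 (e i), p.2) := by fun_prop
    exact (hm i).comp_measurable h
  have hK := stronglyMeasurable_triKernel (F := fun ω : Fin 3 → T ↦ F 0 (ω (e 0)))
    (G := fun ω ↦ F 1 (ω (e 1))) (H := fun ω ↦ F 2 (ω (e 2))) (hev 0) (hev 1) (hev 2)
  set C : ℝ≥0∞ := ENNReal.ofReal (2 * Real.pi) * (C₀ * (C₁ + C₂))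
  have hC : C < ∞ := ENNReal.mul_lt_top ENNReal.ofReal_lt_top
    (ENNReal.mul_lt_top hC₀ (ENNReal.add_lt_top.2 ⟨hC₁, hC₂⟩))
  have hsec : ∀ i t, StronglyMeasurable (F i t) := fun i t ↦
    (hm i).comp_measurable measurable_prodMk_left
  have hbound : ∀ ω : Fin 3 → T, ∫⁻ p,
      ‖triKernel (F 0 (ω (e 0))) (F 1 (ω (e 1))) (F 2 (ω (e 2))) p‖ₑ ∂(volume.prod volume) ≤ C := by
    intro ω
    refine (lintegral_triKernel_le (hsec _ _) (hsec _ _) (hsec _ _)).trans ?_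
    change _ ≤ ENNReal.ofReal (2 * Real.pi) * (C₀ * (C₁ + C₂))
    gcongr
    exacts [h₀ _, h₁ _, h₂ _]
  -- The bounds are uniform in the sample point and the measure has mass one, so the joint integral
  -- converges and Fubini applies.
  have hint : Integrable (fun q : (Fin 3 → T) × (R3 × R3) ↦
      triKernel (F 0 (q.1 (e 0))) (F 1 (q.1 (e 1))) (F 2 (q.1 (e 2))) q.2)
        (ν.prod (volume.prod volume)) := by
    refine ⟨hK.aestronglyMeasurable, ?_⟩
    rw [hasFiniteIntegral_iff_enorm, lintegral_prod _ hK.enorm.aemeasurable]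
    calc _ ≤ ∫⁻ _ω, C ∂ν := lintegral_mono fun ω ↦ hbound ω
      _ = C := by rw [lintegral_const, measure_univ, mul_one]
      _ < ∞ := hC
  have hfix : ∀ ω : Fin 3 → T, ∫ ξ, ∫ η,
      triKernel (F 0 (ω (e 0))) (F 1 (ω (e 1))) (F 2 (ω (e 2))) (ξ, η) =
      ∫ p, triKernel (F 0 (ω (e 0))) (F 1 (ω (e 1))) (F 2 (ω (e 2))) p
        ∂(volume.prod volume) := by
    intro ω
    refine (integral_prod _ ⟨?_, ?_⟩).symm
    · exact (hK.comp_measurable measurable_prodMk_left).aestronglyMeasurable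
    · rw [hasFiniteIntegral_iff_enorm]
      exact (hbound ω).trans_lt hC
  simp_rw [hfix]
  refine ⟨hint.integral_prod_left, ?_⟩
  rw [integral_integral_swap hint]
  exact integral_congr_ae (.of_forall fun p ↦ integral_triKernel_family e hF hM p)

end Average

/-! ### The trilinear form of the averaged fields -/

theorem triKernel_smul (r : ℂ) (F G H : R3 → C3) (p : R3 × R3) :
    triKernel (fun ξ ↦ r • F ξ) (fun ξ ↦ r • G ξ) (fun ξ ↦ r • H ξ) p =
      r ^ 3 * triKernel F G H p := by
  simp only [triKernel, PiLp.smul_apply, smul_eq_mul, map_smul, smul_apply, mul_assoc,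
    ← Finset.mul_sum]
  ring

/-- Three normalizations give `s^{-9/2}` and the derivative gives `s`. The total exponent -7/2 is
written as 5/2 - 6, because `s⁶` is the Jacobian of the double frequency integral; this leaves the
factor `s^{5/2}` of the cascade. -/
theorem triKernel_freqScale {s : ℝ} (hs : 0 < s) (F G H : R3 → C3) (p : R3 × R3) :
    triKernel (freqScale s F) (freqScale s G) (freqScale s H) p =
      ((s ^ (5 / 2 : ℝ) * (s ^ 6)⁻¹ : ℝ) : ℂ) * triKernel F G H (s⁻¹ • p) := by
  have hsC : (s : ℂ) ≠ 0 := by exact_mod_cast hs.ne'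
  have h1 : (s ^ (5 / 2 : ℝ) * (s ^ 6)⁻¹ : ℝ) = (s ^ (-(3 / 2) : ℝ)) ^ 3 * s := by
    rw [← Real.rpow_natCast s 6, ← Real.rpow_neg hs.le, ← Real.rpow_add hs,
      ← Real.rpow_natCast (s ^ (-(3 / 2) : ℝ)), ← Real.rpow_mul hs.le]
    nth_rw 3 [← Real.rpow_one s]
    rw [← Real.rpow_add hs]
    norm_num
  have h2 : s⁻¹ • (-p.1 - p.2) = -(s⁻¹ • p).1 - (s⁻¹ • p).2 := by
    rw [smul_sub, smul_neg]; rfl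
  have h3 : ∀ j, p.2 j = s * (s⁻¹ • p).2 j := fun j ↦ by
    rw [Prod.smul_snd, PiLp.smul_apply, smul_eq_mul, mul_inv_cancel_left₀ hs.ne']
  rw [h1]
  simp only [triKernel, freqScale]
  rw [h2, ContinuousLinearMap.map_smul_of_tower, ContinuousLinearMap.map_smul_of_tower, smul_apply]
  simp only [h3, Prod.smul_fst, Prod.smul_snd, Finset.sum_mul]
  rw [Finset.mul_sum]
  refine Finset.sum_congr rfl fun j _ ↦ ?_
  simp
  ring

theorem integral_comp_smul_R3xR3 {E : Type*} [NormedAddCommGroup E] [NormedSpace ℝ E] {s : ℝ}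
    (hs : 0 < s) (f : R3 × R3 → E) :
    ∫ p, f (s⁻¹ • p) ∂(volume.prod volume) = s ^ 6 • ∫ p, f p ∂(volume.prod volume) := by
  rw [Measure.integral_comp_inv_smul, Module.finrank_prod, finrank_R3, abs_of_pos (by positivity)]

namespace Leg

variable {a b σ : ℝ} (ℓ : Leg a b σ)

theorem continuous_Z : Continuous ℓ.Z := by
  refine continuous_iff_continuousAt.2 fun ξ ↦ ?_
  by_cases hξ : ξ = 0
  · have h : ℓ.Z =ᶠ[nhds ξ] fun _ ↦ 0 := by
      rw [hξ]
      filter_upwards [Metric.ball_mem_nhds (0 : R3) (by norm_num : (0 : ℝ) < 1 / 2)] with η hη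
      exact ℓ.Z_zero η (Or.inl (by simpa using hη))
    exact continuousAt_const.congr h.symm
  · have h : ContinuousAt (fun η : R3 ↦ (‖η‖ ^ 3)⁻¹) ξ :=
      ContinuousAt.inv₀ (by fun_prop) (pow_ne_zero 3 (norm_ne_zero_iff.2 hξ))
    exact h.smul ℓ.Y_smooth.continuous.continuousAt

theorem lintegral_Z_lt_top (j k : ℕ) (hk : k ≠ 0) : ∫⁻ ξ, ‖ξ‖ₑ ^ j * ‖ℓ.Z ξ‖ₑ ^ k < ∞ := by
  have hc : Continuous fun ξ : R3 ↦ ‖ξ‖ ^ j * ‖ℓ.Z ξ‖ ^ k :=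
    (continuous_norm.pow j).mul (ℓ.continuous_Z.norm.pow k)
  have hs : HasCompactSupport fun ξ : R3 ↦ ‖ξ‖ ^ j * ‖ℓ.Z ξ‖ ^ k := by
    refine HasCompactSupport.of_support_subset_isCompact (isCompact_closedBall (0 : R3) 4)
      fun ξ hξ ↦ ?_
    rw [mem_closedBall_zero_iff]
    by_contra h
    refine hξ ?_
    simp only
    rw [ℓ.Z_zero ξ (Or.inr (not_le.1 h)), norm_zero, zero_pow hk, mul_zero]
  have hi := (hc.integrable_of_hasCompactSupport (μ := volume) hs).2
  rw [hasFiniteIntegral_iff_enorm] at hi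
  refine lt_of_le_of_lt (le_of_eq (lintegral_congr fun ξ ↦ ?_)) hi
  simp [enorm_mul, enorm_pow]

/-- The amplitude of the helicity component of `u` at the scale `Q ^ n`. -/
def amp (Q : ℝ) (u : H10df) (n : ℤ) : ℂ := coef ℓ.g (Q ^ n) fun ξ ↦ hel σ ξ (u.hat ξ)

theorem amp_im (Q : ℝ) (u : H10df) (n : ℤ) : (ℓ.amp Q u n).im = 0 := by
  refine coef_real ℓ.g_neg _ ?_
  filter_upwards [u.hat_real] with ξ h
  rw [h, hel_neg_cj]

theorem norm_amp_le (ha : 0 < a) (hσ : σ ^ 2 = 1) {Q : ℝ} (hQ : 100 ≤ Q) (u : H10df) (n : ℤ) :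
    ‖ℓ.amp Q u n‖ ≤ (eLpNorm ℓ.g 2 volume).toReal * ‖u‖ * decay a (Q ^ n) := by
  have := (norm_coef_le ℓ.g_smooth.continuous ℓ.memLp_g ha (fun ξ h ↦ ℓ.g_zero ξ (Or.inl h))
    (s := Q ^ n) (by positivity) u (stronglyMeasurable_hel σ u.measurable_hat)
    (fun ξ ↦ norm_hel_le hσ ξ _)).2
  rw [amp]
  linarith

/-- At every frequency at most one scale is active. The nonvanishing of `Y` in the second case is
the input for `SameScale`. -/
theorem mean_cases {Q : ℝ} (hQ : 100 ≤ Q) (u : H10df) (ξ : R3) :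
    (ℓ.mean Q u ξ = 0 ∧ ∀ n : ℤ, freqScale (Q ^ n) ℓ.Z ξ = 0) ∨
    ∃ n : ℤ, ℓ.Y ((Q ^ n)⁻¹ • ξ) ≠ 0 ∧ ℓ.mean Q u ξ = ℓ.amp Q u n • freqScale (Q ^ n) ℓ.Z ξ ∧
      ∀ m ≠ n, freqScale (Q ^ m) ℓ.Z ξ = 0 := by
  by_cases hξ : ξ = 0
  · left
    rw [hξ]
    exact ⟨ℓ.mean_zero Q u, fun n ↦ by simp [freqScale, ℓ.Z_zero 0 (Or.inl (by simp))]⟩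
  obtain ⟨n, h1, h2⟩ := exists_scale hQ hξ
  by_cases hY : ℓ.Y ((Q ^ n)⁻¹ • ξ) = 0
  · left
    have h0 : freqScale (Q ^ n) ℓ.Z ξ = 0 := by rw [freqScale, Z, hY, smul_zero, smul_zero]
    refine ⟨by rw [ℓ.mean_eq hQ u h1 h2, h0, smul_zero], fun m ↦ ?_⟩
    by_cases hm : m = n
    · rw [hm, h0]
    · exact ℓ.freqScale_Z_ne hQ h1 h2 hm
  · exact Or.inr ⟨n, hY, ℓ.mean_eq hQ u h1 h2, fun m hm ↦ ℓ.freqScale_Z_ne hQ h1 h2 hm⟩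

end Leg

/-- Three frequencies of zero sum can only interact if they belong to the same scale. -/
def SameScale (Q : ℝ) (Y₀ Y₁ Y₂ : R3 → C3) : Prop :=
  ∀ (ξ η : R3) (k l m : ℤ), Y₀ ((Q ^ k)⁻¹ • ξ) ≠ 0 → Y₁ ((Q ^ l)⁻¹ • η) ≠ 0 →
    Y₂ ((Q ^ m)⁻¹ • (-ξ - η)) ≠ 0 → k = m ∧ l = m

theorem SameScale.swap {Q : ℝ} {Y₀ Y₁ Y₂ : R3 → C3} (h : SameScale Q Y₀ Y₁ Y₂) :
    SameScale Q Y₁ Y₀ Y₂ := by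
  intro ξ η k l m h0 h1 h2
  rw [show -ξ - η = -η - ξ by abel] at h2
  exact (h η ξ l k m h1 h0 h2).symm

/-- The value of the trilinear form on the fields `Z` of three legs. -/
def triForm (F G H : R3 → C3) : ℂ := ∫ p, triKernel F G H p ∂(volume.prod volume)

section Three

variable {a b σ₀ σ₁ σ₂ : ℝ} (ℓ₀ : Leg a b σ₀) (ℓ₁ : Leg a b σ₁) (ℓ₂ : Leg a b σ₂)

theorem hasSum_triKernel_mean {Q : ℝ} (hQ : 100 ≤ Q) (h : SameScale Q ℓ₀.Y ℓ₁.Y ℓ₂.Y)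
    (u v w : H10df) (p : R3 × R3) :
    HasSum (fun n : ℤ ↦ ℓ₀.amp Q u n * ℓ₁.amp Q v n * ℓ₂.amp Q w n *
      triKernel (freqScale (Q ^ n) ℓ₀.Z) (freqScale (Q ^ n) ℓ₁.Z) (freqScale (Q ^ n) ℓ₂.Z) p)
      (triKernel (ℓ₀.mean Q u) (ℓ₁.mean Q v) (ℓ₂.mean Q w) p) := by
  have hz0 : ∀ F G H : R3 → C3, F p.1 = 0 → triKernel F G H p = 0 := fun F G H h ↦ by
    simp [triKernel, h]
  have hz1 : ∀ F G H : R3 → C3, G p.2 = 0 → triKernel F G H p = 0 := fun F G H h ↦ by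
    simp [triKernel, h]
  have hz2 : ∀ F G H : R3 → C3, H (-p.1 - p.2) = 0 → triKernel F G H p = 0 := fun F G H h ↦ by
    simp [triKernel, h]
  rcases ℓ₀.mean_cases hQ u p.1 with ⟨h0, h0'⟩ | ⟨k, hk, hk', hk''⟩
  · rw [hz0 _ _ _ h0]
    simp_rw [fun n : ℤ ↦ hz0 _ (freqScale (Q ^ n) ℓ₁.Z) (freqScale (Q ^ n) ℓ₂.Z) (h0' n), mul_zero]
    exact hasSum_zero
  rcases ℓ₁.mean_cases hQ v p.2 with ⟨h1, h1'⟩ | ⟨l, hl, hl', hl''⟩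
  · rw [hz1 _ _ _ h1]
    simp_rw [fun n : ℤ ↦ hz1 (freqScale (Q ^ n) ℓ₀.Z) _ (freqScale (Q ^ n) ℓ₂.Z) (h1' n), mul_zero]
    exact hasSum_zero
  rcases ℓ₂.mean_cases hQ w (-p.1 - p.2) with ⟨h2, h2'⟩ | ⟨m, hm, hm', hm''⟩
  · rw [hz2 _ _ _ h2]
    simp_rw [fun n : ℤ ↦ hz2 (freqScale (Q ^ n) ℓ₀.Z) (freqScale (Q ^ n) ℓ₁.Z) _ (h2' n), mul_zero]
    exact hasSum_zero
  -- The frequencies sum to zero, so the three active scales agree and all mixed terms disappear.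
  obtain ⟨rfl, rfl⟩ := h _ _ k l m hk hl hm
  have he : triKernel (ℓ₀.mean Q u) (ℓ₁.mean Q v) (ℓ₂.mean Q w) p =
      ℓ₀.amp Q u l * ℓ₁.amp Q v l * ℓ₂.amp Q w l *
      triKernel (freqScale (Q ^ l) ℓ₀.Z) (freqScale (Q ^ l) ℓ₁.Z) (freqScale (Q ^ l) ℓ₂.Z) p := by
    simp only [triKernel]
    rw [hk', hl', hm']
    simp only [PiLp.smul_apply, smul_eq_mul, map_smul, smul_apply, mul_assoc, ← Finset.mul_sum]
    ring
  rw [he]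
  refine hasSum_single l fun n hn ↦ ?_
  rw [hz0 _ _ _ (hk'' n hn), mul_zero]

theorem integrable_triKernel_Z :
    Integrable (triKernel ℓ₀.Z ℓ₁.Z ℓ₂.Z) (volume.prod volume) := by
  have hm : ∀ {σ} (ℓ : Leg a b σ), StronglyMeasurable ℓ.Z := fun ℓ ↦
    ℓ.continuous_Z.stronglyMeasurable
  have hm' : ∀ {σ} (ℓ : Leg a b σ), StronglyMeasurable fun p : Unit × R3 ↦ ℓ.Z p.2 := fun ℓ ↦
    (hm ℓ).comp_measurable measurable_snd
  have hK := stronglyMeasurable_triKernel (T := Unit) (F := fun _ ↦ ℓ₀.Z) (G := fun _ ↦ ℓ₁.Z)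
    (H := fun _ ↦ ℓ₂.Z) (hm' ℓ₀) (hm' ℓ₁) (hm' ℓ₂)
  refine ⟨(hK.comp_measurable (measurable_prodMk_left (x := ()))).aestronglyMeasurable, ?_⟩
  rw [hasFiniteIntegral_iff_enorm]
  refine (lintegral_triKernel_le (hm ℓ₀) (hm ℓ₁) (hm ℓ₂)).trans_lt ?_
  have h0 := ℓ₀.lintegral_Z_lt_top 0 1 one_ne_zero
  have h1 := ℓ₁.lintegral_Z_lt_top 2 2 two_ne_zero
  have h2 := ℓ₂.lintegral_Z_lt_top 0 2 two_ne_zero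
  simp only [pow_zero, one_mul, pow_one] at h0 h2
  exact ENNReal.mul_lt_top ENNReal.ofReal_lt_top
    (ENNReal.mul_lt_top h0 (ENNReal.add_lt_top.2 ⟨h1, h2⟩))

/-- Termwise integration, justified because the `L¹` norms of the terms are bounded by `(Qⁿ)^{5/2}`
times the cube of the decay of the amplitudes. -/
theorem hasSum_triForm_mean (ha : 0 < a) (hσ₀ : σ₀ ^ 2 = 1) (hσ₁ : σ₁ ^ 2 = 1) (hσ₂ : σ₂ ^ 2 = 1)
    {Q : ℝ} (hQ : 100 ≤ Q) (h : SameScale Q ℓ₀.Y ℓ₁.Y ℓ₂.Y) (u v w : H10df) :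
    HasSum (fun n : ℤ ↦ ℓ₀.amp Q u n * ℓ₁.amp Q v n * ℓ₂.amp Q w n *
      (((Q ^ n) ^ (5 / 2 : ℝ) : ℝ) * triForm ℓ₀.Z ℓ₁.Z ℓ₂.Z))
      (triForm (ℓ₀.mean Q u) (ℓ₁.mean Q v) (ℓ₂.mean Q w)) := by
  have hs : ∀ n : ℤ, 0 < Q ^ n := fun n ↦ by positivity
  set K := triKernel ℓ₀.Z ℓ₁.Z ℓ₂.Z with hK
  set A : ℤ → ℂ := fun n ↦ ℓ₀.amp Q u n * ℓ₁.amp Q v n * ℓ₂.amp Q w n with hA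
  set Kn : ℤ → R3 × R3 → ℂ := fun n p ↦ A n *
    triKernel (freqScale (Q ^ n) ℓ₀.Z) (freqScale (Q ^ n) ℓ₁.Z) (freqScale (Q ^ n) ℓ₂.Z) p with hKn
  have hKn' : ∀ n p, Kn n p = A n * (((Q ^ n) ^ (5 / 2 : ℝ) * ((Q ^ n) ^ 6)⁻¹ : ℝ) *
      K ((Q ^ n)⁻¹ • p)) := fun n p ↦ by
    simp only [hKn]; rw [triKernel_freqScale (hs n)]
  have hKi : Integrable K (volume.prod volume) := integrable_triKernel_Z ℓ₀ ℓ₁ ℓ₂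
  have hKni : ∀ n, Integrable (Kn n) (volume.prod volume) := by
    intro n
    have h1 : Integrable (fun p ↦ K ((Q ^ n)⁻¹ • p)) (volume.prod volume) :=
      hKi.comp_smul (inv_ne_zero (hs n).ne')
    rw [show Kn n = fun p ↦ _ from funext (hKn' n)]
    exact (h1.const_mul _).const_mul _
  have hval : ∀ n, ∫ p, Kn n p ∂(volume.prod volume) =
      A n * (((Q ^ n) ^ (5 / 2 : ℝ) : ℝ) * triForm ℓ₀.Z ℓ₁.Z ℓ₂.Z) := by
    intro n
    simp_rw [hKn']
    rw [integral_const_mul, integral_const_mul, integral_comp_smul_R3xR3 (hs n), triForm]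
    congr 1
    have : ((Q : ℂ) ^ n) ≠ 0 := by exact_mod_cast (hs n).ne'
    simp
    field_simp
    rfl
  have hnorm : ∀ n, ∫ p, ‖Kn n p‖ ∂(volume.prod volume) =
      ‖A n‖ * ((Q ^ n) ^ (5 / 2 : ℝ) * ∫ p, ‖K p‖ ∂(volume.prod volume)) := by
    intro n
    have hp := hs n
    have h0 : 0 ≤ (Q ^ n) ^ (5 / 2 : ℝ) * ((Q ^ n) ^ 6)⁻¹ := by positivity
    simp_rw [hKn', norm_mul, Complex.norm_real, Real.norm_of_nonneg h0]
    rw [integral_const_mul, integral_const_mul,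
      integral_comp_smul_R3xR3 (hs n) (fun p ↦ ‖K p‖), smul_eq_mul]
    field_simp
  have hsum : Summable fun n ↦ ∫ p, ‖Kn n p‖ ∂(volume.prod volume) := by
    simp_rw [hnorm]
    set B : ℝ := ((eLpNorm ℓ₀.g 2 volume).toReal * ‖u‖) * ((eLpNorm ℓ₁.g 2 volume).toReal * ‖v‖) *
      ((eLpNorm ℓ₂.g 2 volume).toReal * ‖w‖) * ∫ p, ‖K p‖ ∂(volume.prod volume)
    have hI : 0 ≤ ∫ p, ‖K p‖ ∂(volume.prod volume) := integral_nonneg fun _ ↦ norm_nonneg _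
    refine Summable.of_nonneg_of_le (fun n ↦ ?_) (fun n ↦ ?_)
      ((summable_rpow_mul_decay ha (by linarith : 1 < Q)).mul_left B)
    · have := hs n; positivity
    · have h0 := ℓ₀.norm_amp_le ha hσ₀ hQ u n
      have h1 := ℓ₁.norm_amp_le ha hσ₁ hQ v n
      have h2 := ℓ₂.norm_amp_le ha hσ₂ hQ w n
      have hd := decay_nonneg a (Q ^ n)
      have hp := hs n
      simp only [hA, norm_mul]
      calc _ ≤ ((eLpNorm ℓ₀.g 2 volume).toReal * ‖u‖ * decay a (Q ^ n)) *
            ((eLpNorm ℓ₁.g 2 volume).toReal * ‖v‖ * decay a (Q ^ n)) *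
            ((eLpNorm ℓ₂.g 2 volume).toReal * ‖w‖ * decay a (Q ^ n)) *
            ((Q ^ n) ^ (5 / 2 : ℝ) * ∫ p, ‖K p‖ ∂(volume.prod volume)) := by gcongr
        _ = _ := by ring
  have hmain := hasSum_integral_of_summable_integral_norm hKni hsum
  simp_rw [hval] at hmain
  have he : triForm (ℓ₀.mean Q u) (ℓ₁.mean Q v) (ℓ₂.mean Q w) =
      ∫ p, ∑' n, Kn n p ∂(volume.prod volume) := integral_congr_ae (.of_forall fun p ↦
    (hasSum_triKernel_mean ℓ₀ ℓ₁ ℓ₂ hQ h u v w p).tsum_eq.symm)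
  rw [he]
  exact hmain

end Three

/-! ### Averaged forms -/

/-- The trilinear forms `⟨T(u, v), w⟩` that are averages of the Euler form. -/
def IsAveragedForm (T : H10df → H10df → H10df → ℝ) : Prop :=
  ∃ (Ω : Type) (_ : MeasurableSpace Ω) (μ : Measure Ω) (_ : IsProbabilityMeasure μ)
    (m : Fin 3 → Ω → RealMultiplier) (R : Fin 3 → Ω → SO3) (c : Fin 3 → Ω → Set.Ioi (0 : ℝ)),
    (∀ i, Measurable (m i)) ∧
    (∀ i a b, Measurable fun ω ↦ (R i ω : Matrix (Fin 3) (Fin 3) ℝ) a b) ∧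
    (∀ i, Measurable (c i)) ∧
    (∀ k : Fin 3 → ℕ, ∫⁻ ω, ∏ i, symbolSeminorm (k i) (m i ω).symbol ∂μ < ∞) ∧
    (∃ A : ℝ, 0 < A ∧ ∀ i ω, A⁻¹ ≤ (c i ω : ℝ) ∧ (c i ω : ℝ) ≤ A) ∧
    ∀ u v w : H10df,
      let integrand : Ω → ℝ := fun ω ↦ eulerForm
        (mult (m 0 ω) (rot (R 0 ω) (dil (c 0 ω) u.toL2)))
        (mult (m 1 ω) (rot (R 1 ω) (dil (c 1 ω) v.toL2)))
        (mult (m 2 ω) (rot (R 2 ω) (dil (c 2 ω) w.toL2)))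
      Integrable integrand μ ∧ T u v w = ∫ ω, integrand ω ∂μ

/-- Bare trilinear forms are used for the intermediate averages, so that no boundedness has to be
proved for them. -/
theorem isAveragedEuler_iff (T : BilinOp) :
    IsAveragedEuler T ↔ IsAveragedForm fun u v w ↦ T u v w := Iff.rfl

theorem H10df.lintegral_hat_lt_top (u : H10df) : ∫⁻ ξ, ‖u.hat ξ‖ₑ < ∞ := by
  have h := u.integrable_hat.2
  rwa [hasFiniteIntegral_iff_enorm] at h

theorem lintegral_enorm_sq_lt_top {f : R3 → C3} (hf : MemLp f 2 volume) :
    ∫⁻ ξ, ‖f ξ‖ₑ ^ 2 < ∞ := by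
  have h := hf.2
  rw [eLpNorm_lt_top_iff_lintegral_rpow_enorm_lt_top two_ne_zero ENNReal.ofNat_ne_top] at h
  simpa using h

theorem memLp_two_of_lintegral {f : R3 → C3} (hf : StronglyMeasurable f)
    (h : ∫⁻ ξ, ‖f ξ‖ₑ ^ 2 < ∞) : MemLp f 2 volume := by
  refine ⟨hf.aestronglyMeasurable, ?_⟩
  rw [eLpNorm_lt_top_iff_lintegral_rpow_enorm_lt_top two_ne_zero ENNReal.ofNat_ne_top]
  simpa using h

section

variable {a b : ℝ} {σ : Fin 3 → ℝ} (ℓ : ∀ i, Leg a b (σ i))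

theorem exists_lintegral_hat_bounds {Q : ℝ} (hQ : 100 ≤ Q) (ha : 0 < a) (hab : a ≤ b) {σ : ℝ}
    (ℓ : Leg a b σ) (u : H10df) : ∃ C₀ C₁ C₂ : ℝ≥0∞, C₀ < ∞ ∧ C₁ < ∞ ∧ C₂ < ∞ ∧ ∀ ω,
      ∫⁻ ξ, ‖ℓ.hat Q u ω ξ‖ₑ ≤ C₀ ∧ ∫⁻ ξ, ‖ξ‖ₑ ^ 2 * ‖ℓ.hat Q u ω ξ‖ₑ ^ 2 ≤ C₁ ∧
        ∫⁻ ξ, ‖ℓ.hat Q u ω ξ‖ₑ ^ 2 ≤ C₂ := by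
  obtain ⟨C₀, h₀, h₀'⟩ := ℓ.exists_lintegral_hat_le hQ ha hab u 0 1
    (by simpa using u.lintegral_hat_lt_top)
  obtain ⟨C₁, h₁, h₁'⟩ := ℓ.exists_lintegral_hat_le hQ ha hab u 2 2 (by
    have h := lintegral_enorm_sq_lt_top u.memLp_norm_hat
    refine lt_of_le_of_lt (le_of_eq (lintegral_congr fun ξ ↦ ?_)) h
    rw [enorm_smul, mul_pow, enorm_norm])
  obtain ⟨C₂, h₂, h₂'⟩ := ℓ.exists_lintegral_hat_le hQ ha hab u 0 2
    (by simpa using lintegral_enorm_sq_lt_top u.memLp_hat)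
  refine ⟨C₀, C₁, C₂, h₀, h₁, h₂, fun ω ↦ ⟨?_, h₁' ω, ?_⟩⟩
  · simpa using h₀' ω
  · simpa using h₂' ω

theorem stronglyMeasurable_hat_section {Q : ℝ} (hQ : 100 ≤ Q) (ha : 0 < a) {σ : ℝ}
    (ℓ : Leg a b σ) (u : H10df) (ω : SO3 × R3) : StronglyMeasurable (ℓ.hat Q u ω) := by
  have h := (ℓ.measurable_hat hQ ha u).comp_measurable (measurable_prodMk_left (x := ω))
  exact h

theorem integrable_hat {Q : ℝ} (hQ : 100 ≤ Q) (ha : 0 < a) (hab : a ≤ b) {σ : ℝ}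
    (ℓ : Leg a b σ) (u : H10df) (ω : SO3 × R3) : Integrable (ℓ.hat Q u ω) := by
  obtain ⟨C₀, _, _, hC₀, _, _, h₀⟩ := exists_lintegral_hat_bounds hQ ha hab ℓ u
  refine ⟨(stronglyMeasurable_hat_section hQ ha ℓ u ω).aestronglyMeasurable, ?_⟩
  rw [hasFiniteIntegral_iff_enorm]
  exact (h₀ ω).1.trans_lt hC₀

theorem memLp_norm_hat {Q : ℝ} (hQ : 100 ≤ Q) (ha : 0 < a) (hab : a ≤ b) {σ : ℝ}
    (ℓ : Leg a b σ) (u : H10df) (ω : SO3 × R3) :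
    MemLp (fun ξ ↦ ‖ξ‖ • ℓ.hat Q u ω ξ) 2 volume := by
  obtain ⟨_, C₁, _, _, hC₁, _, h₁⟩ := exists_lintegral_hat_bounds hQ ha hab ℓ u
  refine memLp_two_of_lintegral (continuous_norm.stronglyMeasurable.smul
    (stronglyMeasurable_hat_section hQ ha ℓ u ω)) ?_
  refine lt_of_le_of_lt (le_of_eq (lintegral_congr fun ξ ↦ ?_)) ((h₁ ω).2.1.trans_lt hC₁)
  rw [enorm_smul, mul_pow, enorm_norm]

theorem convection_legs {Q : ℝ} (hQ : 100 ≤ Q) (ha : 0 < a) (hab : a ≤ b) {σ₀ σ₁ σ₂ : ℝ}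
    (ℓ₀ : Leg a b σ₀) (ℓ₁ : Leg a b σ₁) (ℓ₂ : Leg a b σ₂) (u v w : H10df)
    (ω₀ ω₁ ω₂ : SO3 × R3) :
    convection (mult (ℓ₀.multiplier hQ ω₀) (rot ω₀.1 (dil (Leg.dilation ha b ω₀) u.toL2)))
      (mult (ℓ₁.multiplier hQ ω₁) (rot ω₁.1 (dil (Leg.dilation ha b ω₁) v.toL2)))
      (mult (ℓ₂.multiplier hQ ω₂) (rot ω₂.1 (dil (Leg.dilation ha b ω₂) w.toL2))) =
    (∫ ξ, ∫ η, triKernel (ℓ₀.hat Q u ω₀) (ℓ₁.hat Q v ω₁) (ℓ₂.hat Q w ω₂) (ξ, η)).re := by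
  have f0 := ℓ₀.fourier_leg hQ ha u ω₀
  have f1 := ℓ₁.fourier_leg hQ ha v ω₁
  have f2 := ℓ₂.fourier_leg hQ ha w ω₂
  have h2 : MemLp (fun ξ ↦ ‖ξ‖ • (𝓕 (mult (ℓ₁.multiplier hQ ω₁)
      (rot ω₁.1 (dil (Leg.dilation ha b ω₁) v.toL2))) : L2Field) ξ) 2 volume := by
    refine (memLp_congr_ae ?_).2 (memLp_norm_hat hQ ha hab ℓ₁ v ω₁)
    filter_upwards [f1] with ξ hξ
    rw [hξ]
  rw [convection_eq ((integrable_hat hQ ha hab ℓ₀ u ω₀).congr f0.symm) h2,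
    triKernel_congr_ae f0 f1 f2]

/-- Each mean carries the inverse volume of the shell, whence the cube. The permutations used are
the identity and the exchange of the first two slots. -/
theorem integral_legs {Q : ℝ} (hQ : 100 ≤ Q) (ha : 0 < a) (hab : a ≤ b) (hσ : ∀ i, σ i ^ 2 = 1)
    (U : Fin 3 → H10df) (e : Equiv.Perm (Fin 3)) :
    Integrable (fun ω : Fin 3 → SO3 × R3 ↦ (∫ ξ, ∫ η,
      triKernel ((ℓ (e 0)).hat Q (U (e 0)) (ω (e 0))) ((ℓ (e 1)).hat Q (U (e 1)) (ω (e 1)))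
        ((ℓ (e 2)).hat Q (U (e 2)) (ω (e 2))) (ξ, η)).re) (Measure.pi fun _ ↦ legMeasure a b) ∧
    ∫ ω : Fin 3 → SO3 × R3, (∫ ξ, ∫ η,
      triKernel ((ℓ (e 0)).hat Q (U (e 0)) (ω (e 0))) ((ℓ (e 1)).hat Q (U (e 1)) (ω (e 1)))
        ((ℓ (e 2)).hat Q (U (e 2)) (ω (e 2))) (ξ, η)).re ∂(Measure.pi fun _ ↦ legMeasure a b) =
      ((volume (shell a b)).toReal⁻¹) ^ 3 * (triForm ((ℓ (e 0)).mean Q (U (e 0)))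
        ((ℓ (e 1)).mean Q (U (e 1))) ((ℓ (e 2)).mean Q (U (e 2)))).re := by
  have := isProbabilityMeasure_legMeasure ha hab
  obtain ⟨C₀, _, _, hC₀, _, _, h₀⟩ := exists_lintegral_hat_bounds hQ ha hab (ℓ (e 0)) (U (e 0))
  obtain ⟨_, C₁, _, _, hC₁, _, h₁⟩ := exists_lintegral_hat_bounds hQ ha hab (ℓ (e 1)) (U (e 1))
  obtain ⟨_, _, C₂, _, _, hC₂, h₂⟩ := exists_lintegral_hat_bounds hQ ha hab (ℓ (e 2)) (U (e 2))
  obtain ⟨h1, h2⟩ := integral_integral_triKernel (μ := legMeasure a b) e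
    (F := fun i ↦ (ℓ (e i)).hat Q (U (e i)))
    (M := fun i ξ ↦ (((volume (shell a b)).toReal⁻¹ : ℝ) : ℂ) • (ℓ (e i)).mean Q (U (e i)) ξ)
    (fun i ↦ (ℓ (e i)).measurable_hat hQ ha _)
    (fun i ξ ↦ ((ℓ (e i)).integral_hat hQ ha hab (hσ _) _ ξ).1)
    (fun i ξ ↦ by
      rw [((ℓ (e i)).integral_hat hQ ha hab (hσ _) _ ξ).2]
      rw [Complex.coe_smul])
    hC₀ hC₁ hC₂ (fun ω ↦ (h₀ ω).1) (fun ω ↦ (h₁ ω).2.1) (fun ω ↦ (h₂ ω).2.2)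
  refine ⟨h1.re, ?_⟩
  have h3 := integral_re h1
  simp only [RCLike.re_to_complex] at h3
  rw [h3, h2]
  simp_rw [triKernel_smul]
  rw [integral_const_mul, triForm, ← Complex.ofReal_pow, Complex.re_ofReal_mul]

/-- The sample space is the product of three independent copies of rotations times shell points, one
for each argument. -/
theorem isAveragedForm_legs {Q : ℝ} (hQ : 100 ≤ Q) (ha : 0 < a) (hab : a ≤ b)
    (hσ : ∀ i, σ i ^ 2 = 1) : IsAveragedForm fun u v w ↦
      -(1 / 2) * ((volume (shell a b)).toReal⁻¹) ^ 3 *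
        (triForm ((ℓ 0).mean Q u) ((ℓ 1).mean Q v) ((ℓ 2).mean Q w) +
          triForm ((ℓ 1).mean Q v) ((ℓ 0).mean Q u) ((ℓ 2).mean Q w)).re := by
  have := isProbabilityMeasure_legMeasure ha hab
  refine ⟨Fin 3 → SO3 × R3, inferInstance, Measure.pi fun _ ↦ legMeasure a b, inferInstance,
    fun i ω ↦ (ℓ i).multiplier hQ (ω i), fun i ω ↦ (ω i).1, fun i ω ↦ Leg.dilation ha b (ω i),
    fun i ↦ ((ℓ i).measurable_multiplier hQ ha).comp (measurable_pi_apply i),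
    fun i j k ↦ (continuous_SO3_entry j k).measurable.comp
      (measurable_fst.comp (measurable_pi_apply i)),
    fun i ↦ (Leg.measurable_dilation ha b).comp (measurable_pi_apply i), fun k ↦ ?_, ?_,
    fun u v w ↦ ?_⟩
  · choose C hC using fun i ↦ (ℓ i).exists_symbolSeminorm_multiplier_le hQ ha hab (k i)
    calc _ ≤ ∫⁻ _ω : Fin 3 → SO3 × R3, ∏ i, ENNReal.ofReal (C i)
          ∂(Measure.pi fun _ ↦ legMeasure a b) :=
          lintegral_mono fun ω ↦ Finset.prod_le_prod' fun i _ ↦ hC i (ω i)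
      _ = ∏ i, ENNReal.ofReal (C i) := by rw [lintegral_const, measure_univ, mul_one]
      _ < ∞ := ENNReal.prod_lt_top fun i _ ↦ ENNReal.ofReal_lt_top
  -- The dilation factors are inverses of numbers in `[a/4, 2b]`.
  · refine ⟨max (4 / a) (2 * b), lt_max_of_lt_left (by positivity), fun i ω ↦ ?_⟩
    have hpos := Leg.clampNorm_pos ha b (ω i).2
    simp only [Leg.dilation]
    constructor
    · exact inv_anti₀ hpos ((clampNorm_le (by linarith) _).trans (le_max_right _ _))
    · refine le_trans ?_ (le_max_left _ _)
      rw [← inv_div]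
      exact inv_anti₀ (by positivity) (le_clampNorm a b _)
  · obtain ⟨h1, h2⟩ := integral_legs ℓ hQ ha hab hσ ![u, v, w] (Equiv.refl _)
    obtain ⟨h3, h4⟩ := integral_legs ℓ hQ ha hab hσ ![u, v, w] (Equiv.swap 0 1)
    have e0 : Equiv.swap (0 : Fin 3) 1 0 = 1 := rfl
    have e1 : Equiv.swap (0 : Fin 3) 1 1 = 0 := rfl
    have e2 : Equiv.swap (0 : Fin 3) 1 2 = 2 := rfl
    change Integrable (fun ω : Fin 3 → SO3 × R3 ↦ (∫ ξ, ∫ η,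
      triKernel ((ℓ 0).hat Q u (ω 0)) ((ℓ 1).hat Q v (ω 1)) ((ℓ 2).hat Q w (ω 2)) (ξ, η)).re) _
      at h1
    change ∫ ω : Fin 3 → SO3 × R3, (∫ ξ, ∫ η,
      triKernel ((ℓ 0).hat Q u (ω 0)) ((ℓ 1).hat Q v (ω 1)) ((ℓ 2).hat Q w (ω 2)) (ξ, η)).re ∂_ =
      _ * (triForm ((ℓ 0).mean Q u) ((ℓ 1).mean Q v) ((ℓ 2).mean Q w)).re at h2
    change Integrable (fun ω : Fin 3 → SO3 × R3 ↦ (∫ ξ, ∫ η,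
      triKernel ((ℓ 1).hat Q v (ω 1)) ((ℓ 0).hat Q u (ω 0)) ((ℓ 2).hat Q w (ω 2)) (ξ, η)).re) _
      at h3
    change ∫ ω : Fin 3 → SO3 × R3, (∫ ξ, ∫ η,
      triKernel ((ℓ 1).hat Q v (ω 1)) ((ℓ 0).hat Q u (ω 0)) ((ℓ 2).hat Q w (ω 2)) (ξ, η)).re ∂_ =
      _ * (triForm ((ℓ 1).mean Q v) ((ℓ 0).mean Q u) ((ℓ 2).mean Q w)).re at h4
    simp only [eulerForm, convection_legs hQ ha hab]
    refine ⟨(h1.add h3).const_mul _, ?_⟩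
    rw [integral_const_mul, integral_add h1 h3, h2, h4, Complex.add_re]
    ring

end

/-! ### Linear combinations of averaged forms -/

theorem symbolSeminorm_smul (k : ℕ) (c : ℝ) {f : R3 → ℂ} (hf : ContDiffOn ℝ (⊤ : ℕ∞) f {0}ᶜ) :
    symbolSeminorm k (c • f) = ‖c‖ₑ * symbolSeminorm k f := by
  simp only [symbolSeminorm, ENNReal.mul_iSup]
  refine iSup_congr fun ξ ↦ iSup_congr fun hξ ↦ ?_
  have h : ContDiffAt ℝ k f ξ := ((hf.contDiffAt (isOpen_compl_singleton.mem_nhds hξ))).of_le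
    (mod_cast le_top)
  rw [iteratedFDeriv_const_smul_apply h, enorm_smul]
  ring

namespace RealMultiplier

/-- A real multiple of a multiplier. -/
def scale (c : ℝ) (m : RealMultiplier) : RealMultiplier where
  symbol := c • m.symbol
  smooth := m.smooth.const_smul c
  bounded k := by
    rw [symbolSeminorm_smul k c m.smooth]
    exact ENNReal.mul_lt_top enorm_lt_top (m.bounded k)
  real ξ hξ := by
    simp only [Pi.smul_apply, Complex.real_smul, map_mul, Complex.conj_ofReal, m.real ξ hξ]

/-- For `c ≠ 0` the preimage of a seminorm ball is a ball of radius `r / |c|`; for `c = 0` the map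
is constant. -/
theorem continuous_scale (c : ℝ) : Continuous (scale c) := by
  by_cases hc : c = 0
  · have h : ∀ m n : RealMultiplier, scale c m = scale c n := fun m n ↦ by
      simp only [scale, hc, zero_smul]
    rcases isEmpty_or_nonempty RealMultiplier with h0 | ⟨⟨n⟩⟩
    · exact continuous_of_const h
    · exact continuous_of_const h
  refine continuous_generateFrom_iff.2 ?_
  rintro S ⟨k, m₀, r, rfl⟩
  have h : scale c ⁻¹' {m | symbolSeminorm k (m.symbol - m₀.symbol) < r} =
      {m | symbolSeminorm k (m.symbol - (scale c⁻¹ m₀).symbol) < r / ‖c‖ₑ} := by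
    ext m
    simp only [Set.mem_preimage, Set.mem_ofPred_eq, scale]
    have e : c • m.symbol - m₀.symbol = c • (m.symbol - c⁻¹ • m₀.symbol) := by
      rw [smul_sub, smul_smul, mul_inv_cancel₀ hc, one_smul]
    have e2 : symbolSeminorm k (c • (m.symbol - c⁻¹ • m₀.symbol)) =
        ‖c‖ₑ * symbolSeminorm k (m.symbol - c⁻¹ • m₀.symbol) :=
      symbolSeminorm_smul k c (m.smooth.sub (m₀.smooth.const_smul c⁻¹))
    rw [e, e2, ENNReal.lt_div_iff_mul_lt (Or.inl (by simpa using hc))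
      (Or.inl enorm_ne_top), mul_comm]
  rw [h]
  exact TopologicalSpace.isOpen_generateFrom_of_mem ⟨k, _, _, rfl⟩

end RealMultiplier

theorem mult_scale (c : ℝ) (m : RealMultiplier) (u : L2Field) :
    mult (m.scale c) u = (c : ℂ) • mult m u := by
  have h : (𝓕 (mult (m.scale c) u) : L2Field) = 𝓕 ((c : ℂ) • mult m u : L2Field) := by
    rw [FourierTransform.fourier_smul]
    apply Lp.ext
    filter_upwards [fourier_mult (m.scale c) u, fourier_mult m u,
      Lp.coeFn_smul (c : ℂ) (𝓕 (mult m u) : L2Field)] with ξ h1 h2 h3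
    rw [h1, h3, Pi.smul_apply, h2, smul_smul]
    rfl
  have h2 := congrArg (fun w : L2Field ↦ (𝓕⁻ w : L2Field)) h
  simpa only [fourierInv_fourier_eq] using h2

theorem convection_smul (c : ℝ) (u v w : L2Field) :
    convection u v ((c : ℂ) • w) = c * convection u v w := by
  rw [convection, convection, ← Complex.re_ofReal_mul, ← integral_const_mul]
  congr 1
  refine integral_congr_ae ?_
  filter_upwards [Lp.coeFn_smul (c : ℂ) w] with x hx
  rw [hx, Finset.mul_sum]
  refine Finset.sum_congr rfl fun i _ ↦ ?_
  simp only [Pi.smul_apply, PiLp.smul_apply, smul_eq_mul]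
  ring

theorem eulerForm_smul (c : ℝ) (u v w : L2Field) :
    eulerForm u v ((c : ℂ) • w) = c * eulerForm u v w := by
  rw [eulerForm, eulerForm, convection_smul, convection_smul]; ring

namespace IsAveragedForm

/-- The scalar, of either sign, is absorbed into the third multiplier. The third argument enters the
convection term without a derivative, so homogeneity there is immediate. -/
theorem smul {T : H10df → H10df → H10df → ℝ} (hT : IsAveragedForm T) (c : ℝ) :
    IsAveragedForm (c • T) := by
  obtain ⟨Ω, _, μ, _, m, R, d, hm, hR, hd, hk, hA, h⟩ := hT
  refine ⟨Ω, inferInstance, μ, inferInstance,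
    fun i ω ↦ if i = 2 then (m i ω).scale c else m i ω, R, d, fun i ↦ ?_, hR, hd, fun k ↦ ?_,
    hA, fun u v w ↦ ?_⟩
  · by_cases hi : i = 2
    · simp only [hi, if_true]
      exact (RealMultiplier.continuous_scale c).measurable.comp (hm 2)
    · simp only [hi, if_false]
      exact hm i
  · have e : ∀ ω, ∏ i, symbolSeminorm (k i) (if i = 2 then (m i ω).scale c else m i ω).symbol =
        ‖c‖ₑ * ∏ i, symbolSeminorm (k i) (m i ω).symbol := by
      intro ω
      have h2 : symbolSeminorm (k 2) ((m 2 ω).scale c).symbol =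
        ‖c‖ₑ * symbolSeminorm (k 2) (m 2 ω).symbol := symbolSeminorm_smul _ c (m 2 ω).smooth
      rw [Fin.prod_univ_three, Fin.prod_univ_three]
      simp only [Fin.isValue, if_true, h2, show ¬ ((0 : Fin 3) = 2) by decide,
        show ¬ ((1 : Fin 3) = 2) by decide, if_false]
      ring
    simp_rw [e]
    rw [lintegral_const_mul' _ _ enorm_ne_top]
    exact ENNReal.mul_lt_top enorm_lt_top (hk k)
  · obtain ⟨h1, h2⟩ := h u v w
    simp only [Fin.isValue, if_true, show ¬ ((0 : Fin 3) = 2) by decide,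
        show ¬ ((1 : Fin 3) = 2) by decide, if_false, mult_scale, eulerForm_smul]
    refine ⟨h1.const_mul c, ?_⟩
    rw [integral_const_mul, ← h2]
    rfl

theorem measurableEmbedding_inl {α β : Type*} [MeasurableSpace α]
    [MeasurableSpace β] : MeasurableEmbedding (Sum.inl : α → α ⊕ β) :=
  ⟨Sum.inl_injective, measurable_inl, fun _ hs ↦ hs.inl_image⟩

theorem measurableEmbedding_inr {α β : Type*} [MeasurableSpace α]
    [MeasurableSpace β] : MeasurableEmbedding (Sum.inr : β → α ⊕ β) :=
  ⟨Sum.inr_injective, measurable_inr, fun _ hs ↦ hs.inr_image⟩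

/-- On the disjoint union of the two probability spaces, each weighted by one half, the average is
the mean of the two averages. Together with `smul` this gives sums. -/
theorem midpoint {T₁ T₂ : H10df → H10df → H10df → ℝ} (h₁ : IsAveragedForm T₁)
    (h₂ : IsAveragedForm T₂) : IsAveragedForm ((1 / 2 : ℝ) • (T₁ + T₂)) := by
  obtain ⟨Ω₁, _, μ₁, _, m₁, R₁, d₁, hm₁, hR₁, hd₁, hk₁, ⟨A₁, hA₁, hA₁'⟩, h₁⟩ := h₁
  obtain ⟨Ω₂, _, μ₂, _, m₂, R₂, d₂, hm₂, hR₂, hd₂, hk₂, ⟨A₂, hA₂, hA₂'⟩, h₂⟩ := h₂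
  set μ : Measure (Ω₁ ⊕ Ω₂) := (1 / 2 : ℝ≥0∞) • (μ₁.map Sum.inl + μ₂.map Sum.inr) with hμ
  have hprob : IsProbabilityMeasure μ := ⟨by
    rw [hμ, Measure.smul_apply, Measure.add_apply,
      Measure.map_apply measurable_inl MeasurableSet.univ,
      Measure.map_apply measurable_inr MeasurableSet.univ, Set.preimage_univ, Set.preimage_univ,
      measure_univ, measure_univ, smul_eq_mul, one_add_one_eq_two, one_div,
      ENNReal.inv_mul_cancel two_ne_zero ENNReal.ofNat_ne_top]⟩
  have hhalf : (1 / 2 : ℝ≥0∞) ≠ ∞ := by simp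
  refine ⟨Ω₁ ⊕ Ω₂, inferInstance, μ, hprob, fun i ↦ Sum.elim (m₁ i) (m₂ i),
    fun i ↦ Sum.elim (R₁ i) (R₂ i), fun i ↦ Sum.elim (d₁ i) (d₂ i),
    fun i ↦ (hm₁ i).sumElim (hm₂ i), fun i a b ↦ ?_, fun i ↦ (hd₁ i).sumElim (hd₂ i),
    fun k ↦ ?_, ⟨max A₁ A₂, lt_max_of_lt_left hA₁, ?_⟩, fun u v w ↦ ?_⟩
  · have e : (fun ω ↦ ((Sum.elim (R₁ i) (R₂ i) ω : SO3) : Matrix (Fin 3) (Fin 3) ℝ) a b) =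
      Sum.elim (fun ω ↦ (R₁ i ω : Matrix (Fin 3) (Fin 3) ℝ) a b)
        (fun ω ↦ (R₂ i ω : Matrix (Fin 3) (Fin 3) ℝ) a b) := by
      ext ω; cases ω <;> rfl
    rw [e]
    exact (hR₁ i a b).sumElim (hR₂ i a b)
  · rw [hμ, lintegral_smul_measure, lintegral_add_measure,
      measurableEmbedding_inl.lintegral_map, measurableEmbedding_inr.lintegral_map]
    exact ENNReal.mul_lt_top hhalf.lt_top (ENNReal.add_lt_top.2 ⟨hk₁ k, hk₂ k⟩)
  · rintro i (ω | ω)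
    · exact ⟨(inv_anti₀ hA₁ (le_max_left _ _)).trans (hA₁' i ω).1,
        (hA₁' i ω).2.trans (le_max_left _ _)⟩
    · exact ⟨(inv_anti₀ hA₂ (le_max_right _ _)).trans (hA₂' i ω).1,
        (hA₂' i ω).2.trans (le_max_right _ _)⟩
  · obtain ⟨h1, e1⟩ := h₁ u v w
    obtain ⟨h2, e2⟩ := h₂ u v w
    set f : Ω₁ ⊕ Ω₂ → ℝ := fun ω ↦ eulerForm
      (mult (Sum.elim (m₁ 0) (m₂ 0) ω) (rot (Sum.elim (R₁ 0) (R₂ 0) ω)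
        (dil (Sum.elim (d₁ 0) (d₂ 0) ω) u.toL2)))
      (mult (Sum.elim (m₁ 1) (m₂ 1) ω) (rot (Sum.elim (R₁ 1) (R₂ 1) ω)
        (dil (Sum.elim (d₁ 1) (d₂ 1) ω) v.toL2)))
      (mult (Sum.elim (m₁ 2) (m₂ 2) ω) (rot (Sum.elim (R₁ 2) (R₂ 2) ω)
        (dil (Sum.elim (d₁ 2) (d₂ 2) ω) w.toL2))) with hf
    have i1 : Integrable f (μ₁.map Sum.inl) := measurableEmbedding_inl.integrable_map_iff.2 h1
    have i2 : Integrable f (μ₂.map Sum.inr) := measurableEmbedding_inr.integrable_map_iff.2 h2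
    refine ⟨(i1.add_measure i2).smul_measure hhalf, ?_⟩
    change (1 / 2 : ℝ) * (T₁ u v w + T₂ u v w) = ∫ ω, f ω ∂μ
    rw [hμ, integral_smul_measure, integral_add_measure i1 i2,
      measurableEmbedding_inl.integral_map, measurableEmbedding_inr.integral_map, e1, e2]
    simp only [hf, Sum.elim_inl, Sum.elim_inr, smul_eq_mul]
    norm_num

theorem add {T₁ T₂ : H10df → H10df → H10df → ℝ} (h₁ : IsAveragedForm T₁)
    (h₂ : IsAveragedForm T₂) : IsAveragedForm (T₁ + T₂) := by
  have h := (h₁.midpoint h₂).smul 2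
  rwa [smul_smul, show (2 : ℝ) * (1 / 2) = 1 by norm_num, one_smul] at h

theorem zero : IsAveragedForm 0 := by
  let m : RealMultiplier :=
    ⟨0, contDiffOn_const, fun k ↦ by
      simp [symbolSeminorm, show (0 : R3 → ℂ) = fun _ ↦ 0 from rfl],
      fun ξ _ ↦ by simp⟩
  let d : Set.Ioi (0 : ℝ) := ⟨1, Set.mem_Ioi.2 one_pos⟩
  have h : IsAveragedForm fun u v w ↦ eulerForm (mult m (rot 1 (dil d u.toL2)))
      (mult m (rot 1 (dil d v.toL2))) (mult m (rot 1 (dil d w.toL2))) := by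
    refine ⟨Unit, inferInstance, Measure.dirac (), inferInstance, fun _ _ ↦ m, fun _ _ ↦ 1,
      fun _ _ ↦ d, fun _ ↦ measurable_const, fun _ _ _ ↦ measurable_const,
      fun _ ↦ measurable_const, fun k ↦ ?_, ⟨1, one_pos, fun _ _ ↦ by simp [d]⟩, fun u v w ↦ ?_⟩
    · rw [lintegral_const, measure_univ, mul_one]
      exact ENNReal.prod_lt_top fun i _ ↦ m.bounded (k i)
    · refine ⟨integrable_const _, ?_⟩
      rw [integral_const]
      simp
  have h0 := h.smul 0
  rwa [zero_smul] at h0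

theorem sum {ι : Type*} (s : Finset ι) {T : ι → H10df → H10df → H10df → ℝ}
    (h : ∀ i ∈ s, IsAveragedForm (T i)) : IsAveragedForm (∑ i ∈ s, T i) := by
  classical
  induction s using Finset.induction_on with
  | empty => rw [Finset.sum_empty]; exact zero
  | insert i s hi ih =>
    rw [Finset.sum_insert hi]
    exact (h i (Finset.mem_insert_self i s)).add (ih fun j hj ↦ h j (Finset.mem_insert_of_mem hj))

end IsAveragedForm

/-! ### Three interacting fields of given helicities -/

/-- A vector of helicity `σ` at the frequency `η`. -/
def helVec (σ : ℝ) (η : R3) : C3 :=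
  WithLp.toLp 2 ![-(η 2 * η 0 : ℝ) + Complex.I * (σ * ‖η‖ * η 1 : ℝ),
    -(η 2 * η 1 : ℝ) - Complex.I * (σ * ‖η‖ * η 0 : ℝ), (‖η‖ ^ 2 - η 2 ^ 2 : ℝ)]

theorem helVec_zero' (σ : ℝ) (η : R3) :
    helVec σ η 0 = -(η 2 * η 0 : ℝ) + Complex.I * (σ * ‖η‖ * η 1 : ℝ) := rfl

theorem helVec_one' (σ : ℝ) (η : R3) :
    helVec σ η 1 = -(η 2 * η 1 : ℝ) - Complex.I * (σ * ‖η‖ * η 0 : ℝ) := rfl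

theorem helVec_two' (σ : ℝ) (η : R3) : helVec σ η 2 = (‖η‖ ^ 2 - η 2 ^ 2 : ℝ) := rfl

/-- `helVec` is `2|η|²` times the helicity projection of the component of the third basis vector
orthogonal to `η`. The factor clears denominators, so it is continuous at the origin too. -/
theorem isHel_helVec {σ : ℝ} (hσ : σ ^ 2 = 1) (η : R3) : IsHel σ η (helVec σ η) := by
  have hσC : (σ : ℂ) ^ 2 = 1 := by exact_mod_cast hσ
  have hr : (‖η‖ : ℂ) ^ 2 = (η 0 : ℂ) ^ 2 + (η 1 : ℂ) ^ 2 + (η 2 : ℂ) ^ 2 := by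
    exact_mod_cast norm_sq_R3 η
  rw [IsHel]
  apply C3_ext <;> simp only [PiLp.smul_apply, smul_eq_mul, crossC_zero', crossC_one', crossC_two',
    helVec_zero', helVec_one', helVec_two'] <;> push_cast
  · linear_combination (σ * ‖η‖ * η 0 * η 2 : ℂ) * Complex.I_sq -
      (Complex.I * ‖η‖ ^ 2 * η 1 : ℂ) * hσC
  · linear_combination (σ * ‖η‖ * η 1 * η 2 : ℂ) * Complex.I_sq +
      (Complex.I * ‖η‖ ^ 2 * η 0 : ℂ) * hσC
  · linear_combination (-σ * ‖η‖ * (η 0 ^ 2 + η 1 ^ 2) : ℂ) * Complex.I_sq -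
      (σ * ‖η‖ : ℂ) * hr

theorem helVec_neg (σ : ℝ) (η : R3) : helVec σ (-η) = cj (helVec σ η) := by
  apply C3_ext <;> simp only [cj_apply, helVec_zero', helVec_one', helVec_two', map_add, map_sub,
    map_mul, map_neg, Complex.conj_ofReal, Complex.conj_I, norm_neg, PiLp.neg_apply] <;>
    push_cast <;> ring

theorem continuous_helVec (σ : ℝ) : Continuous (helVec σ) := by
  have h : ∀ j : Fin 3, Continuous fun η : R3 ↦ η j := fun j ↦ by fun_prop
  have h0 := h 0
  have h1 := h 1
  have h2 := h 2
  refine (PiLp.continuous_toLp 2 _).comp (continuous_pi fun i ↦ ?_)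
  fin_cases i <;> simp <;> fun_prop

theorem contDiffAt_helVec (σ : ℝ) {η : R3} (hη : η ≠ 0) :
    ContDiffAt ℝ (⊤ : ℕ∞) (helVec σ) η := by
  have hc : ∀ j : Fin 3, ContDiffAt ℝ (⊤ : ℕ∞) (fun η : R3 ↦ η j) η := fun j ↦
    (EuclideanSpace.proj j : R3 →L[ℝ] ℝ).contDiff.contDiffAt
  have hn : ContDiffAt ℝ (⊤ : ℕ∞) (fun η : R3 ↦ ‖η‖) η := contDiffAt_norm ℝ hη
  have hC : ∀ {f : R3 → ℝ}, ContDiffAt ℝ (⊤ : ℕ∞) f η →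
      ContDiffAt ℝ (⊤ : ℕ∞) (fun x ↦ (f x : ℂ)) η := fun hf ↦
    Complex.ofRealCLM.contDiff.contDiffAt.comp η hf
  have hsm : ∀ i, ContDiffAt ℝ (⊤ : ℕ∞) (fun η ↦ helVec σ η i) η := by
    intro i
    fin_cases i
    · exact (hC ((hc 2).mul (hc 0))).neg.add
        (contDiffAt_const.mul (hC ((contDiffAt_const.mul hn).mul (hc 1))))
    · exact (hC ((hc 2).mul (hc 1))).neg.sub
        (contDiffAt_const.mul (hC ((contDiffAt_const.mul hn).mul (hc 0))))
    · exact hC ((hn.pow 2).sub ((hc 2).pow 2))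
  have hpi : ContDiffAt ℝ (⊤ : ℕ∞) (fun η ↦ fun i ↦ helVec σ η i) η := contDiffAt_pi.2 hsm
  exact ((PiLp.continuousLinearEquiv 2 ℝ (fun _ : Fin 3 ↦ ℂ)).symm.contDiff.contDiffAt).comp η hpi

/-- An even cutoff function concentrated near `p` and `-p`. -/
def evenBump {δ : ℝ} (hδ : 0 < δ) (p η : R3) : ℝ :=
  (⟨δ / 2, δ, by positivity, by linarith⟩ : ContDiffBump (0 : R3)) (η - p) +
    (⟨δ / 2, δ, by positivity, by linarith⟩ : ContDiffBump (0 : R3)) (η + p)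

section Bump

variable {δ : ℝ} (hδ : 0 < δ) (p : R3)

theorem contDiff_evenBump : ContDiff ℝ (⊤ : ℕ∞) (evenBump hδ p) :=
  ((ContDiffBump.contDiff _).comp (contDiff_id.sub contDiff_const)).add
    ((ContDiffBump.contDiff _).comp (contDiff_id.add contDiff_const))

theorem evenBump_nonneg (η : R3) : 0 ≤ evenBump hδ p η :=
  add_nonneg (ContDiffBump.nonneg _) (ContDiffBump.nonneg _)

theorem evenBump_neg (η : R3) : evenBump hδ p (-η) = evenBump hδ p η := by
  rw [evenBump, evenBump, show -η - p = -(η + p) by abel, show -η + p = -(η - p) by abel,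
    ContDiffBump.neg, ContDiffBump.neg, add_comm]

theorem evenBump_ne {η : R3} (h : evenBump hδ p η ≠ 0) :
    ∃ ε : ℝ, (ε = 1 ∨ ε = -1) ∧ ‖η - ε • p‖ < δ := by
  by_contra! hcon
  have h1 := hcon 1 (Or.inl rfl)
  have h2 := hcon (-1) (Or.inr rfl)
  rw [one_smul] at h1
  rw [neg_smul, one_smul, sub_neg_eq_add] at h2
  refine h ?_
  rw [evenBump, ContDiffBump.zero_of_le_dist _ (by simpa using h1),
    ContDiffBump.zero_of_le_dist _ (by simpa using h2), add_zero]

theorem evenBump_pos : 0 < evenBump hδ p p := by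
  refine add_pos_of_pos_of_nonneg ?_ (ContDiffBump.nonneg _)
  rw [sub_self]
  exact ContDiffBump.pos_of_mem_ball _ (by simpa using hδ)

/-- The field of vectors of helicity `σ` concentrated near `p` and `-p`. -/
def bumpField (σ : ℝ) (η : R3) : C3 := evenBump hδ p η • helVec σ η

theorem bumpField_ne {σ : ℝ} {η : R3} (h : bumpField hδ p σ η ≠ 0) :
    ∃ ε : ℝ, (ε = 1 ∨ ε = -1) ∧ ‖η - ε • p‖ < δ := by
  refine evenBump_ne hδ p fun h0 ↦ h ?_
  rw [bumpField, h0, zero_smul]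

theorem bumpField_zero (hδ' : δ ≤ 1 / 10) (hp : 1 ≤ ‖p‖) (hp' : ‖p‖ ≤ 3) (σ : ℝ) (η : R3)
    (hη : ‖η‖ < 1 / 2 ∨ 4 < ‖η‖) : bumpField hδ p σ η = 0 := by
  by_contra h
  obtain ⟨ε, hε, h1⟩ := bumpField_ne hδ p h
  have h2 : ‖ε • p‖ = ‖p‖ := by
    rw [norm_smul]; rcases hε with rfl | rfl <;> simp
  have h3 := abs_norm_sub_norm_le η (ε • p)
  rw [h2, abs_le] at h3
  -- The support satisfies `9/10 ≤ |η| ≤ 31/10`, inside the band.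
  rcases hη with h | h <;> linarith

theorem bumpField_neg (σ : ℝ) (η : R3) : bumpField hδ p σ (-η) = cj (bumpField hδ p σ η) := by
  rw [bumpField, bumpField, evenBump_neg, helVec_neg, cj.map_smul]

theorem isHel_bumpField {σ : ℝ} (hσ : σ ^ 2 = 1) (η : R3) : IsHel σ η (bumpField hδ p σ η) := by
  have h := isHel_helVec hσ η
  rw [IsHel] at h ⊢
  rw [bumpField, ← Complex.coe_smul, crossC_smul_right, smul_comm, h, smul_comm]

theorem contDiff_bumpField (hδ' : δ ≤ 1 / 10) (hp : 1 ≤ ‖p‖) (hp' : ‖p‖ ≤ 3) (σ : ℝ) :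
    ContDiff ℝ (⊤ : ℕ∞) (bumpField hδ p σ) := by
  refine contDiff_iff_contDiffAt.2 fun η ↦ ?_
  by_cases hη : η = 0
  · have h : bumpField hδ p σ =ᶠ[nhds η] fun _ ↦ 0 := by
      rw [hη]
      filter_upwards [Metric.ball_mem_nhds (0 : R3) (by norm_num : (0 : ℝ) < 1 / 2)] with x hx
      exact bumpField_zero hδ p hδ' hp hp' σ x (Or.inl (by simpa using hx))
    exact contDiffAt_const.congr_of_eventuallyEq h
  · exact (contDiff_evenBump hδ p).contDiffAt.smul (contDiffAt_helVec σ hη)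

end Bump

/-- Three frequencies of sum zero. -/
def center : Fin 3 → R3 := ![!₂[1, 0, 0], !₂[0, 2, 0], !₂[-1, -2, 0]]

theorem norm_center_zero : ‖center 0‖ = 1 := by
  have h := norm_sq_R3 (center 0)
  have h' := norm_nonneg (center 0)
  rw [show center 0 0 = 1 from rfl, show center 0 1 = 0 from rfl, show center 0 2 = 0 from rfl] at h
  nlinarith

theorem norm_center_one : ‖center 1‖ = 2 := by
  have h := norm_sq_R3 (center 1)
  have h' := norm_nonneg (center 1)
  rw [show center 1 0 = 0 from rfl, show center 1 1 = 2 from rfl, show center 1 2 = 0 from rfl] at h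
  nlinarith

theorem norm_center_two : ‖center 2‖ = √5 := by
  have h := norm_sq_R3 (center 2)
  rw [show center 2 0 = -1 from rfl, show center 2 1 = -2 from rfl, show center 2 2 = 0 from rfl]
    at h
  rw [eq_comm, Real.sqrt_eq_iff_mul_self_eq (by norm_num) (norm_nonneg _), ← sq, h]
  norm_num

theorem norm_center_bounds (i : Fin 3) : 1 ≤ ‖center i‖ ∧ ‖center i‖ ≤ 3 := by
  have h1 : 1 ≤ √5 := Real.one_le_sqrt.2 (by norm_num)
  have h2 : √5 ≤ 3 := Real.sqrt_le_iff.2 (by norm_num)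
  fin_cases i
  · exact ⟨norm_center_zero.ge, by norm_num [norm_center_zero]⟩
  · exact ⟨by norm_num [norm_center_one], by norm_num [norm_center_one]⟩
  · exact ⟨norm_center_two.symm ▸ h1, norm_center_two.symm ▸ h2⟩

theorem abs_coord_sub_lt {δ ε s : ℝ} (hs : 0 < s) {ξ p : R3} (h : ‖s⁻¹ • ξ - ε • p‖ < δ)
    (i : Fin 3) : |ξ i - s * (ε * p i)| < δ * s := by
  have h1 := (PiLp.norm_apply_le (s⁻¹ • ξ - ε • p) i).trans_lt h
  have h2 : ξ i - s * (ε * p i) = s * ((s⁻¹ • ξ - ε • p) i) := by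
    simp
    field_simp
  rw [h2, abs_mul, abs_of_pos hs, mul_comm]
  exact mul_lt_mul_of_pos_right h1 hs

/-- Coordinate bounds for a frequency near `± s p`. -/
theorem abs_coord_bounds {δ ε s : ℝ} (hδ : δ ≤ 1 / 10) (hε : ε = 1 ∨ ε = -1) (hs : 0 < s)
    {ξ p : R3} (h : ‖s⁻¹ • ξ - ε • p‖ < δ) (i : Fin 3) :
    s * |p i| - s / 10 ≤ |ξ i| ∧ |ξ i| ≤ s * |p i| + s / 10 := by
  have h1 := abs_coord_sub_lt hs h i
  have h2 : |s * (ε * p i)| = s * |p i| := by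
    rw [abs_mul, abs_mul, abs_of_pos hs]
    rcases hε with rfl | rfl <;> simp
  have h3 := abs_abs_sub_abs_le_abs_sub (ξ i) (s * (ε * p i))
  rw [h2] at h3
  have h4 : δ * s ≤ s / 10 := by nlinarith
  have h5 := abs_le.1 (h3.trans (h1.le.trans h4))
  constructor <;> linarith [h5.1, h5.2]

theorem zpow_mul_le {Q : ℝ} (hQ : 100 ≤ Q) {k l : ℤ} (h : k < l) : 100 * Q ^ k ≤ Q ^ l := by
  have h1 : Q ^ (k + 1) ≤ Q ^ l := zpow_le_zpow_right₀ (by linarith) (by omega)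
  rw [zpow_add₀ (by linarith), zpow_one] at h1
  have h2 : 0 < Q ^ k := by positivity
  nlinarith

/-- In units of their scales the frequencies are close to `±(1,0,0)`, `±(0,2,0)` and `±(1,2,0)`. In
the first coordinate the first and third must balance, in the second coordinate the second and
third; scales that differ do so by a factor of at least 100, which the tolerance 1/10 cannot absorb.
-/
theorem sameScale_bumpField {Q δ : ℝ} (hQ : 100 ≤ Q) (hδ : 0 < δ) (hδ' : δ ≤ 1 / 10)
    (σ : Fin 3 → ℝ) : SameScale Q (bumpField hδ (center 0) (σ 0)) (bumpField hδ (center 1) (σ 1))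
      (bumpField hδ (center 2) (σ 2)) := by
  intro ξ η k l m h0 h1 h2
  obtain ⟨ε₀, hε₀, h0⟩ := bumpField_ne hδ _ h0
  obtain ⟨ε₁, hε₁, h1⟩ := bumpField_ne hδ _ h1
  obtain ⟨ε₂, hε₂, h2⟩ := bumpField_ne hδ _ h2
  have hA : 0 < Q ^ k := by positivity
  have hB : 0 < Q ^ l := by positivity
  have hC : 0 < Q ^ m := by positivity
  obtain ⟨a1, a2⟩ := abs_coord_bounds hδ' hε₀ hA h0 0
  obtain ⟨a3, a4⟩ := abs_coord_bounds hδ' hε₀ hA h0 1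
  obtain ⟨b1, b2⟩ := abs_coord_bounds hδ' hε₁ hB h1 0
  obtain ⟨b3, b4⟩ := abs_coord_bounds hδ' hε₁ hB h1 1
  obtain ⟨c1, c2⟩ := abs_coord_bounds hδ' hε₂ hC h2 0
  obtain ⟨c3, c4⟩ := abs_coord_bounds hδ' hε₂ hC h2 1
  simp [center] at a1 a2 a3 a4 b1 b2 b3 b4 c1 c2 c3 c4
  have t0 : |-ξ 0 - η 0| ≤ |ξ 0| + |η 0| := by
    calc _ ≤ |-ξ 0| + |η 0| := abs_sub _ _
      _ = _ := by rw [abs_neg]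
  have t1 : |-ξ 1 - η 1| ≤ |ξ 1| + |η 1| := by
    calc _ ≤ |-ξ 1| + |η 1| := abs_sub _ _
      _ = _ := by rw [abs_neg]
  have s0 : |ξ 0| ≤ |-ξ 0 - η 0| + |η 0| := by
    calc |ξ 0| = |-(-ξ 0 - η 0) - η 0| := by congr 1; ring
      _ ≤ |-(-ξ 0 - η 0)| + |η 0| := abs_sub _ _
      _ = _ := by rw [abs_neg]
  have r1 : |η 1| ≤ |-ξ 1 - η 1| + |ξ 1| := by
    calc |η 1| = |-(-ξ 1 - η 1) - ξ 1| := by congr 1; ring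
      _ ≤ |-(-ξ 1 - η 1)| + |ξ 1| := abs_sub _ _
      _ = _ := by rw [abs_neg]
  -- If `l` exceeds both other scales, the second coordinate is unbalanced; otherwise the first one
  -- is.
  have km : k = m := by
    rcases lt_trichotomy k m with h | h | h
    · exfalso
      have e1 := zpow_mul_le hQ h
      rcases lt_or_ge m l with h' | h'
      · have e2 := zpow_mul_le hQ h'
        linarith
      · have e2 : Q ^ l ≤ Q ^ m := zpow_le_zpow_right₀ (by linarith) h'
        linarith
    · exact h
    · exfalso
      have e1 := zpow_mul_le hQ h
      rcases lt_or_ge k l with h' | h'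
      · have e2 := zpow_mul_le hQ h'
        linarith
      · have e2 : Q ^ l ≤ Q ^ k := zpow_le_zpow_right₀ (by linarith) h'
        linarith
  subst km
  refine ⟨rfl, ?_⟩
  rcases lt_trichotomy l k with h | h | h
  · have e1 := zpow_mul_le hQ h
    linarith
  · exact h
  · have e1 := zpow_mul_le hQ h
    linarith

/-- The symmetrized kernel of the trilinear form. -/
def symKernel (F G H : R3 → C3) (p : R3 × R3) : ℂ := triKernel F G H p + triKernel G F H p.swap

theorem continuous_triKernel {F G H : R3 → C3} (hF : Continuous F) (hG : Continuous G)
    (hH : Continuous H) : Continuous (triKernel F G H) := by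
  have h0 : Continuous fun p : R3 × R3 ↦ F p.1 := hF.comp continuous_fst
  have h1 : Continuous fun p : R3 × R3 ↦ G p.2 := hG.comp continuous_snd
  have h2 : Continuous fun p : R3 × R3 ↦ H (-p.1 - p.2) := hH.comp (by fun_prop)
  have hd : Continuous fun p : R3 × R3 ↦ dotC (G p.2) (H (-p.1 - p.2)) :=
    (dotC.continuous.comp h1).clm_apply h2
  have hs : Continuous fun p : R3 × R3 ↦ ∑ j, F p.1 j * (2 * Real.pi * Complex.I * (p.2 j : ℂ)) :=
    continuous_finsetSum _ fun j _ ↦ by fun_prop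
  exact hs.mul hd

theorem continuous_symKernel {F G H : R3 → C3} (hF : Continuous F) (hG : Continuous G)
    (hH : Continuous H) : Continuous (symKernel F G H) :=
  (continuous_triKernel hF hG hH).add ((continuous_triKernel hG hF hH).comp continuous_swap)

theorem triKernel_neg {F G H : R3 → C3} (hF : ∀ ξ, F (-ξ) = cj (F ξ)) (hG : ∀ ξ, G (-ξ) = cj (G ξ))
    (hH : ∀ ξ, H (-ξ) = cj (H ξ)) (p : R3 × R3) :
    triKernel F G H (-p) = starRingEnd ℂ (triKernel F G H p) := by
  simp only [triKernel, Prod.fst_neg, Prod.snd_neg, hF, hG, map_mul, map_sum]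
  rw [show - -p.1 - -p.2 = -(-p.1 - p.2) by abel, hH, dotC_cj]
  congr 1
  refine Finset.sum_congr rfl fun j _ ↦ ?_
  simp [cj_apply, Complex.conj_ofNat]

theorem symKernel_neg {F G H : R3 → C3} (hF : ∀ ξ, F (-ξ) = cj (F ξ)) (hG : ∀ ξ, G (-ξ) = cj (G ξ))
    (hH : ∀ ξ, H (-ξ) = cj (H ξ)) (p : R3 × R3) :
    symKernel F G H (-p) = starRingEnd ℂ (symKernel F G H p) := by
  rw [symKernel, symKernel, map_add, ← triKernel_neg hF hG hH, ← triKernel_neg hG hF hH]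
  rfl

theorem symKernel_mul {c₀ c₁ c₂ : R3 → ℝ} (F G H : R3 → C3) (p : R3 × R3) :
    symKernel (fun ξ ↦ c₀ ξ • F ξ) (fun ξ ↦ c₁ ξ • G ξ) (fun ξ ↦ c₂ ξ • H ξ) p =
      ((c₀ p.1 * c₁ p.2 * c₂ (-p.1 - p.2) : ℝ) : ℂ) * symKernel F G H p := by
  simp only [symKernel, triKernel, ← Complex.coe_smul, PiLp.smul_apply, smul_eq_mul, map_smul,
    smul_apply, mul_assoc, ← Finset.mul_sum, Prod.fst_swap, Prod.snd_swap]
  rw [show -p.2 - p.1 = -p.1 - p.2 by abel]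
  push_cast
  ring

theorem integral_symKernel {F G H : R3 → C3}
    (h : Integrable (triKernel F G H) (volume.prod volume))
    (h' : Integrable (triKernel G F H) (volume.prod volume)) :
    Integrable (symKernel F G H) (volume.prod volume) ∧
    ∫ p, symKernel F G H p ∂(volume.prod volume) = triForm F G H + triForm G F H := by
  have h2 : Integrable (fun p : R3 × R3 ↦ triKernel G F H p.swap) (volume.prod volume) := h'.swap
  refine ⟨h.add h2, ?_⟩
  have h3 : ∫ p, symKernel F G H p ∂(volume.prod volume) =
    ∫ p, (triKernel F G H p + triKernel G F H p.swap) ∂(volume.prod volume) := rfl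
  rw [h3, integral_add h h2, integral_prod_swap (f := triKernel G F H)]
  rfl

/-- The explicit value is `8π√5 (3σ₀σ₁σ₂ + √5(2σ₀ - σ₁))`. If it vanished, squaring would give `9 =
5(5 - 4σ₀σ₁)`, that is `σ₀σ₁ = 4/5`, impossible for a product of signs. -/
theorem symKernel_center_re (σ : Fin 3 → ℝ) (hσ : ∀ i, σ i ^ 2 = 1) :
    (symKernel (helVec (σ 0)) (helVec (σ 1)) (helVec (σ 2)) (center 0, center 1)).re ≠ 0 := by
  have e2 : -center 0 - center 1 = center 2 := by
    apply R3_ext <;> simp [center]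
  have e2' : -center 1 - center 0 = center 2 := by rw [← e2]; abel
  have hval : symKernel (helVec (σ 0)) (helVec (σ 1)) (helVec (σ 2)) (center 0, center 1) =
      ((8 * Real.pi * √5 * (3 * (σ 0 * σ 1 * σ 2) + √5 * (2 * σ 0 - σ 1)) : ℝ) : ℂ) := by
    have h5 : ((√5 : ℝ) : ℂ) ^ 2 = 5 := by
      rw [← Complex.ofReal_pow, Real.sq_sqrt (by norm_num)]; norm_num
    simp only [symKernel, triKernel, Prod.fst_swap, Prod.snd_swap]
    rw [e2, e2', dotC_apply, dotC_apply]
    simp only [Fin.sum_univ_three, helVec_zero', helVec_one', helVec_two', norm_center_zero,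
      norm_center_one, norm_center_two]
    simp [center]
    linear_combination (24 * Real.pi * √5 * (σ 0 * σ 1 * σ 2) * (Complex.I ^ 2 - 1) -
      80 * Real.pi * σ 0 + 40 * Real.pi * σ 1 : ℂ) * Complex.I_sq -
      (8 * Real.pi * (2 * σ 0 - σ 1) : ℂ) * h5
  rw [hval, Complex.ofReal_re]
  have h5 : √5 ^ 2 = (5 : ℝ) := Real.sq_sqrt (by norm_num)
  have h50 : √5 ≠ 0 := (Real.sqrt_pos.2 (by norm_num)).ne'
  refine mul_ne_zero (mul_ne_zero (mul_ne_zero (by norm_num) Real.pi_ne_zero) h50) fun h ↦ ?_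
  have h1 : (3 * (σ 0 * σ 1 * σ 2)) ^ 2 = (√5 * (2 * σ 0 - σ 1)) ^ 2 := by
    rw [eq_neg_of_add_eq_zero_left h, neg_sq]
  have h2 : (3 * (σ 0 * σ 1 * σ 2)) ^ 2 = 9 * (σ 0 ^ 2 * σ 1 ^ 2 * σ 2 ^ 2) := by ring
  have h3 : (√5 * (2 * σ 0 - σ 1)) ^ 2 =
      √5 ^ 2 * (4 * σ 0 ^ 2 + σ 1 ^ 2 - 4 * (σ 0 * σ 1)) := by ring
  rw [h2, h3, h5, hσ, hσ, hσ] at h1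
  have h4 : σ 0 * σ 1 = 4 / 5 := by linarith
  have h6 : (σ 0 * σ 1) ^ 2 = 1 := by rw [mul_pow, hσ, hσ, one_mul]
  rw [h4] at h6
  norm_num at h6

/-- For suitable cutoffs, the trilinear form does not vanish on fields of given helicities. -/
theorem exists_triForm_ne (σ : Fin 3 → ℝ) (hσ : ∀ i, σ i ^ 2 = 1) :
    ∃ (δ : ℝ) (hδ : 0 < δ), δ ≤ 1 / 10 ∧
      ∀ Z : Fin 3 → R3 → C3, (∀ i η, Z i η = (‖η‖ ^ 3)⁻¹ • bumpField hδ (center i) (σ i) η) →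
        (∀ i, Continuous (Z i)) →
        Integrable (triKernel (Z 0) (Z 1) (Z 2)) (volume.prod volume) →
        Integrable (triKernel (Z 1) (Z 0) (Z 2)) (volume.prod volume) →
        (triForm (Z 0) (Z 1) (Z 2) + triForm (Z 1) (Z 0) (Z 2)).re ≠ 0 := by
  set S := symKernel (helVec (σ 0)) (helVec (σ 1)) (helVec (σ 2)) with hS
  set v := (S (center 0, center 1)).re with hv
  have hv0 : v ≠ 0 := symKernel_center_re σ hσ
  have hSc : Continuous S :=
    continuous_symKernel (continuous_helVec _) (continuous_helVec _) (continuous_helVec _)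
  have hSn : ∀ p, (S (-p)).re = (S p).re := fun p ↦ by
    rw [hS, symKernel_neg (helVec_neg _) (helVec_neg _) (helVec_neg _), Complex.conj_re]
  -- Multiplying by the value `v` at the centre fixes the sign: near the centre the real part has
  -- the sign of `v`, so there is no cancellation on small supports.
  have hopen : IsOpen {p : R3 × R3 | 0 < v * (S p).re} :=
    isOpen_lt continuous_const (continuous_const.mul (Complex.continuous_re.comp hSc))
  have hmem : (center 0, center 1) ∈ {p : R3 × R3 | 0 < v * (S p).re} := by
    change 0 < v * v
    exact mul_self_pos.2 hv0
  obtain ⟨r, hr, hball⟩ := Metric.isOpen_iff.1 hopen _ hmem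
  -- The cutoffs must stay in the ball of constant sign and satisfy the separation bound 1/10.
  have hδ : 0 < min r (1 / 10) := lt_min hr (by norm_num)
  have hδ' : min r (1 / 10) ≤ 1 / 10 := min_le_right _ _
  refine ⟨min r (1 / 10), hδ, hδ', fun Z hZ hZc hi hi' ↦ ?_⟩
  set δ := min r (1 / 10) with hδdef
  obtain ⟨hint, hval⟩ := integral_symKernel hi hi'
  set c : Fin 3 → R3 → ℝ := fun i η ↦ (‖η‖ ^ 3)⁻¹ * evenBump hδ (center i) η with hc
  have hZ' : ∀ i, Z i = fun η ↦ c i η • helVec (σ i) η := fun i ↦ by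
    ext1 η
    rw [hZ, bumpField, smul_smul]
  have hker : ∀ p, symKernel (Z 0) (Z 1) (Z 2) p =
      ((c 0 p.1 * c 1 p.2 * c 2 (-p.1 - p.2) : ℝ) : ℂ) * S p := fun p ↦ by
    rw [hZ' 0, hZ' 1, hZ' 2, symKernel_mul]
  have hcn : ∀ i η, 0 ≤ c i η := fun i η ↦
    mul_nonneg (by positivity) (evenBump_nonneg hδ _ _)
  have hcpos : ∀ i, 0 < c i (center i) := fun i ↦
    mul_pos (inv_pos.2 (pow_pos (one_pos.trans_le (norm_center_bounds i).1) 3))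
      (evenBump_pos hδ _)
  have hcne : ∀ {i η}, c i η ≠ 0 → ∃ ε : ℝ, (ε = 1 ∨ ε = -1) ∧ ‖η - ε • center i‖ < δ :=
    fun h ↦ evenBump_ne hδ _ (right_ne_zero_of_mul h)
  set φ : R3 × R3 → ℝ := fun p ↦ v * (symKernel (Z 0) (Z 1) (Z 2) p).re with hφ
  have hφ' : ∀ p, φ p = (c 0 p.1 * c 1 p.2 * c 2 (-p.1 - p.2)) * (v * (S p).re) := fun p ↦ by
    simp only [hφ]
    rw [hker, Complex.re_ofReal_mul]
    ring
  have hφc : Continuous φ := continuous_const.mul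
    (Complex.continuous_re.comp (continuous_symKernel (hZc 0) (hZc 1) (hZc 2)))
  have hφi : Integrable φ (volume.prod volume) := hint.re.const_mul v
  have hφn : 0 ≤ φ := by
    intro p
    rw [Pi.zero_apply, hφ']
    have hcc : 0 ≤ c 0 p.1 * c 1 p.2 * c 2 (-p.1 - p.2) :=
      mul_nonneg (mul_nonneg (hcn _ _) (hcn _ _)) (hcn _ _)
    by_cases h0 : c 0 p.1 * c 1 p.2 * c 2 (-p.1 - p.2) = 0
    · rw [h0, zero_mul]
    obtain ⟨ε₀, hε₀, b0⟩ := hcne (left_ne_zero_of_mul (left_ne_zero_of_mul h0))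
    obtain ⟨ε₁, hε₁, b1⟩ := hcne (right_ne_zero_of_mul (left_ne_zero_of_mul h0))
    obtain ⟨ε₂, hε₂, b2⟩ := hcne (right_ne_zero_of_mul h0)
    refine mul_nonneg hcc ?_
    -- The even cutoffs also live near the negatives of the centres. Since the three frequencies sum
    -- to zero, their signs cannot be mixed; the fully reflected case is covered by the evenness of
    -- the real part of `S`.
    have key : ε₀ = ε₁ := by
      have x0 := abs_lt.1 ((PiLp.norm_apply_le _ 0).trans_lt b0)
      have x1 := abs_lt.1 ((PiLp.norm_apply_le _ 1).trans_lt b0)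
      have y0 := abs_lt.1 ((PiLp.norm_apply_le _ 0).trans_lt b1)
      have y1 := abs_lt.1 ((PiLp.norm_apply_le _ 1).trans_lt b1)
      have z0 := abs_lt.1 ((PiLp.norm_apply_le _ 0).trans_lt b2)
      have z1 := abs_lt.1 ((PiLp.norm_apply_le _ 1).trans_lt b2)
      simp [center] at x0 x1 y0 y1 z0 z1
      rcases hε₀ with rfl | rfl <;> rcases hε₁ with rfl | rfl <;>
        rcases hε₂ with rfl | rfl <;> first | rfl | (exfalso; linarith)
    subst key
    have hmul : ε₀ • p ∈ Metric.ball (center 0, center 1) r := by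
      rw [Metric.mem_ball, Prod.dist_eq, max_lt_iff]
      have hsq : ε₀ * ε₀ = 1 := by rcases hε₀ with rfl | rfl <;> norm_num
      have hab : |ε₀| = 1 := by rcases hε₀ with rfl | rfl <;> norm_num
      have hd : ∀ x y : R3, ‖x - ε₀ • y‖ < δ → dist (ε₀ • x) y < r := by
        intro x y hxy
        rw [dist_eq_norm]
        have : ε₀ • x - y = ε₀ • (x - ε₀ • y) := by
          rw [smul_sub, smul_smul, hsq, one_smul]
        rw [this, norm_smul, Real.norm_eq_abs, hab, one_mul]
        exact hxy.trans_le (min_le_left _ _)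
      exact ⟨hd _ _ b0, hd _ _ b1⟩
    have hpos : 0 < v * (S (ε₀ • p)).re := hball hmul
    rcases hε₀ with rfl | rfl
    · rw [one_smul] at hpos
      exact hpos.le
    · rw [neg_smul, one_smul, hSn] at hpos
      exact hpos.le
  have hne : φ (center 0, center 1) ≠ 0 := by
    rw [hφ']
    have e2 : -center 0 - center 1 = center 2 := by
      apply R3_ext <;> simp [center]
    change c 0 (center 0) * c 1 (center 1) * c 2 (-center 0 - center 1) * (v * v) ≠ 0
    rw [e2]
    have := hcpos 0
    have := hcpos 1
    have := hcpos 2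
    positivity
  have hpos : 0 < ∫ p, φ p ∂(volume.prod volume) := by
    rw [integral_pos_iff_support_of_nonneg hφn hφi]
    exact (hφc.isOpen_support).measure_pos _ ⟨_, hne⟩
  have hfin : ∫ p, φ p ∂(volume.prod volume) =
      v * (triForm (Z 0) (Z 1) (Z 2) + triForm (Z 1) (Z 0) (Z 2)).re := by
    rw [integral_const_mul, ← hval]
    congr 1
    exact integral_re hint
  rw [hfin] at hpos
  exact right_ne_zero_of_mul hpos.ne'

/-! ### Cascade operators as averages -/

/-- The profiles of the wavelets of a cascade operator. -/
structure IsProfile (a b : ℝ) (g : R3 → C3) : Prop where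
  smooth : ContDiff ℝ (⊤ : ℕ∞) g
  zero : ∀ ξ, (‖ξ‖ < a ∨ b < ‖ξ‖) → g ξ = 0
  neg : ∀ ξ, g (-ξ) = cj (g ξ)

theorem isAveragedForm_hel {a b Q : ℝ} (ha : 0 < a) (hab : a ≤ b) (hQ : 100 ≤ Q)
    {g : Fin 3 → R3 → C3} (hg : ∀ i, IsProfile a b (g i)) {σ : Fin 3 → ℝ}
    (hσ : ∀ i, σ i ^ 2 = 1) :
    ∃ T, IsAveragedForm T ∧ ∀ u v w, HasSum (fun n : ℤ ↦ (Q ^ n) ^ (5 / 2 : ℝ) *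
      ((coef (g 0) (Q ^ n) fun ξ ↦ hel (σ 0) ξ (u.hat ξ)).re *
        (coef (g 1) (Q ^ n) fun ξ ↦ hel (σ 1) ξ (v.hat ξ)).re *
        (coef (g 2) (Q ^ n) fun ξ ↦ hel (σ 2) ξ (w.hat ξ)).re)) (T u v w) := by
  obtain ⟨δ, hδ, hδ', hne⟩ := exists_triForm_ne σ hσ
  let ℓ : ∀ i, Leg a b (σ i) := fun i ↦
    { g := g i
      Y := bumpField hδ (center i) (σ i)
      g_smooth := (hg i).smooth
      g_zero := (hg i).zero
      g_neg := (hg i).neg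
      Y_smooth := contDiff_bumpField hδ _ hδ' (norm_center_bounds i).1 (norm_center_bounds i).2 _
      Y_zero := bumpField_zero hδ _ hδ' (norm_center_bounds i).1 (norm_center_bounds i).2 _
      Y_neg := bumpField_neg hδ _ _
      Y_hel := isHel_bumpField hδ _ (hσ i) }
  have hκ := hne (fun i ↦ (ℓ i).Z) (fun _ _ ↦ rfl) (fun i ↦ (ℓ i).continuous_Z)
    (integrable_triKernel_Z _ _ _) (integrable_triKernel_Z _ _ _)
  set κ : ℝ := (triForm (ℓ 0).Z (ℓ 1).Z (ℓ 2).Z + triForm (ℓ 1).Z (ℓ 0).Z (ℓ 2).Z).re with hκ_def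
  have hS : SameScale Q (ℓ 0).Y (ℓ 1).Y (ℓ 2).Y := sameScale_bumpField hQ hδ hδ' σ
  have hV : (volume (shell a b)).toReal ≠ 0 := ENNReal.toReal_ne_zero.2
    ⟨volume_shell_ne_zero ha hab, volume_shell_ne_top a b⟩
  set d : ℝ := -(1 / 2) * ((volume (shell a b)).toReal⁻¹) ^ 3 with hd
  have hd0 : d ≠ 0 := mul_ne_zero (by norm_num) (pow_ne_zero 3 (inv_ne_zero hV))
  -- Division by the nonzero constant produced by the shell volumes and by the symmetrized form of
  -- the fields `Z`.
  refine ⟨_, (isAveragedForm_legs ℓ hQ ha hab hσ).smul (d * κ)⁻¹, fun u v w ↦ ?_⟩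
  have h1 := hasSum_triForm_mean (ℓ 0) (ℓ 1) (ℓ 2) ha (hσ 0) (hσ 1) (hσ 2) hQ hS u v w
  have h2 := hasSum_triForm_mean (ℓ 1) (ℓ 0) (ℓ 2) ha (hσ 1) (hσ 0) (hσ 2) hQ hS.swap v u w
  have hreal : ∀ {σ} (ℓ : Leg a b σ) (u : H10df) (n : ℤ),
      ℓ.amp Q u n = ((ℓ.amp Q u n).re : ℂ) := fun ℓ u n ↦
    Complex.ext rfl (by rw [ℓ.amp_im, Complex.ofReal_im])
  have hterm : ∀ n : ℤ, ((ℓ 0).amp Q u n * (ℓ 1).amp Q v n * (ℓ 2).amp Q w n *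
      (((Q ^ n) ^ (5 / 2 : ℝ) : ℝ) * triForm (ℓ 0).Z (ℓ 1).Z (ℓ 2).Z) +
      (ℓ 1).amp Q v n * (ℓ 0).amp Q u n * (ℓ 2).amp Q w n *
      (((Q ^ n) ^ (5 / 2 : ℝ) : ℝ) * triForm (ℓ 1).Z (ℓ 0).Z (ℓ 2).Z)) =
      (((Q ^ n) ^ (5 / 2 : ℝ) * (((ℓ 0).amp Q u n).re * ((ℓ 1).amp Q v n).re *
        ((ℓ 2).amp Q w n).re) : ℝ) : ℂ) *
        (triForm (ℓ 0).Z (ℓ 1).Z (ℓ 2).Z + triForm (ℓ 1).Z (ℓ 0).Z (ℓ 2).Z) := fun n ↦ by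
    rw [hreal (ℓ 0), hreal (ℓ 1), hreal (ℓ 2)]
    push_cast
    simp only [Complex.ofReal_re]
    ring
  have hval : ∀ x : ℝ, (d * κ)⁻¹ * (d * x) = κ⁻¹ * x := fun x ↦ by
    rw [mul_inv, mul_comm d⁻¹, mul_assoc, inv_mul_cancel_left₀ hd0]
  have h4 := (Complex.hasSum_re (h1.add h2)).mul_left κ⁻¹
  rw [← hval] at h4
  refine HasSum.congr_fun h4 fun n ↦ ?_
  rw [hterm, Complex.re_ofReal_mul, ← hκ_def, mul_comm _ κ, inv_mul_cancel_left₀ hκ]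
  rfl

theorem coef_hel_add {a b s : ℝ} (ha : 0 < a) (hs : 0 < s) {g : R3 → C3} (hg : IsProfile a b g)
    (u : H10df) : (coef g s fun ξ ↦ hel 1 ξ (u.hat ξ)) + (coef g s fun ξ ↦ hel (-1) ξ (u.hat ξ)) =
      coef g s u.hat := by
  have hL : MemLp g 2 volume :=
    hg.smooth.continuous.memLp_of_hasCompactSupport
      (HasCompactSupport.of_support_subset_isCompact (isCompact_closedBall (0 : R3) b) fun ξ hξ ↦ by
        rw [mem_closedBall_zero_iff]
        by_contra h
        exact hξ (hg.zero ξ (Or.inr (not_le.1 h))))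
  have hi : ∀ σ : ℝ, σ ^ 2 = 1 →
      Integrable fun ξ ↦ dotC (freqScale s g ξ) (hel σ ξ (u.hat ξ)) := fun σ hσ ↦
    (norm_coef_le hg.smooth.continuous hL ha (fun ξ h ↦ hg.zero ξ (Or.inl h)) hs u
      (stronglyMeasurable_hel σ u.measurable_hat) (fun ξ ↦ norm_hel_le hσ ξ _)).1
  rw [coef, coef, ← integral_add (hi 1 (by norm_num)) (hi (-1) (by norm_num))]
  refine integral_congr_ae (.of_forall fun ξ ↦ ?_)
  simp only
  rw [← map_add, hel_add_hel_neg]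

/-- Each coefficient is the sum of its two helicity coefficients; expanding the product gives eight
terms, one for each triple of signs. -/
theorem isAveragedForm_profile {a b Q : ℝ} (ha : 0 < a) (hab : a ≤ b) (hQ : 100 ≤ Q)
    {g : Fin 3 → R3 → C3} (hg : ∀ i, IsProfile a b (g i)) :
    ∃ T, IsAveragedForm T ∧ ∀ u v w, HasSum (fun n : ℤ ↦ (Q ^ n) ^ (5 / 2 : ℝ) *
      ((coef (g 0) (Q ^ n) u.hat).re * (coef (g 1) (Q ^ n) v.hat).re *
        (coef (g 2) (Q ^ n) w.hat).re)) (T u v w) := by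
  set sgn : Bool → ℝ := fun b ↦ if b then 1 else -1 with hsgn
  have hs : ∀ b, sgn b ^ 2 = 1 := by rintro (_ | _) <;> simp [hsgn]
  choose T hT h using fun s : Bool × Bool × Bool ↦
    isAveragedForm_hel ha hab hQ hg (σ := ![sgn s.1, sgn s.2.1, sgn s.2.2])
      (fun i ↦ by fin_cases i; exacts [hs _, hs _, hs _])
  refine ⟨_, IsAveragedForm.sum Finset.univ fun s _ ↦ hT s, fun u v w ↦ ?_⟩
  have h1 := hasSum_sum (s := Finset.univ) fun s _ ↦ h s u v w
  convert h1 using 1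
  · ext n
    have hp : 0 < Q ^ n := by positivity
    rw [← coef_hel_add ha hp (hg 0) u, ← coef_hel_add ha hp (hg 1) v,
      ← coef_hel_add ha hp (hg 2) w]
    simp only [Fintype.sum_prod_type, Fintype.sum_bool, hsgn]
    simp
    ring
  · simp only [Finset.sum_apply]

theorem freqScale_freqScale {s t : ℝ} (hs : 0 < s) (ht : 0 < t) (g : R3 → C3) :
    freqScale s (freqScale t g) = freqScale (t * s) g := by
  ext1 ξ
  rw [freqScale, freqScale, freqScale, smul_smul, smul_smul, mul_inv, Real.mul_rpow ht.le hs.le,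
    mul_comm (s ^ _)]

theorem IsProfile.freqScale {a b t : ℝ} (ht : 0 < t) {g : R3 → C3} (hg : IsProfile a b g) :
    IsProfile (t * a) (t * b) (freqScale t g) where
  smooth := by
    have h : ContDiff ℝ (⊤ : ℕ∞) fun ξ : R3 ↦ t⁻¹ • ξ := contDiff_id.const_smul t⁻¹
    exact (hg.smooth.comp h).const_smul (t ^ (-(3 / 2) : ℝ))
  zero ξ hξ := by
    rw [AveragedEuler.freqScale, hg.zero, smul_zero]
    rw [norm_smul, norm_inv, Real.norm_of_nonneg ht.le, inv_mul_lt_iff₀ ht, lt_inv_mul_iff₀ ht]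
    exact hξ
  neg ξ := by
    rw [AveragedEuler.freqScale, AveragedEuler.freqScale, smul_neg, hg.neg, cj.map_smul]

theorem IsWavelet.isProfile {ε : ℝ} {ψ : 𝓢(R3, C3)} (h : IsWavelet ε ψ) :
    IsProfile (1 - 2 * ε) (1 + 2 * ε) (profile ψ) where
  smooth := contDiff_profile ψ
  zero _ := h.profile_eq_zero
  neg := profile_neg h.1

/-- With `n = kN + r`, the wavelet at scale `qⁿ` is the profile rescaled by `q^r` at scale
`(q^N)^k`. Each residue class is thus a cascade of large ratio `q^N`, with the weight split
accordingly. -/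
theorem IsCascadeWith.isAveragedForm {ε : ℝ} (hε : 0 < ε) (hε' : 2 * ε < 1)
    {ψ : Fin 3 → 𝓢(R3, C3)} (hψ : ∀ i, IsWavelet ε (ψ i)) {C : BilinOp}
    (hC : IsCascadeWith ε ψ C) : IsAveragedForm fun u v w ↦ C u v w := by
  set q : ℝ := 1 + ε with hq
  have hq0 : 0 < q := by linarith
  obtain ⟨N, hN⟩ := pow_unbounded_of_one_lt 100 (by linarith : 1 < q)
  have hN0 : NeZero N := ⟨by rintro rfl; norm_num at hN⟩
  have hQ : 100 ≤ q ^ N := hN.le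
  choose T hT h using fun r : Fin N ↦ isAveragedForm_profile
    (a := q ^ (r : ℕ) * (1 - 2 * ε)) (b := q ^ (r : ℕ) * (1 + 2 * ε)) (Q := q ^ N)
    (mul_pos (pow_pos hq0 _) (by linarith))
    (mul_le_mul_of_nonneg_left (by linarith) (pow_pos hq0 _).le) hQ
    (g := fun i ↦ freqScale (q ^ (r : ℕ)) (profile (ψ i)))
    (fun i ↦ (hψ i).isProfile.freqScale (pow_pos hq0 _))
  have hsum : (fun u v w ↦ C u v w) =
      ∑ r : Fin N, ((q ^ (r : ℕ)) ^ (5 / 2 : ℝ)) • T r := by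
    ext u v w
    have h1 : HasSum (cascadeTerm ε ψ u v w) (C u v w) := hC u v w
    have h2 : ∀ r : Fin N, HasSum (fun n : ℤ ↦ cascadeTerm ε ψ u v w (n * N + r))
        ((q ^ (r : ℕ)) ^ (5 / 2 : ℝ) * T r u v w) := by
      intro r
      refine ((h r u v w).mul_left ((q ^ (r : ℕ)) ^ (5 / 2 : ℝ))).congr_fun fun n ↦ ?_
      have hp : (1 + ε) ^ (n * (N : ℤ) + (r : ℤ)) = q ^ (r : ℕ) * (q ^ N) ^ n := by
        rw [zpow_add₀ hq0.ne', mul_comm n, zpow_mul, zpow_natCast, zpow_natCast, mul_comm]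
      have hc : ∀ i (U : R3 → C3), coef (freqScale (q ^ (r : ℕ)) (profile (ψ i))) ((q ^ N) ^ n) U =
          coef (profile (ψ i)) (q ^ (r : ℕ) * (q ^ N) ^ n) U := fun i U ↦ by
        rw [coef, coef, freqScale_freqScale (by positivity) (by positivity)]
      rw [cascadeTerm_eq hε hψ, hp, hc, hc, hc, Real.mul_rpow (by positivity) (by positivity)]
      ring
    -- Regrouping the full series by quotient shows that it sums to the total of the residue class
    -- series.
    have h3 := ((Int.divModEquiv N).symm.hasSum_iff.2 h1).prod_fiberwise fun n ↦
      hasSum_fintype _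
    have h4 := h3.unique (hasSum_sum (s := Finset.univ) fun r _ ↦ h2 r)
    rw [h4]
    simp only [Finset.sum_apply, Pi.smul_apply, smul_eq_mul]
  rw [hsum]
  exact IsAveragedForm.sum _ fun r _ ↦ (hT r).smul _

set_option maxSynthPendingDepth 5 in
theorem IsLocalCascade.isAveragedEuler {ε : ℝ} (hε : 0 < ε) (hε' : 2 * ε < 1) {C : BilinOp}
    (hC : IsLocalCascade ε C) : IsAveragedEuler C := by
  rw [isAveragedEuler_iff]
  refine Submodule.span_induction (p := fun C _ ↦ IsAveragedForm fun u v w ↦ C u v w)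
    ?_ ?_ ?_ ?_ hC
  · rintro C ⟨ψ, hψ, hC⟩
    exact hC.isAveragedForm hε hε' hψ
  · exact IsAveragedForm.zero
  · exact fun _ _ _ _ h₁ h₂ ↦ h₁.add h₂
  · exact fun c _ _ h ↦ h.smul c

end

end AveragedEuler

theorem theorem3p2 :
    ∃ ε : ℝ, 0 < ε ∧ ∀ ε₀ : ℝ, 0 < ε₀ → ε₀ < ε →
      (∀ ψ : Fin 3 → SchwartzMap AveragedEuler.R3 AveragedEuler.C3,
        (∀ i, AveragedEuler.IsWavelet ε₀ (ψ i)) →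
          ∃ C : AveragedEuler.BilinOp, AveragedEuler.IsCascadeWith ε₀ ψ C) ∧
      ∀ C : AveragedEuler.BilinOp,
        AveragedEuler.IsLocalCascade ε₀ C → AveragedEuler.IsAveragedEuler C :=
  -- Only `2 * ε₀ < 1` is used, so any threshold up to 1/2 would serve.
  ⟨1 / 4, by norm_num, fun _ h₀ h₁ ↦ ⟨fun _ hψ ↦ AveragedEuler.exists_cascade h₀ (by linarith) hψ,
    fun _ hC ↦ hC.isAveragedEuler h₀ (by linarith)⟩⟩
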